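/- Let $T>0$, $\Omega=\,]0,1[$, $n_e\in\mathbb N$. Let $\alpha,\beta\in C^2([0,T])$ and $\gamma=\beta-\alpha$ with $0<\gamma_0<\gamma(t)<\gamma_1$ on $[0,T]$, $\alpha',\beta'\in L_2(0,T)$, $|\gamma'|\le\gamma'_{\max}$, $|\alpha'|\le\alpha'_{\max}$; let $u_{i0}\in H^1_0(\alpha(0),\beta(0))$, $\int_0^T\!\int_{\alpha(t)}^{\beta(t)} f_i^2\,dx\,dt<\infty$, and let $a_i:\mathbb R^{n_e}\to\mathbb R$ be Lipschitz continuous with constant $L_a$ and $0<m_a\le a_i\le M_a$ $(i=1,\dots,n_e)$. Put $b_1(y,t)=\frac{\alpha'(t)+\gamma'(t)y}{\gamma(t)}$, $b_2(t)=\gamma(t)^{-2}$, $l(w)=\gamma(t)\int_0^1 w\,dy$, $g_i(y,t)=f_i(\alpha(t)+\gamma(t)y,t)$, $v_{i0}(y)=u_{i0}(\alpha(0)+\gamma(0)y)$. Write $(\cdot,\cdot)$ and $\|\cdot\|$ for the inner product and norm of $L_2(\Omega)$. Let $\mathbf v=(v_1,\dots,v_{n_e})$ be a weak solution: $v_i\in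 L_\infty(0,T;H^1_0(\Omega)\cap H^2(\Omega))$, $\partial_t v_i\in L_2(0,T;L_2(\Omega))$, $v_i\in C([0,T];L_2(\Omega))$, $v_i(\cdot,0)=v_{i0}$, and for a.e. $t\in\,]0,T[$ and all $w\in H^1_0(\Omega)$ $$(\partial_t v_i,w)+a_i(l(v_1),\dots,l(v_{n_e}))\,b_2\,(\partial_y v_i,\partial_y w)-(b_1\partial_y v_i,w)=(g_i,w).$$ Let $k\ge1$, let $\mathcal T_h$ be a partition of $\Omega$ into finitely many intervals of maximal length $h$, let $S_h^k$ be the space of continuous functions on $[0,1]$ that vanish at $0$ and $1$ and are polynomials of degree at most $k$ on each interval of $\mathcal T_h$, and let $I_h$ be Lagrange interpolation into $S_h^k$ at $k+1$ distinct points of each closed interval of $\mathcal T_h$, its end points included. Let $\mathbf V=(V_1,\dots,V_{n_e})$ with $V_i(\cdot,t)\in S_h^k$ be the semidiscrete Galerkin solution: $V_i$ is absolutely continuous in $t\in[0,T]$, $V_i(\cdot,0)=I_hv_{i0}$, and for a.e. $t\in\,]0,T[$ and all $W\in S_h^k$ $$(\partial_t V_i,W)+a_i(l(V_1),\dots,l(V_{n_e}))\,b_2\,(\partial_y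 V_i,\partial_y W)-(b_1\partial_y V_i,W)=(g_i,W).$$ Suppose that the quantities $\sum_i\|v_{i0}\|_{H^{k+1}(\Omega)}$, $\sum_i\|v_i\|_{L_\infty(0,T;H^{k+1}(\Omega))}$, $\sum_i\|\partial_y v_i\|_{L_\infty(0,T;L_2(\Omega))}$, $\sum_i\|v_i\|_{L_2(0,T;H^{k+1}(\Omega))}$ and $\sum_i\|\partial_t v_i\|_{L_2(0,T;H^{k+1}(\Omega))}$ are finite. Then $$\|V_i(\cdot,t)-v_i(\cdot,t)\|\le C\,h^{k+1},\qquad t\in\,]0,T],\quad i=1,\dots,n_e,$$ where $C$ depends only on $n_e,T,\gamma_0,\gamma_1,\gamma'_{\max},\alpha'_{\max},m_a,M_a,L_a$ and on upper bounds for these five quantities; in particular $C$ does not depend on $h$, on $k$ (otherwise than through these bounds), on the partition, on the interpolation points or on $i$. -/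

import Mathlib

open Set MeasureTheory Filter Topology
open scoped ENNReal NNReal ContDiff Polynomial

namespace NonlocalFEM

noncomputable section

/-! ### Weak derivatives, Sobolev norms and `H₀¹` on a bounded interval `(a, b)` -/

/-- Test functions on `(a, b)`: the space `C_c^∞(a, b)`. -/
def IsTestFunction (a b : ℝ) (φ : ℝ → ℝ) : Prop :=
  ContDiff ℝ ∞ φ ∧ HasCompactSupport φ ∧ tsupport φ ⊆ Ioo a b

/-- `w` is a `j`-th order weak (distributional) derivative of `u` on `(a, b)`. The functions may
take values in a normed space: it is used for real functions of the space variable and for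
`L²(0,1)`-valued functions of time. -/
def IsWeakDeriv {E : Type*} [NormedAddCommGroup E] [NormedSpace ℝ E]
    (a b : ℝ) (j : ℕ) (u w : ℝ → E) : Prop :=
  LocallyIntegrableOn u (Ioo a b) ∧ LocallyIntegrableOn w (Ioo a b) ∧
    ∀ φ : ℝ → ℝ, IsTestFunction a b φ →
      ∫ x in Ioo a b, iteratedDeriv j φ x • u x = (-1 : ℝ) ^ j • ∫ x in Ioo a b, φ x • w x

open Classical in
/-- The first order weak derivative on `(a, b)` (unique up to null sets); the value is `0` if there
is none. -/
def weakDeriv {E : Type*} [NormedAddCommGroup E] [NormedSpace ℝ E]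
    (a b : ℝ) (u : ℝ → E) : ℝ → E :=
  if h : ∃ w, IsWeakDeriv a b 1 u w then h.choose else 0

/-- The `L²(a, b)` norm of the `j`-th weak derivative, `∞` if there is no weak derivative. -/
def weakDerivNorm (a b : ℝ) (j : ℕ) (u : ℝ → ℝ) : ℝ≥0∞ :=
  ⨅ (w : ℝ → ℝ) (_ : IsWeakDeriv a b j u w), eLpNorm w 2 (volume.restrict (Ioo a b))

/-- The norm of `H^m(a, b)`, with value `∞` outside of `H^m(a, b)`. -/
def sobolevNorm (a b : ℝ) (m : ℕ) (u : ℝ → ℝ) : ℝ≥0∞ :=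
  (∑ j ∈ Finset.range (m + 1), weakDerivNorm a b j u ^ 2) ^ (1 / 2 : ℝ)

/-- `u ∈ H₀¹(a, b)`: `u` is in `H¹(a, b)` and is a limit of test functions in `H¹(a, b)`. -/
def MemH10 (a b : ℝ) (u : ℝ → ℝ) : Prop :=
  sobolevNorm a b 1 u < ⊤ ∧
    ∃ φ : ℕ → ℝ → ℝ, (∀ m, IsTestFunction a b (φ m)) ∧
      Tendsto (fun m => sobolevNorm a b 1 (fun x => φ m x - u x)) atTop (𝓝 0)

/-- The Lebesgue space `L²(Ω)`, `Ω = (0, 1)`. -/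
abbrev L2Ω : Type := Lp ℝ 2 (volume.restrict (Ioo (0 : ℝ) 1))

/-- The norm of `L_p(0, T; H^m(Ω))`, `Ω = (0, 1)`. -/
def bochnerSobolevNorm (p : ℝ≥0∞) (T : ℝ) (m : ℕ) (u : ℝ → L2Ω) : ℝ≥0∞ :=
  eLpNorm (fun t => sobolevNorm 0 1 m (u t)) p (volume.restrict (Ioo 0 T))

/-! ### The data of the problem -/

/-- The data of the moving boundary problem: the boundary curves `α`, `β`, the diffusion
coefficients `a i`, the right-hand sides `f i (x, t)` and the initial values `u0 i`. -/
structure ProblemData (n : ℕ) where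
  α : ℝ → ℝ
  β : ℝ → ℝ
  a : Fin n → (Fin n → ℝ) → ℝ
  f : Fin n → ℝ × ℝ → ℝ
  u0 : Fin n → ℝ → ℝ

namespace ProblemData

variable {n : ℕ} (D : ProblemData n)

/-- The length `γ = β - α` of the moving interval. -/
def γ (t : ℝ) : ℝ := D.β t - D.α t

/-- The coefficient `b₁(y, t) = (α'(t) + γ'(t) y) / γ(t)`. -/
def b1 (y t : ℝ) : ℝ := (deriv D.α t + deriv D.γ t * y) / D.γ t

/-- The coefficient `b₂(t) = 1 / γ(t)²`. -/
def b2 (t : ℝ) : ℝ := 1 / D.γ t ^ 2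

/-- The transformed right-hand side `g_i(y, t) = f_i(α(t) + γ(t) y, t)`. -/
def g (i : Fin n) (y t : ℝ) : ℝ := D.f i (D.α t + D.γ t * y, t)

/-- The transformed initial value `v_{i0}(y) = u_{i0}(α(0) + γ(0) y)`. -/
def v0 (i : Fin n) (y : ℝ) : ℝ := D.u0 i (D.α 0 + D.γ 0 * y)

/-- The functional `l(w) = γ(t) ∫₀¹ w dy` at time `t`. -/
def l (t : ℝ) (w : ℝ → ℝ) : ℝ := D.γ t * ∫ y in Ioo (0 : ℝ) 1, w y

/-- The non-cylindrical domain `Q_t = {(x, t) : α(t) < x < β(t), 0 < t < T}`. -/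
def movingDomain (T : ℝ) : Set (ℝ × ℝ) :=
  {p | p.2 ∈ Ioo 0 T ∧ p.1 ∈ Ioo (D.α p.2) (D.β p.2)}

/-- The standing hypotheses on the data on the time interval `[0, T]`. -/
structure Admissible (T γ₀ γ₁ γ'max α'max ma Ma : ℝ) (La : ℝ≥0) : Prop where
  contDiff_α : ContDiffOn ℝ 2 D.α (Icc 0 T)
  contDiff_β : ContDiffOn ℝ 2 D.β (Icc 0 T)
  γ_bounds : ∀ t ∈ Icc 0 T, γ₀ < D.γ t ∧ D.γ t < γ₁
  memLp_α' : MemLp (deriv D.α) 2 (volume.restrict (Ioo 0 T))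
  memLp_β' : MemLp (deriv D.β) 2 (volume.restrict (Ioo 0 T))
  γ'_bound : ∀ t ∈ Ioo 0 T, |deriv D.γ t| ≤ γ'max
  α'_bound : ∀ t ∈ Ioo 0 T, |deriv D.α t| ≤ α'max
  u0_mem : ∀ i, MemH10 (D.α 0) (D.β 0) (D.u0 i)
  /-- `u0 i` is the continuous representative of its class, so that it has nodal values. -/
  u0_cont : ∀ i, ContinuousOn (D.u0 i) (Icc (D.α 0) (D.β 0))
  f_memLp : ∀ i, MemLp (D.f i) 2 (volume.restrict (D.movingDomain T))
  a_lipschitz : ∀ i, LipschitzWith La (D.a i)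
  a_bounds : ∀ i s, ma ≤ D.a i s ∧ D.a i s ≤ Ma

/-- `v = (v_1, …, v_n)` is a weak solution of the transformed problem on `(0, 1) × (0, T)`.
As a function of time with values in `L²(0, 1)`, `v i` is the continuous representative, so that
`v i t` makes sense for every `t ∈ [0, T]`. -/
structure IsWeakSolution (T : ℝ) (v : Fin n → ℝ → L2Ω) : Prop where
  continuousOn : ∀ i, ContinuousOn (v i) (Icc 0 T)
  memH10 : ∀ i, ∀ᵐ t ∂(volume.restrict (Ioo 0 T)), MemH10 0 1 (v i t)
  memH2 : ∀ i, bochnerSobolevNorm ⊤ T 2 (v i) < ⊤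
  hasTimeDeriv : ∀ i, ∃ w, IsWeakDeriv 0 T 1 (v i) w
  timeDeriv_memLp : ∀ i, MemLp (weakDeriv 0 T (v i)) 2 (volume.restrict (Ioo 0 T))
  equation : ∀ i, ∀ᵐ t ∂(volume.restrict (Ioo 0 T)), ∀ w : ℝ → ℝ, MemH10 0 1 w →
    (∫ y in Ioo (0 : ℝ) 1, (weakDeriv 0 T (v i) t) y * w y)
      + D.a i (fun j => D.l t (v j t)) * D.b2 t *
          (∫ y in Ioo (0 : ℝ) 1, weakDeriv 0 1 (v i t) y * weakDeriv 0 1 w y)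
      - (∫ y in Ioo (0 : ℝ) 1, D.b1 y t * weakDeriv 0 1 (v i t) y * w y)
      = ∫ y in Ioo (0 : ℝ) 1, D.g i y t * w y
  initial : ∀ i, v i 0 =ᵐ[volume.restrict (Ioo (0 : ℝ) 1)] D.v0 i

end ProblemData

/-! ### Finite elements -/

/-- A partition `0 = x_0 < x_1 < ⋯ < x_N = 1` of `(0, 1)` into `N` intervals, with Lagrange points
of degree `k`: every closed interval `[x_j, x_{j+1}]` contains `k + 1` points, among them
the two end points. -/
structure Mesh (k : ℕ) where
  N : ℕ
  x : Fin (N + 1) → ℝ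
  x_strictMono : StrictMono x
  x_zero : x 0 = 0
  x_last : x (Fin.last N) = 1
  P : Fin N → Fin (k + 1) → ℝ
  P_strictMono : ∀ j, StrictMono (P j)
  P_zero : ∀ j, P j 0 = x j.castSucc
  P_last : ∀ j, P j (Fin.last k) = x j.succ

namespace Mesh

variable {k : ℕ} (M : Mesh k)

/-- The mesh size `h = max_j (x_{j+1} - x_j)`. -/
def h : ℝ := ⨆ j : Fin M.N, (M.x j.succ - M.x j.castSucc)

/-- The finite element space `S_h^k`: continuous functions on `[0, 1]` that vanish at the end
points and are polynomials of degree at most `k` on every interval of the partition (values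
outside of `[0, 1]` are irrelevant). -/
def S : Set (ℝ → ℝ) :=
  {W | ContinuousOn W (Icc 0 1) ∧ W 0 = 0 ∧ W 1 = 0 ∧
    ∀ j : Fin M.N, ∃ p : ℝ[X], p.natDegree ≤ k ∧
      ∀ y ∈ Icc (M.x j.castSucc) (M.x j.succ), W y = p.eval y}

/-- `W` is the interpolant `I_h u`: the element of `S_h^k` that agrees with `u` at the Lagrange
points. -/
def IsInterpolant (u W : ℝ → ℝ) : Prop :=
  W ∈ M.S ∧ ∀ j l, W (M.P j l) = u (M.P j l)

end Mesh

/-- `V = (V_1, …, V_n)` is a solution of the semidiscrete Galerkin problem in `(S_h^k)^n` with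
initial values `I_h v_{i0}`; it is a Caratheodory solution of a system of ordinary differential
equations, that is, absolutely continuous in time with the equations at almost every time. -/
structure IsSemidiscreteSolution {n k : ℕ} (D : ProblemData n) (T : ℝ) (M : Mesh k)
    (V : Fin n → ℝ → ℝ → ℝ) : Prop where
  mem : ∀ i, ∀ t ∈ Icc 0 T, V i t ∈ M.S
  absolutelyContinuous : ∀ i, ∀ y ∈ Icc (0 : ℝ) 1,
    AbsolutelyContinuousOnInterval (fun t => V i t y) 0 T
  equation : ∀ i, ∀ᵐ t ∂(volume.restrict (Ioo 0 T)), ∀ W ∈ M.S,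
    (∫ y in Ioo (0 : ℝ) 1, deriv (fun s => V i s y) t * W y)
      + D.a i (fun j => D.l t (V j t)) * D.b2 t *
          (∫ y in Ioo (0 : ℝ) 1, deriv (V i t) y * deriv W y)
      - (∫ y in Ioo (0 : ℝ) 1, D.b1 y t * deriv (V i t) y * W y)
      = ∫ y in Ioo (0 : ℝ) 1, D.g i y t * W y
  initial : ∀ i, M.IsInterpolant (D.v0 i) (V i 0)

end

end NonlocalFEM

open NonlocalFEM

/-! The argument is carried out on space derivatives. A function in H₀¹(0, 1) is the primitive from
0 of some z in L² of mean zero, and on [0, 1] the elements of S_h^k are the primitives of the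
piecewise polynomials of degree less than k and mean zero. Since the diffusion coefficient a_i b₂
does not depend on y, the elliptic projection P v is the primitive of the L² projection `gradProj`
of ∂_y v. For k ≥ 1 the cell indicators lie in the range of that projection, so P v agrees with v at
the mesh nodes, and Poincaré's inequality on each cell gains the extra power of h without a duality
argument.

Write V_i - v_i = θ_i - ρ_i with θ_i = V_i - P v_i and ρ_i = v_i - P v_i. Both equations are tested
with θ_i and subtracted (`energy_inequality`). Orthogonality removes the diffusion of ρ_i. The
nonlocal coefficients differ by at most La γ₁ times an upper bound for the ‖v_j - V_j‖, and this
difference multiplies ‖∂_y v_i‖, which is bounded in time. The convection of ρ_i is integrated by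
parts (`inner_affineMul_primitiveL2`), so that it is controlled by ‖ρ_i‖, of order k + 1, and not by
‖∂_y ρ_i‖, of order k. Young's inequality absorbs ‖∂_y θ_i‖ into the diffusion
(`absorb_gradient_terms`), and Gronwall's inequality for ∑ ‖θ_i‖² concludes. At time 0, θ_i is the
difference of two approximations of v_{i0}, the interpolant and the elliptic projection
(`Mesh.initial_error`).

The constant is uniform in k and in the nodes because both approximation results,
`exists_polynomial_approx` and `integral_sq_le_of_zeros`, iterate Poincaré's inequality with
constant 1; for interpolation, Rolle's theorem supplies the zeros of the successive derivatives.

What remains is regularity in time. The time derivative of ρ_i involves ∂_y ∂_t v_i, whereas ∂_t v_i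
is a weak derivative of an L²-valued function. Commutation of the two derivatives is proved after
pairing with L² functions (`inner_gradL2_eq_add_integral`), the zero boundary value at 0 is
inherited by ∂_t v_i (`ae_eq_primitiveL2_gradL2`), and `exists_error_curve` supplies an absolutely
continuous version of ‖θ_i‖². The bound holds first for almost every t and extends to every t
because V_i and v_i are continuous in L². -/

namespace NonlocalFEM

/-! ### Test functions -/

namespace IsTestFunction

variable {a b : ℝ} {φ ψ : ℝ → ℝ}

theorem of_support_subset_Icc {c d : ℝ} (h : ContDiff ℝ ∞ φ) (hc : a < c) (hd : d < b)
    (hs : Function.support φ ⊆ Icc c d) : IsTestFunction a b φ := by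
  have ht : tsupport φ ⊆ Icc c d := closure_minimal hs isClosed_Icc
  exact ⟨h, isCompact_Icc.of_isClosed_subset (isClosed_tsupport _) ht,
    ht.trans (Icc_subset_Ioo hc hd)⟩

theorem exists_Icc (h : IsTestFunction a b φ) (hab : a < b) :
    ∃ c d, a < c ∧ c < d ∧ d < b ∧ tsupport φ ⊆ Icc c d := by
  obtain ⟨c, hc⟩ : ∃ c, a < c ∧ c < (a + b) / 2 ∧ ∀ x ∈ tsupport φ, c ≤ x := by
    rcases (tsupport φ).eq_empty_or_nonempty with he | hne
    · exact ⟨a / 4 * 3 + b / 4, by linarith, by linarith, by simp [he]⟩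
    · obtain ⟨c, hc, hm⟩ := h.2.1.isCompact.exists_isLeast hne
      have := (h.2.2 hc).1
      refine ⟨min c (a / 4 * 3 + b / 4), lt_min this (by linarith), ?_, fun x hx => ?_⟩
      · exact (min_le_right _ _).trans_lt (by linarith)
      · exact (min_le_left _ _).trans (hm hx)
  obtain ⟨d, hd⟩ : ∃ d, d < b ∧ (a + b) / 2 < d ∧ ∀ x ∈ tsupport φ, x ≤ d := by
    rcases (tsupport φ).eq_empty_or_nonempty with he | hne
    · exact ⟨a / 4 + b / 4 * 3, by linarith, by linarith, by simp [he]⟩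
    · obtain ⟨c, hc, hm⟩ := h.2.1.isCompact.exists_isGreatest hne
      have := (h.2.2 hc).2
      refine ⟨max c (a / 4 + b / 4 * 3), max_lt this (by linarith), ?_, fun x hx => ?_⟩
      · exact lt_of_lt_of_le (by linarith) (le_max_right _ _)
      · exact (hm hx).trans (le_max_left _ _)
  exact ⟨c, d, hc.1, hc.2.1.trans hd.2.1, hd.1, fun x hx => ⟨hc.2.2 x hx, hd.2.2 x hx⟩⟩

theorem continuous (h : IsTestFunction a b φ) : Continuous φ := h.1.continuous

theorem eq_zero_of_notMem (h : IsTestFunction a b φ) {x : ℝ} (hx : x ∉ Ioo a b) : φ x = 0 :=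
  image_eq_zero_of_notMem_tsupport fun h' => hx (h.2.2 h')

theorem zero : IsTestFunction a b (fun _ => 0) :=
  ⟨contDiff_const, HasCompactSupport.zero, by simp [tsupport]⟩

theorem add (h : IsTestFunction a b φ) (h' : IsTestFunction a b ψ) :
    IsTestFunction a b (fun x => φ x + ψ x) :=
  ⟨h.1.add h'.1, h.2.1.add h'.2.1, (tsupport_add φ ψ).trans (union_subset h.2.2 h'.2.2)⟩

theorem const_mul (h : IsTestFunction a b φ) (c : ℝ) : IsTestFunction a b (fun x => c * φ x) :=
  ⟨contDiff_const.mul h.1, h.2.1.mul_left, (tsupport_mul_subset_right).trans h.2.2⟩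

theorem sub (h : IsTestFunction a b φ) (h' : IsTestFunction a b ψ) :
    IsTestFunction a b (fun x => φ x - ψ x) := by
  have := h.add (h'.const_mul (-1))
  simpa [sub_eq_add_neg] using this

theorem deriv (h : IsTestFunction a b φ) : IsTestFunction a b (deriv φ) :=
  ⟨(contDiff_infty_iff_deriv.mp h.1).2, h.2.1.deriv, tsupport_deriv_subset.trans h.2.2⟩

theorem iteratedDeriv (h : IsTestFunction a b φ) (j : ℕ) :
    IsTestFunction a b (iteratedDeriv j φ) := by
  induction j with
  | zero => simpa using h
  | succ j ih => rw [iteratedDeriv_succ]; exact ih.deriv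

theorem memLp (h : IsTestFunction a b φ) (p : ℝ≥0∞) (μ : Measure ℝ) [IsLocallyFiniteMeasure μ] :
    MemLp φ p μ :=
  h.continuous.memLp_of_hasCompactSupport h.2.1

theorem integrable (h : IsTestFunction a b φ) : Integrable φ :=
  h.continuous.integrable_of_hasCompactSupport h.2.1

theorem integrable_smul {E : Type*} [NormedAddCommGroup E] [NormedSpace ℝ E] {u : ℝ → E}
    (h : IsTestFunction a b φ) (hu : LocallyIntegrableOn u (Ioo a b)) :
    Integrable (fun x => φ x • u x) (volume.restrict (Ioo a b)) := by
  have hK : IsCompact (tsupport φ) := h.2.1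
  have h1 : IntegrableOn u (tsupport φ) := hu.integrableOn_compact_subset h.2.2 hK
  have h2 : IntegrableOn (fun x => φ x • u x) (tsupport φ) :=
    h1.continuousOn_smul h.continuous.continuousOn hK
  refine Integrable.integrableOn ?_
  rw [← integrableOn_iff_integrable_of_support_subset (s := tsupport φ)]
  · exact h2
  · intro x hx
    exact subset_tsupport _ (fun h0 => hx (by simp [h0]))

theorem intervalIntegral_eq_of_tsupport_subset {c d : ℝ} (hcd : c ≤ d)
    (hs : tsupport φ ⊆ Icc c d) : ∫ x in c..d, φ x = ∫ x, φ x := by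
  rw [intervalIntegral.integral_of_le hcd, ← integral_Icc_eq_integral_Ioc]
  refine setIntegral_eq_integral_of_forall_compl_eq_zero fun x hx => ?_
  exact image_eq_zero_of_notMem_tsupport fun h' => hx (hs h')

theorem integral_Ioo_eq (h : IsTestFunction a b φ) : ∫ x in Ioo a b, φ x = ∫ x, φ x :=
  setIntegral_eq_integral_of_forall_compl_eq_zero fun _ hx => h.eq_zero_of_notMem hx

/-- A primitive of a test function of mean zero is a test function. -/
theorem primitive_of_integral_eq_zero (h : IsTestFunction a b φ) (hab : a < b) (h0 : ∫ x, φ x = 0) :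
    IsTestFunction a b (fun x => ∫ t in a..x, φ t) := by
  obtain ⟨c, d, hc, hcd, hd, hs⟩ := h.exists_Icc hab
  have hz : ∀ t, t ∉ Icc c d → φ t = 0 := fun t ht =>
    image_eq_zero_of_notMem_tsupport fun h' => ht (hs h')
  have hder : ∀ x, HasDerivAt (fun x => ∫ t in a..x, φ t) (φ x) x := fun x =>
    h.continuous.integral_hasStrictDerivAt a x |>.hasDerivAt
  have hint : ∀ x y, IntervalIntegrable φ volume x y := fun x y =>
    h.continuous.intervalIntegrable x y
  refine of_support_subset_Icc ?_ hc hd ?_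
  · rw [contDiff_infty_iff_deriv]
    refine ⟨fun x => (hder x).differentiableAt, ?_⟩
    rw [funext fun x => (hder x).deriv]
    exact h.1
  · intro x hx
    by_contra hx'
    apply hx
    change ∫ t in a..x, φ t = 0
    have key : ∀ y ≤ c, ∫ t in a..y, φ t = 0 := by
      intro y hy
      rw [intervalIntegral.integral_congr_ae (g := fun _ => (0 : ℝ))]
      · simp
      · have : ∀ᵐ t : ℝ, t ≠ c := by simp [ae_iff, measure_singleton]
        filter_upwards [this] with t htc ht
        refine hz t fun h' => htc (le_antisymm ?_ h'.1)
        exact ht.2.trans (max_le hc.le hy)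
    rw [mem_Icc, not_and_or, not_le, not_le] at hx'
    rcases hx' with hx' | hx'
    · exact key x hx'.le
    · rw [← intervalIntegral.integral_add_adjacent_intervals (hint a c) (hint c x), key c le_rfl,
        zero_add, ← intervalIntegral.integral_add_adjacent_intervals (hint c d) (hint d x),
        intervalIntegral_eq_of_tsupport_subset hcd.le hs, h0, zero_add,
        intervalIntegral.integral_congr_ae (g := fun _ => (0 : ℝ))]
      · simp
      · refine Eventually.of_forall fun t ht => hz t fun h' => ?_
        rw [uIoc_of_le hx'.le] at ht
        exact absurd ht.1 (not_lt.2 h'.2)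

theorem exists_integral_eq_one (hab : a < b) :
    ∃ η, IsTestFunction a b η ∧ ∫ x, η x = 1 := by
  let f : ContDiffBump ((a + b) / 2) :=
    ⟨(b - a) / 8, (b - a) / 4, by linarith, by linarith⟩
  refine ⟨f.normed volume, ⟨f.contDiff_normed, f.hasCompactSupport_normed, ?_⟩,
    f.integral_normed⟩
  rw [f.tsupport_normed_eq, Real.closedBall_eq_Icc]
  exact Icc_subset_Ioo (by change a < (a + b) / 2 - (b - a) / 4; linarith)
    (by change (a + b) / 2 + (b - a) / 4 < b; linarith)

end IsTestFunction

/-! ### First order weak derivatives and primitives -/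

/-- The lemma of du Bois-Reymond. -/
theorem ae_eq_const_of_integral_deriv_mul_eq_zero {a b : ℝ} (hab : a < b) {u : ℝ → ℝ}
    (hu : LocallyIntegrableOn u (Ioo a b))
    (h : ∀ φ, IsTestFunction a b φ → ∫ x in Ioo a b, deriv φ x * u x = 0) :
    ∃ c : ℝ, u =ᵐ[volume.restrict (Ioo a b)] fun _ => c := by
  obtain ⟨η, hη, hη1⟩ := IsTestFunction.exists_integral_eq_one hab
  -- Each test function is a multiple of `η` plus one of mean zero, and the latter is the derivative
  -- of a test function, to which `u` is orthogonal. So `u` acts on test functions as this constant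
  -- does.
  set c := ∫ x in Ioo a b, η x * u x with hc
  refine ⟨c, ?_⟩
  have hcl : LocallyIntegrableOn (fun _ : ℝ => c) (Ioo a b) :=
    (locallyIntegrable_const c).locallyIntegrableOn _
  have key := isOpen_Ioo.ae_eq_zero_of_integral_contDiff_smul_eq_zero (μ := volume)
    (f := fun x => u x - c) (U := Ioo a b) (hu.sub hcl) ?_
  · rw [Filter.EventuallyEq, ae_restrict_iff' measurableSet_Ioo]
    filter_upwards [key] with x hx hx'
    linarith [hx hx']
  intro φ h1 h2 h3
  have hφ : IsTestFunction a b φ := ⟨h1, h2, h3⟩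
  set m := ∫ x, φ x with hm
  have hψ : IsTestFunction a b (fun x => φ x - m * η x) := hφ.sub (hη.const_mul m)
  have hψ0 : ∫ x, (φ x - m * η x) = 0 := by
    rw [integral_sub hφ.integrable (hη.integrable.const_mul m), integral_const_mul, hη1]
    simp [hm]
  have h4 := h _ (hψ.primitive_of_integral_eq_zero hab hψ0)
  have hd : ∀ x, deriv (fun x => ∫ t in a..x, (φ t - m * η t)) x = φ x - m * η x := fun x =>
    (hψ.continuous.integral_hasStrictDerivAt a x).hasDerivAt.deriv
  simp only [hd] at h4
  have i1 := hφ.integrable_smul hu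
  have i2 := hη.integrable_smul hu
  simp only [smul_eq_mul] at i1 i2
  have e1 : ∫ x in Ioo a b, φ x * u x = m * c := by
    have : ∀ x, (φ x - m * η x) * u x = φ x * u x - m * (η x * u x) := fun x => by ring
    simp only [this] at h4
    rw [integral_sub i1 (i2.const_mul m), integral_const_mul] at h4
    linarith
  have e2 : ∫ x in Ioo a b, φ x * (u x - c) = 0 := by
    simp only [mul_sub]
    rw [integral_sub i1 (hφ.integrable.integrableOn.mul_const c), e1, integral_mul_const,
      hφ.integral_Ioo_eq]
    ring
  rw [← e2]
  simp only [smul_eq_mul]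
  symm
  refine setIntegral_eq_integral_of_forall_compl_eq_zero fun x hx => ?_
  simp [hφ.eq_zero_of_notMem hx]

section Primitive

variable {a b : ℝ} {u w : ℝ → ℝ}

theorem intervalIntegrable_of_integrableOn_Ioo (hw : IntegrableOn w (Ioo a b))
    {x y : ℝ} (hx : x ∈ Icc a b) (hy : y ∈ Icc a b) : IntervalIntegrable w volume x y := by
  have h1 : IntervalIntegrable w volume a b :=
    (intervalIntegrable_iff_integrableOn_Ioo_of_le (hx.1.trans hx.2)).2 hw
  exact h1.mono_set (by
    rw [uIcc_of_le (hx.1.trans hx.2)]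
    exact uIcc_subset_Icc hx hy)

theorem integral_Ioo_eq_intervalIntegral (hab : a ≤ b) (f : ℝ → ℝ) :
    ∫ x in Ioo a b, f x = ∫ x in a..b, f x := by
  rw [intervalIntegral.integral_of_le hab, integral_Ioc_eq_integral_Ioo]

theorem ae_Ioo_of_ae_uIcc {p : ℝ → Prop} (hab : a ≤ b) (h : ∀ᵐ x, x ∈ uIcc a b → p x) :
    ∀ᵐ x ∂(volume.restrict (Ioo a b)), p x := by
  rw [ae_restrict_iff' measurableSet_Ioo]
  filter_upwards [h] with x hx hx'
  exact hx (by rw [uIcc_of_le hab]; exact Ioo_subset_Icc_self hx')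

theorem absolutelyContinuous_primitive (hab : a ≤ b) (hw : IntegrableOn w (Ioo a b)) :
    AbsolutelyContinuousOnInterval (fun x => ∫ t in a..x, w t) a b :=
  (intervalIntegrable_of_integrableOn_Ioo hw (left_mem_Icc.2 hab)
    (right_mem_Icc.2 hab)).absolutelyContinuousOnInterval_intervalIntegral left_mem_uIcc

theorem continuousOn_primitive (hab : a ≤ b) (hw : IntegrableOn w (Ioo a b)) :
    ContinuousOn (fun x => ∫ t in a..x, w t) (Icc a b) := by
  simpa [uIcc_of_le hab] using (absolutelyContinuous_primitive hab hw).continuousOn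

theorem ae_hasDerivAt_primitive (hab : a ≤ b) (hw : IntegrableOn w (Ioo a b)) :
    ∀ᵐ x ∂(volume.restrict (Ioo a b)), HasDerivAt (fun x => ∫ t in a..x, w t) (w x) x := by
  refine ae_Ioo_of_ae_uIcc hab ?_
  filter_upwards [(intervalIntegrable_of_integrableOn_Ioo hw (left_mem_Icc.2 hab)
    (right_mem_Icc.2 hab)).ae_hasDerivAt_integral] with x hx hx'
  exact hx hx' a left_mem_uIcc

theorem IsTestFunction.absolutelyContinuous {φ : ℝ → ℝ} (hφ : IsTestFunction a b φ) :
    AbsolutelyContinuousOnInterval φ a b :=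
  (hφ.1.of_le (by simp)).contDiffOn.absolutelyContinuousOnInterval

theorem integral_deriv_mul_primitive (hab : a ≤ b) (hw : IntegrableOn w (Ioo a b)) {φ : ℝ → ℝ}
    (hφ : IsTestFunction a b φ) :
    ∫ x in Ioo a b, deriv φ x * (∫ t in a..x, w t) = - ∫ x in Ioo a b, φ x * w x := by
  have h1 := hφ.absolutelyContinuous.integral_mul_deriv_eq_deriv_mul
    (absolutelyContinuous_primitive hab hw)
  rw [hφ.eq_zero_of_notMem (x := a) (by simp), hφ.eq_zero_of_notMem (x := b) (by simp),
    ← integral_Ioo_eq_intervalIntegral hab] at h1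
  have h2 : ∫ x in Ioo a b, φ x * deriv (fun x => ∫ t in a..x, w t) x
      = ∫ x in Ioo a b, φ x * w x := by
    refine integral_congr_ae ?_
    filter_upwards [ae_hasDerivAt_primitive hab hw] with x hx
    rw [hx.deriv]
  rw [integral_Ioo_eq_intervalIntegral hab (fun x => deriv φ x * _)]
  linarith

theorem IsTestFunction.integral_deriv_mul_const (hab : a ≤ b) {φ : ℝ → ℝ}
    (hφ : IsTestFunction a b φ) (c : ℝ) : ∫ x in Ioo a b, _root_.deriv φ x * c = 0 := by
  rw [integral_mul_const, integral_Ioo_eq_intervalIntegral hab,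
    hφ.absolutelyContinuous.integral_deriv_eq_sub, hφ.eq_zero_of_notMem (by simp),
    hφ.eq_zero_of_notMem (by simp)]
  simp

theorem isWeakDeriv_of_ae_eq_primitive (hab : a ≤ b) (hw : IntegrableOn w (Ioo a b)) {c : ℝ}
    (hu : u =ᵐ[volume.restrict (Ioo a b)] fun x => c + ∫ t in a..x, w t) :
    IsWeakDeriv a b 1 u w := by
  have hp : IntegrableOn (fun x => ∫ t in a..x, w t) (Ioo a b) :=
    ((continuousOn_primitive hab hw).integrableOn_Icc).mono_set Ioo_subset_Icc_self
  have hui : IntegrableOn u (Ioo a b) := by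
    refine Integrable.congr ?_ hu.symm
    exact (integrableOn_const (by simp)).add hp
  refine ⟨hui.locallyIntegrableOn, hw.locallyIntegrableOn, fun φ hφ => ?_⟩
  simp only [iteratedDeriv_one, smul_eq_mul, pow_one]
  have h1 : ∫ x in Ioo a b, deriv φ x * u x
      = ∫ x in Ioo a b, (deriv φ x * c + deriv φ x * ∫ t in a..x, w t) := by
    refine integral_congr_ae ?_
    filter_upwards [hu] with x hx
    rw [hx]; ring
  rw [h1, integral_add, hφ.integral_deriv_mul_const hab, integral_deriv_mul_primitive hab hw hφ]
  · ring
  · exact hφ.deriv.integrable.integrableOn.mul_const c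
  · exact hφ.deriv.integrable_smul hp.locallyIntegrableOn

/-- The difference of `u` and the primitive has weak derivative zero, so du Bois-Reymond applies. -/
theorem IsWeakDeriv.ae_eq_primitive (h : IsWeakDeriv a b 1 u w) (hab : a < b)
    (hw : IntegrableOn w (Ioo a b)) :
    ∃ c : ℝ, u =ᵐ[volume.restrict (Ioo a b)] fun x => c + ∫ t in a..x, w t := by
  have hp : LocallyIntegrableOn (fun x => ∫ t in a..x, w t) (Ioo a b) :=
    (((continuousOn_primitive hab.le hw).integrableOn_Icc).mono_set
      Ioo_subset_Icc_self).locallyIntegrableOn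
  obtain ⟨c, hc⟩ := ae_eq_const_of_integral_deriv_mul_eq_zero hab (h.1.sub hp) (fun φ hφ => by
    have h1 := h.2.2 φ hφ
    simp only [iteratedDeriv_one, smul_eq_mul, pow_one] at h1
    simp only [Pi.sub_apply, mul_sub]
    have i1 := hφ.deriv.integrable_smul h.1
    have i2 := hφ.deriv.integrable_smul hp
    simp only [smul_eq_mul] at i1 i2
    rw [integral_sub i1 i2, h1,
      integral_deriv_mul_primitive hab.le hw hφ]
    ring)
  refine ⟨c, ?_⟩
  filter_upwards [hc] with x hx
  simp only [Pi.sub_apply] at hx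
  linarith

end Primitive

/-! ### Uniqueness of weak derivatives and their norms -/

theorem IsWeakDeriv.ae_unique {a b : ℝ} {j : ℕ} {u w w' : ℝ → ℝ} (h : IsWeakDeriv a b j u w)
    (h' : IsWeakDeriv a b j u w') : w =ᵐ[volume.restrict (Ioo a b)] w' := by
  have key := isOpen_Ioo.ae_eq_zero_of_integral_contDiff_smul_eq_zero (μ := volume)
    (f := fun x => w x - w' x) (U := Ioo a b) (h.2.1.sub h'.2.1) ?_
  · rw [Filter.EventuallyEq, ae_restrict_iff' measurableSet_Ioo]
    filter_upwards [key] with x hx hx'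
    linarith [hx hx']
  intro φ h1 h2 h3
  have hφ : IsTestFunction a b φ := ⟨h1, h2, h3⟩
  have e1 : ∫ x in Ioo a b, φ x • w x = ∫ x in Ioo a b, φ x • w' x := by
    have := (h.2.2 φ hφ).symm.trans (h'.2.2 φ hφ)
    have hne : ((-1 : ℝ) ^ j) ≠ 0 := by simp
    simpa [hne] using this
  have e2 : ∫ x in Ioo a b, φ x • (w x - w' x) = 0 := by
    simp only [smul_sub]
    rw [integral_sub (hφ.integrable_smul h.2.1) (hφ.integrable_smul h'.2.1), e1, sub_self]
  rw [← e2]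
  symm
  refine setIntegral_eq_integral_of_forall_compl_eq_zero fun x hx => ?_
  simp [hφ.eq_zero_of_notMem hx]

theorem locallyIntegrableOn_congr_ae {E : Type*} [NormedAddCommGroup E] {a b : ℝ} {u u' : ℝ → E}
    (h : LocallyIntegrableOn u (Ioo a b)) (hu : u =ᵐ[volume.restrict (Ioo a b)] u') :
    LocallyIntegrableOn u' (Ioo a b) := by
  rw [locallyIntegrableOn_iff isOpen_Ioo.isLocallyClosed] at h ⊢
  intro K hK hc
  exact (h K hK hc).congr (ae_restrict_of_ae_restrict_of_subset hK hu)

theorem IsWeakDeriv.congr {a b : ℝ} {j : ℕ} {u u' w w' : ℝ → ℝ} (h : IsWeakDeriv a b j u w)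
    (hu : u =ᵐ[volume.restrict (Ioo a b)] u') (hw : w =ᵐ[volume.restrict (Ioo a b)] w') :
    IsWeakDeriv a b j u' w' := by
  refine ⟨locallyIntegrableOn_congr_ae h.1 hu, locallyIntegrableOn_congr_ae h.2.1 hw,
    fun φ hφ => ?_⟩
  have e1 : ∫ x in Ioo a b, iteratedDeriv j φ x • u' x
      = ∫ x in Ioo a b, iteratedDeriv j φ x • u x :=
    integral_congr_ae (by filter_upwards [hu] with x hx; rw [hx])
  have e2 : ∫ x in Ioo a b, φ x • w' x = ∫ x in Ioo a b, φ x • w x :=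
    integral_congr_ae (by filter_upwards [hw] with x hx; rw [hx])
  rw [e1, e2, h.2.2 φ hφ]

theorem weakDeriv_ae_eq {a b : ℝ} {u w : ℝ → ℝ} (h : IsWeakDeriv a b 1 u w) :
    weakDeriv a b u =ᵐ[volume.restrict (Ioo a b)] w := by
  have hex : ∃ w, IsWeakDeriv a b 1 u w := ⟨w, h⟩
  unfold weakDeriv
  rw [dif_pos hex]
  exact hex.choose_spec.ae_unique h

theorem isWeakDeriv_weakDeriv {E : Type*} [NormedAddCommGroup E] [NormedSpace ℝ E] {a b : ℝ}
    {u : ℝ → E} (h : ∃ w, IsWeakDeriv a b 1 u w) : IsWeakDeriv a b 1 u (weakDeriv a b u) := by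
  unfold weakDeriv
  rw [dif_pos h]
  exact h.choose_spec

theorem weakDerivNorm_eq {a b : ℝ} {j : ℕ} {u w : ℝ → ℝ} (h : IsWeakDeriv a b j u w) :
    weakDerivNorm a b j u = eLpNorm w 2 (volume.restrict (Ioo a b)) := by
  refine le_antisymm (iInf₂_le w h) (le_iInf₂ fun w' h' => ?_)
  rw [eLpNorm_congr_ae (h.ae_unique h')]

theorem weakDerivNorm_congr_ae {a b : ℝ} {j : ℕ} {u u' : ℝ → ℝ}
    (hu : u =ᵐ[volume.restrict (Ioo a b)] u') : weakDerivNorm a b j u = weakDerivNorm a b j u' := by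
  refine le_antisymm ?_ ?_
  · exact le_iInf₂ fun w h => iInf₂_le w (h.congr hu.symm (ae_eq_refl _))
  · exact le_iInf₂ fun w h => iInf₂_le w (h.congr hu (ae_eq_refl _))

theorem weakDerivNorm_le_sobolevNorm {a b : ℝ} {j m : ℕ} (hj : j ≤ m) (u : ℝ → ℝ) :
    weakDerivNorm a b j u ≤ sobolevNorm a b m u := by
  unfold sobolevNorm
  have h1 : weakDerivNorm a b j u ^ 2
      ≤ ∑ j ∈ Finset.range (m + 1), weakDerivNorm a b j u ^ 2 :=
    Finset.single_le_sum (f := fun j => weakDerivNorm a b j u ^ 2) (fun _ _ => zero_le)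
      (Finset.mem_range.2 (by omega))
  calc weakDerivNorm a b j u = (weakDerivNorm a b j u ^ 2) ^ (1 / 2 : ℝ) := by
        rw [← ENNReal.rpow_natCast, ← ENNReal.rpow_mul]; simp
    _ ≤ _ := ENNReal.rpow_le_rpow h1 (by norm_num)

/-- Test the definition of `w` with the derivative of a test function; the sign (-1)^j cancels. -/
theorem IsWeakDeriv.succ {a b : ℝ} {j : ℕ} {u w w' : ℝ → ℝ} (h : IsWeakDeriv a b j u w)
    (h' : IsWeakDeriv a b (j + 1) u w') : IsWeakDeriv a b 1 w w' := by
  refine ⟨h.2.1, h'.2.1, fun φ hφ => ?_⟩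
  have h1 := h.2.2 _ hφ.deriv
  have h2 := h'.2.2 _ hφ
  rw [iteratedDeriv_succ'] at h2
  rw [iteratedDeriv_one]
  rw [h2] at h1
  have hne : ((-1 : ℝ) ^ j) ≠ 0 := by simp
  rw [pow_succ, mul_smul] at h1
  have h3 := smul_right_injective ℝ hne h1
  simpa using h3.symm

theorem IsWeakDeriv.ae_eq_of_zero {a b : ℝ} {u w : ℝ → ℝ} (h : IsWeakDeriv a b 0 u w) :
    w =ᵐ[volume.restrict (Ioo a b)] u :=
  h.ae_unique ⟨h.1, h.1, fun φ _ => by simp⟩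

theorem exists_isWeakDeriv_of_weakDerivNorm_lt_top {a b : ℝ} {j : ℕ} {u : ℝ → ℝ}
    (h : weakDerivNorm a b j u < ⊤) :
    ∃ w, IsWeakDeriv a b j u w ∧ MemLp w 2 (volume.restrict (Ioo a b)) ∧
      eLpNorm w 2 (volume.restrict (Ioo a b)) = weakDerivNorm a b j u := by
  have h' := h
  unfold weakDerivNorm at h'
  rw [iInf_lt_iff] at h'
  obtain ⟨w, hw⟩ := h'
  rw [iInf_lt_iff] at hw
  obtain ⟨hw, hlt⟩ := hw
  refine ⟨w, hw, ⟨?_, hlt⟩, (weakDerivNorm_eq hw).symm⟩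
  exact hw.2.1.aestronglyMeasurable


/-- Lebesgue measure on `(0, 1)`. -/
noncomputable abbrev unitMeasure : Measure ℝ := volume.restrict (Ioo (0 : ℝ) 1)

/-! ### The inner product of `L²(0, 1)` -/

theorem inner_eq_integral (f g : L2Ω) :
    inner ℝ f g = ∫ x in Ioo (0 : ℝ) 1, f x * g x := by
  rw [L2.inner_def]
  exact integral_congr_ae (Eventually.of_forall fun x => by simp [mul_comm])

theorem inner_toLp_left {f : ℝ → ℝ} (hf : MemLp f 2 unitMeasure) (g : L2Ω) :
    inner ℝ (hf.toLp f) g = ∫ x in Ioo (0 : ℝ) 1, f x * g x := by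
  rw [inner_eq_integral]
  refine integral_congr_ae ?_
  filter_upwards [hf.coeFn_toLp] with x hx
  rw [hx]

theorem inner_toLp_toLp {f g : ℝ → ℝ} (hf : MemLp f 2 unitMeasure) (hg : MemLp g 2 unitMeasure) :
    inner ℝ (hf.toLp f) (hg.toLp g) = ∫ x in Ioo (0 : ℝ) 1, f x * g x := by
  rw [inner_toLp_left]
  refine integral_congr_ae ?_
  filter_upwards [hg.coeFn_toLp] with x hx
  rw [hx]

theorem integrableOn_of_memLp {f : ℝ → ℝ} {a b : ℝ}
    (hf : MemLp f 2 (volume.restrict (Ioo a b))) : IntegrableOn f (Ioo a b) :=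
  hf.integrable (by norm_num)

theorem integrableOn_L2 (f : L2Ω) : IntegrableOn f (Ioo 0 1) :=
  integrableOn_of_memLp (Lp.memLp f)

theorem eLpNorm_eq_ofReal_norm (f : L2Ω) : eLpNorm f 2 unitMeasure = ENNReal.ofReal ‖f‖ := by
  rw [Lp.norm_def, ENNReal.ofReal_toReal (Lp.eLpNorm_ne_top f)]

theorem integrable_mul_of_memLp {f g : ℝ → ℝ} {μ : Measure ℝ} (hf : MemLp f 2 μ)
    (hg : MemLp g 2 μ) : Integrable (fun x => f x * g x) μ :=
  hf.integrable_mul hg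

/-! ### Density of the test functions -/

/-- The class of a test function in `L²(0, 1)`. -/
noncomputable def IsTestFunction.toL2 {φ : ℝ → ℝ} (h : IsTestFunction 0 1 φ) : L2Ω :=
  (h.memLp 2 unitMeasure).toLp φ

/-- The space of test functions on `(0, 1)`. -/
def testSubmodule : Submodule ℝ (ℝ → ℝ) where
  carrier := {φ | IsTestFunction 0 1 φ}
  add_mem' h h' := h.add h'
  zero_mem' := IsTestFunction.zero
  smul_mem' c _ h := h.const_mul c

/-- The inclusion of the test functions into `L²(0, 1)`. -/
noncomputable def testToL2 : testSubmodule →ₗ[ℝ] L2Ω where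
  toFun φ := IsTestFunction.toL2 φ.2
  map_add' _ _ := rfl
  map_smul' _ _ := rfl

/-- An element orthogonal to all test functions vanishes, by the fundamental lemma of the calculus
of variations. -/
theorem denseRange_testToL2 : DenseRange testToL2 := by
  have h1 : (LinearMap.range testToL2)ᗮ = ⊥ := by
    rw [Submodule.eq_bot_iff]
    intro q hq
    rw [Submodule.mem_orthogonal] at hq
    have key := isOpen_Ioo.ae_eq_zero_of_integral_contDiff_smul_eq_zero (μ := volume)
      (f := q) (U := Ioo 0 1) (integrableOn_L2 q).locallyIntegrableOn ?_
    · rw [Lp.eq_zero_iff_ae_eq_zero, Filter.EventuallyEq, ae_restrict_iff' measurableSet_Ioo]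
      exact key
    intro φ h1 h2 h3
    have hφ : IsTestFunction 0 1 φ := ⟨h1, h2, h3⟩
    have h4 := hq _ ⟨⟨φ, hφ⟩, rfl⟩
    change inner ℝ ((hφ.memLp 2 unitMeasure).toLp φ) q = 0 at h4
    rw [inner_toLp_left] at h4
    refine Eq.trans (Eq.symm ?_) h4
    refine setIntegral_eq_integral_of_forall_compl_eq_zero fun x hx => ?_
    simp [hφ.eq_zero_of_notMem hx]
  have h2 := Submodule.topologicalClosure_eq_top_iff.2 h1
  have h3 := (Submodule.dense_iff_topologicalClosure_eq_top).2 h2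
  exact h3

theorem exists_testFunction_tendsto (q : L2Ω) :
    ∃ (ψ : ℕ → ℝ → ℝ) (hψ : ∀ m, IsTestFunction 0 1 (ψ m)),
      Tendsto (fun m => (hψ m).toL2) atTop (𝓝 q) := by
  obtain ⟨x, hx, hlim⟩ := mem_closure_iff_seq_limit.1 (denseRange_testToL2 q)
  choose φ hφ using hx
  refine ⟨fun m => φ m, fun m => (φ m).2, ?_⟩
  have : (fun m => IsTestFunction.toL2 (φ m).2) = x := funext hφ
  rw [this]
  exact hlim

/-! ### Measurability of Sobolev norms on `L²(0, 1)` -/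

theorem isWeakDeriv_iff_inner {j : ℕ} (u w : L2Ω) :
    IsWeakDeriv 0 1 j u w ↔ ∀ φ (hφ : IsTestFunction 0 1 φ),
      inner ℝ (hφ.iteratedDeriv j).toL2 u = (-1) ^ j * inner ℝ hφ.toL2 w := by
  have h1 : ∀ φ (hφ : IsTestFunction 0 1 φ) (f : L2Ω),
      inner ℝ hφ.toL2 f = ∫ x in Ioo (0 : ℝ) 1, φ x * f x := fun φ hφ f => inner_toLp_left _ _
  simp only [h1]
  constructor
  · intro h φ hφ
    simpa using h.2.2 φ hφ
  · intro h
    exact ⟨(integrableOn_L2 u).locallyIntegrableOn, (integrableOn_L2 w).locallyIntegrableOn,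
      fun φ hφ => by simpa using h φ hφ⟩

theorem exists_L2_isWeakDeriv {j : ℕ} {u : ℝ → ℝ} (h : weakDerivNorm 0 1 j u < ⊤) :
    ∃ w : L2Ω, IsWeakDeriv 0 1 j u w ∧ ENNReal.ofReal ‖w‖ = weakDerivNorm 0 1 j u := by
  obtain ⟨w, hw, hm, he⟩ := exists_isWeakDeriv_of_weakDerivNorm_lt_top h
  refine ⟨hm.toLp w, hw.congr (ae_eq_refl _) hm.coeFn_toLp.symm, ?_⟩
  rw [← eLpNorm_eq_ofReal_norm, eLpNorm_congr_ae hm.coeFn_toLp, he]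

/-- Duality: if φ ↦ (φ^(j), u) is bounded by c in the L² norm, it extends by density to all of L²,
and its Riesz representative is, up to sign, the weak derivative. The right-hand side involves `u`
only through continuous functionals, which is what makes measurability in time accessible. -/
theorem weakDerivNorm_le_iff (j : ℕ) (u : L2Ω) (c : ℝ≥0) :
    weakDerivNorm 0 1 j u ≤ c ↔ ∀ φ (hφ : IsTestFunction 0 1 φ),
      |inner ℝ (hφ.iteratedDeriv j).toL2 u| ≤ c * ‖hφ.toL2‖ := by
  constructor
  · intro h φ hφ
    obtain ⟨w, hw, hn⟩ := exists_L2_isWeakDeriv (h.trans_lt ENNReal.coe_lt_top)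
    rw [(isWeakDeriv_iff_inner u w).1 hw φ hφ, abs_mul, abs_pow, abs_neg, abs_one, one_pow,
      one_mul, mul_comm]
    refine (abs_real_inner_le_norm _ _).trans ?_
    refine mul_le_mul_of_nonneg_left ?_ (norm_nonneg _)
    rw [← hn, ← ENNReal.ofReal_coe_nnreal] at h
    exact (ENNReal.ofReal_le_ofReal_iff c.2).1 h
  · intro h
    let F : testSubmodule →ₗ[ℝ] ℝ :=
      { toFun := fun φ => (-1) ^ j * inner ℝ (IsTestFunction.iteratedDeriv φ.2 j).toL2 u
        map_add' := fun φ ψ => by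
          rw [← mul_add, ← inner_add_left]
          congr 2
          refine Eq.trans ?_ (MemLp.toLp_add _ _)
          refine (MemLp.toLp_eq_toLp_iff _ _).2 (Eventually.of_forall fun x => ?_)
          have := iteratedDeriv_add (n := j) (x := x) (f := φ.1) (g := ψ.1)
            ((φ.2.1.of_le (by exact_mod_cast le_top)).contDiffAt)
            ((ψ.2.1.of_le (by exact_mod_cast le_top)).contDiffAt)
          exact this
        map_smul' := fun c φ => by
          rw [RingHom.id_apply, smul_eq_mul, mul_left_comm,
            ← real_inner_smul_left (IsTestFunction.toL2 _) u c]
          refine congrArg (fun z : L2Ω => (-1) ^ j * inner ℝ z u) ?_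
          refine Eq.trans ?_ (MemLp.toLp_const_smul _ _)
          refine (MemLp.toLp_eq_toLp_iff _ _).2 (Eventually.of_forall fun x => ?_)
          exact iteratedDeriv_const_smul_field c φ.1 }
    have hF : ∀ φ, ‖F φ‖ ≤ c * ‖testToL2 φ‖ := fun φ => by
      change |(-1) ^ j * inner ℝ (IsTestFunction.iteratedDeriv φ.2 j).toL2 u| ≤ _
      rw [abs_mul, abs_pow, abs_neg, abs_one, one_pow, one_mul]
      exact h φ.1 φ.2
    let G := F.extendOfNorm testToL2
    have hG : ∀ φ, G (testToL2 φ) = F φ :=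
      LinearMap.extendOfNorm_eq denseRange_testToL2 ⟨c, hF⟩
    have hGn : ∀ x, ‖G x‖ ≤ c * ‖x‖ :=
      LinearMap.norm_extendOfNorm_apply_le denseRange_testToL2 c hF
    let w : L2Ω := (InnerProductSpace.toDual ℝ L2Ω).symm G
    have hw : IsWeakDeriv 0 1 j u w := by
      rw [isWeakDeriv_iff_inner]
      intro φ hφ
      have h1 : inner ℝ hφ.toL2 w = (-1) ^ j * inner ℝ (hφ.iteratedDeriv j).toL2 u := by
        rw [real_inner_comm, InnerProductSpace.toDual_symm_apply]
        exact hG ⟨φ, hφ⟩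
      rw [h1, ← mul_assoc, ← mul_pow]
      simp
    rw [weakDerivNorm_eq hw, eLpNorm_eq_ofReal_norm, LinearIsometryEquiv.norm_map]
    rw [← ENNReal.ofReal_coe_nnreal]
    exact ENNReal.ofReal_le_ofReal (G.opNorm_le_bound c.2 hGn)

/-- By duality every sublevel set is an intersection of closed sets. -/
theorem lowerSemicontinuous_weakDerivNorm (j : ℕ) :
    LowerSemicontinuous fun u : L2Ω => weakDerivNorm 0 1 j u := by
  rw [lowerSemicontinuous_iff_isClosed_preimage]
  intro c
  induction c using ENNReal.recTopCoe with
  | top => simp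
  | coe c =>
    have : (fun u : L2Ω => weakDerivNorm 0 1 j u) ⁻¹' Iic (c : ℝ≥0∞)
        = ⋂ (φ : ℝ → ℝ) (hφ : IsTestFunction 0 1 φ),
          {u | |inner ℝ (hφ.iteratedDeriv j).toL2 u| ≤ c * ‖hφ.toL2‖} := by
      ext u
      simp only [mem_preimage, mem_Iic, mem_iInter, mem_ofPred_eq]
      exact weakDerivNorm_le_iff j u c
    rw [this]
    refine isClosed_iInter fun φ => isClosed_iInter fun hφ => ?_
    exact isClosed_le (by fun_prop) continuous_const

theorem aemeasurable_sobolevNorm {μ : Measure ℝ} {u : ℝ → L2Ω} (hu : AEStronglyMeasurable u μ)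
    (m : ℕ) : AEMeasurable (fun t => sobolevNorm 0 1 m (u t)) μ := by
  borelize L2Ω
  have h1 : Measurable fun u : L2Ω => sobolevNorm 0 1 m u := by
    unfold sobolevNorm
    refine Measurable.pow_const (Finset.measurable_sum _ fun j _ => ?_) _
    exact (lowerSemicontinuous_weakDerivNorm j).measurable.pow_const 2
  exact h1.comp_aemeasurable hu.aemeasurable


/-! ### The Poincaré inequality on an interval -/

section Poincare

variable {a b : ℝ} {r : ℝ → ℝ}

/-- The Cauchy–Schwarz inequality against the constant 1, obtained by expanding the integral of ((b
- a)|r| - I)² ≥ 0. -/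
theorem sq_integral_abs_le (hab : a < b) (hr : MemLp r 2 (volume.restrict (Ioo a b))) :
    (∫ x in Ioo a b, |r x|) ^ 2 ≤ (b - a) * ∫ x in Ioo a b, r x ^ 2 := by
  set I := ∫ x in Ioo a b, |r x|
  have h1 : Integrable (fun x => |r x|) (volume.restrict (Ioo a b)) :=
    (integrableOn_of_memLp hr).abs
  have h2 : Integrable (fun x => r x ^ 2) (volume.restrict (Ioo a b)) := hr.integrable_sq
  have hL : 0 < b - a := sub_pos.2 hab
  have h3 : ∫ x in Ioo a b, ((b - a) * |r x| - I) ^ 2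
      = (b - a) ^ 2 * (∫ x in Ioo a b, r x ^ 2) - (b - a) * I ^ 2 := by
    have : ∀ x, ((b - a) * |r x| - I) ^ 2
        = (b - a) ^ 2 * r x ^ 2 - (2 * (b - a) * I) * |r x| + I ^ 2 := fun x => by
      rw [← sq_abs (r x)]; ring
    simp only [this]
    have h5 : Integrable (fun x => (b - a) ^ 2 * r x ^ 2 - (2 * (b - a) * I) * |r x|)
        (volume.restrict (Ioo a b)) := (h2.const_mul _).sub (h1.const_mul _)
    rw [integral_add h5 (integrableOn_const (by simp)),
      integral_sub (h2.const_mul _) (h1.const_mul _), integral_const_mul, integral_const_mul]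
    simp [hab.le]
    ring
  have h4 : 0 ≤ ∫ x in Ioo a b, ((b - a) * |r x| - I) ^ 2 :=
    integral_nonneg fun x => sq_nonneg _
  rw [h3] at h4
  have h5 : 0 ≤ (b - a) * ((b - a) * (∫ x in Ioo a b, r x ^ 2) - I ^ 2) := by linarith
  linarith [nonneg_of_mul_nonneg_right h5 hL]

theorem sq_intervalIntegral_le (hab : a < b) (hr : MemLp r 2 (volume.restrict (Ioo a b))) {c y : ℝ}
    (hc : c ∈ Icc a b) (hy : y ∈ Icc a b) :
    (∫ x in c..y, r x) ^ 2 ≤ (b - a) * ∫ x in Ioo a b, r x ^ 2 := by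
  refine le_trans ?_ (sq_integral_abs_le hab hr)
  rw [← sq_abs]
  refine pow_le_pow_left₀ (abs_nonneg _) ?_ 2
  have h1 := intervalIntegral.norm_integral_le_integral_norm_uIoc (f := r) (a := c) (b := y)
    (μ := volume)
  refine h1.trans ?_
  rw [← integral_Ioc_eq_integral_Ioo]
  refine setIntegral_mono_set ?_ (Eventually.of_forall fun x => abs_nonneg _) ?_
  · rw [integrableOn_Ioc_iff_integrableOn_Ioo]
    exact (integrableOn_of_memLp hr).abs
  · refine LE.le.eventuallyLE fun x (hx : x ∈ uIoc c y) => ?_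
    exact ⟨lt_of_le_of_lt (le_min hc.1 hy.1) hx.1, hx.2.trans (max_le hc.2 hy.2)⟩

/-- The base point `c` may lie anywhere in the interval: it is an end point for the projection and a
Lagrange point for the interpolation. The constant 1 is what keeps the iterated bounds free of k. -/
theorem integral_sq_le_of_eq_primitive (hab : a < b) (hr : MemLp r 2 (volume.restrict (Ioo a b)))
    {c : ℝ} (hc : c ∈ Icc a b) {e : ℝ → ℝ} (he : ∀ y ∈ Icc a b, e y = ∫ x in c..y, r x) :
    ∫ x in Ioo a b, e x ^ 2 ≤ (b - a) ^ 2 * ∫ x in Ioo a b, r x ^ 2 := by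
  have h1 : ∀ x ∈ Ioo a b, ‖e x ^ 2‖ ≤ (b - a) * ∫ x in Ioo a b, r x ^ 2 := fun x hx => by
    rw [Real.norm_of_nonneg (sq_nonneg _), he x (Ioo_subset_Icc_self hx)]
    exact sq_intervalIntegral_le hab hr hc (Ioo_subset_Icc_self hx)
  have h2 := norm_setIntegral_le_of_norm_le_const (μ := volume) (by simp) h1
  rw [Real.norm_of_nonneg (integral_nonneg fun x => sq_nonneg _), Real.volume_real_Ioo_of_le hab.le]
    at h2
  linarith

end Poincare

theorem norm_sq_eq_integral (f : L2Ω) : ‖f‖ ^ 2 = ∫ x in Ioo (0 : ℝ) 1, f x ^ 2 := by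
  rw [← real_inner_self_eq_norm_sq, inner_eq_integral]
  simp only [sq]

theorem norm_toLp_sq {f : ℝ → ℝ} (hf : MemLp f 2 unitMeasure) :
    ‖hf.toLp f‖ ^ 2 = ∫ x in Ioo (0 : ℝ) 1, f x ^ 2 := by
  rw [← real_inner_self_eq_norm_sq, inner_toLp_toLp]
  simp only [sq]

theorem memLp_of_continuousOn_Icc {a b : ℝ} {f : ℝ → ℝ} (hf : ContinuousOn f (Icc a b)) (p : ℝ≥0∞) :
    MemLp f p (volume.restrict (Ioo a b)) := by
  obtain ⟨C, hC⟩ := isCompact_Icc.exists_bound_of_continuousOn hf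
  refine MemLp.of_bound ((hf.mono Ioo_subset_Icc_self).aestronglyMeasurable measurableSet_Ioo) C ?_
  rw [ae_restrict_iff' measurableSet_Ioo]
  exact Eventually.of_forall fun x hx => hC x (Ioo_subset_Icc_self hx)

/-! ### Primitives of functions in `L²(0, 1)` -/

/-- The primitive `y ↦ ∫₀^y z`. -/
noncomputable def primitive (z : L2Ω) (y : ℝ) : ℝ := ∫ s in (0 : ℝ)..y, z s

theorem continuousOn_primitive_L2 (z : L2Ω) : ContinuousOn (primitive z) (Icc 0 1) :=
  continuousOn_primitive zero_le_one (integrableOn_L2 z)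

theorem memLp_primitive (z : L2Ω) : MemLp (primitive z) 2 unitMeasure :=
  memLp_of_continuousOn_Icc (continuousOn_primitive_L2 z) 2

theorem primitive_zero_left (z : L2Ω) : primitive z 0 = 0 := by simp [primitive]

theorem primitive_one (z : L2Ω) : primitive z 1 = ∫ x in Ioo (0 : ℝ) 1, z x := by
  rw [primitive, integral_Ioo_eq_intervalIntegral zero_le_one]

theorem intervalIntegral_congr_ae_Ioo {a b x y : ℝ} {f g : ℝ → ℝ}
    (h : f =ᵐ[volume.restrict (Ioo a b)] g) (hx : x ∈ Icc a b) (hy : y ∈ Icc a b) :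
    ∫ t in x..y, f t = ∫ t in x..y, g t := by
  have h' : f =ᵐ[volume.restrict (Ioc a b)] g := by
    rwa [← restrict_Ioo_eq_restrict_Ioc]
  rw [Filter.EventuallyEq, ae_restrict_iff' measurableSet_Ioc] at h'
  refine intervalIntegral.integral_congr_ae ?_
  filter_upwards [h'] with t ht ht'
  exact ht ⟨lt_of_le_of_lt (le_min hx.1 hy.1) ht'.1, ht'.2.trans (max_le hx.2 hy.2)⟩

theorem intervalIntegrable_L2 (z : L2Ω) {x y : ℝ} (hx : x ∈ Icc (0 : ℝ) 1) (hy : y ∈ Icc (0 : ℝ) 1) :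
    IntervalIntegrable z volume x y :=
  intervalIntegrable_of_integrableOn_Ioo (integrableOn_L2 z) hx hy

theorem primitive_add (z z' : L2Ω) {y : ℝ} (hy : y ∈ Icc (0 : ℝ) 1) :
    primitive (z + z') y = primitive z y + primitive z' y := by
  have h0 : (0 : ℝ) ∈ Icc (0 : ℝ) 1 := by simp
  unfold primitive
  rw [intervalIntegral_congr_ae_Ioo (Lp.coeFn_add z z') h0 hy]
  exact intervalIntegral.integral_add (intervalIntegrable_L2 z h0 hy) (intervalIntegrable_L2 z' h0 hy)

theorem primitive_smul (c : ℝ) (z : L2Ω) {y : ℝ} (hy : y ∈ Icc (0 : ℝ) 1) :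
    primitive (c • z) y = c * primitive z y := by
  unfold primitive
  rw [intervalIntegral_congr_ae_Ioo (Lp.coeFn_smul c z) (by simp) hy]
  exact intervalIntegral.integral_const_mul c z

theorem primitive_sub (z z' : L2Ω) {y : ℝ} (hy : y ∈ Icc (0 : ℝ) 1) :
    primitive (z - z') y = primitive z y - primitive z' y := by
  rw [sub_eq_add_neg, ← neg_one_smul ℝ z', primitive_add _ _ hy, primitive_smul _ _ hy]
  ring

theorem primitive_sum {ι : Type*} (s : Finset ι) (c : ι → ℝ) (z : ι → L2Ω) {y : ℝ}
    (hy : y ∈ Icc (0 : ℝ) 1) :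
    primitive (∑ i ∈ s, c i • z i) y = ∑ i ∈ s, c i * primitive (z i) y := by
  classical
  induction s using Finset.induction_on with
  | empty =>
    have := primitive_smul 0 (0 : L2Ω) hy
    simpa using this
  | insert i s hi ih =>
    rw [Finset.sum_insert hi, Finset.sum_insert hi, primitive_add _ _ hy, primitive_smul _ _ hy, ih]

/-- Integration `z ↦ ∫₀^· z` as a bounded operator on `L²(0, 1)`. -/
noncomputable def primitiveL2 : L2Ω →L[ℝ] L2Ω :=
  LinearMap.mkContinuous
    { toFun := fun z => (memLp_primitive z).toLp _
      map_add' := fun z z' => by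
        rw [← MemLp.toLp_add]
        refine (MemLp.toLp_eq_toLp_iff _ _).2 ((ae_restrict_iff' measurableSet_Ioo).2 ?_)
        exact Eventually.of_forall fun x hx => primitive_add z z' (Ioo_subset_Icc_self hx)
      map_smul' := fun c z => by
        rw [RingHom.id_apply, ← MemLp.toLp_const_smul]
        refine (MemLp.toLp_eq_toLp_iff _ _).2 ((ae_restrict_iff' measurableSet_Ioo).2 ?_)
        exact Eventually.of_forall fun x hx => primitive_smul c z (Ioo_subset_Icc_self hx) } 1
    fun z => by
      rw [one_mul]
      refine (pow_le_pow_iff_left₀ (norm_nonneg _) (norm_nonneg _) two_ne_zero).1 ?_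
      change ‖(memLp_primitive z).toLp _‖ ^ 2 ≤ _
      rw [norm_toLp_sq, norm_sq_eq_integral]
      have := integral_sq_le_of_eq_primitive zero_lt_one (Lp.memLp z) (c := 0) (by simp)
        (e := primitive z) (fun y _ => rfl)
      simpa using this

theorem coeFn_primitiveL2 (z : L2Ω) : primitiveL2 z =ᵐ[unitMeasure] primitive z :=
  (memLp_primitive z).coeFn_toLp

theorem norm_primitiveL2_le (z : L2Ω) : ‖primitiveL2 z‖ ≤ ‖z‖ := by
  have h : ‖primitiveL2‖ ≤ 1 := LinearMap.mkContinuous_norm_le _ zero_le_one _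
  simpa using primitiveL2.le_of_opNorm_le h z

theorem isWeakDeriv_primitive {u : ℝ → ℝ} {z : L2Ω} (h : u =ᵐ[unitMeasure] primitive z) :
    IsWeakDeriv 0 1 1 u z :=
  isWeakDeriv_of_ae_eq_primitive (c := 0) zero_le_one (integrableOn_L2 z)
    (h.trans (Eventually.of_forall fun _ => (zero_add _).symm))

theorem IsTestFunction.eq_primitive {φ : ℝ → ℝ} (h : IsTestFunction 0 1 φ) {x : ℝ}
    (hx : x ∈ Icc (0 : ℝ) 1) : φ x = NonlocalFEM.primitive h.deriv.toL2 x := by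
  unfold NonlocalFEM.primitive
  have h1 := intervalIntegral_congr_ae_Ioo (h.deriv.memLp 2 unitMeasure).coeFn_toLp
    (x := 0) (by simp) hx
  unfold IsTestFunction.toL2
  rw [h1, intervalIntegral.integral_deriv_eq_sub (fun t _ => (h.1.differentiable (by simp)) t)
    (h.deriv.continuous.intervalIntegrable _ _), h.eq_zero_of_notMem (x := 0) (by simp), sub_zero]

theorem IsTestFunction.toL2_eq_primitiveL2 {φ : ℝ → ℝ} (h : IsTestFunction 0 1 φ) :
    h.toL2 = primitiveL2 h.deriv.toL2 := by
  refine (MemLp.toLp_eq_toLp_iff _ (memLp_primitive _)).2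
    ((ae_restrict_iff' measurableSet_Ioo).2 ?_)
  exact Eventually.of_forall fun x hx => h.eq_primitive (Ioo_subset_Icc_self hx)

/-! ### Characterization of `H₀¹(0, 1)` -/

theorem memLp_const_one : MemLp (fun _ : ℝ => (1 : ℝ)) 2 unitMeasure := memLp_const 1

/-- The constant function `1` in `L²(0, 1)`. -/
noncomputable def oneL2 : L2Ω := memLp_const_one.toLp _

theorem inner_oneL2 (z : L2Ω) : inner ℝ oneL2 z = ∫ x in Ioo (0 : ℝ) 1, z x := by
  rw [oneL2, inner_toLp_left]
  simp

theorem inner_oneL2_eq_primitive (z : L2Ω) : inner ℝ oneL2 z = primitive z 1 := by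
  rw [inner_oneL2, primitive_one]

theorem IsWeakDeriv.sub {a b : ℝ} {j : ℕ} {u u' w w' : ℝ → ℝ} (h : IsWeakDeriv a b j u w)
    (h' : IsWeakDeriv a b j u' w') :
    IsWeakDeriv a b j (fun x => u x - u' x) (fun x => w x - w' x) := by
  refine ⟨h.1.sub h'.1, h.2.1.sub h'.2.1, fun φ hφ => ?_⟩
  simp only [smul_sub]
  rw [integral_sub ((hφ.iteratedDeriv j).integrable_smul h.1)
    ((hφ.iteratedDeriv j).integrable_smul h'.1), integral_sub (hφ.integrable_smul h.2.1)
    (hφ.integrable_smul h'.2.1), h.2.2 φ hφ, h'.2.2 φ hφ, smul_sub]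

theorem isWeakDeriv_zero_self {a b : ℝ} {u : ℝ → ℝ} (h : LocallyIntegrableOn u (Ioo a b)) :
    IsWeakDeriv a b 0 u u :=
  ⟨h, h, fun φ _ => by simp⟩

theorem sobolevNorm_one_le {u : ℝ → ℝ} {z : L2Ω} (h : u =ᵐ[unitMeasure] primitive z) :
    sobolevNorm 0 1 1 u ≤ 2 * ENNReal.ofReal ‖z‖ := by
  have h0 : weakDerivNorm 0 1 0 u ≤ ENNReal.ofReal ‖z‖ := by
    have hw : IsWeakDeriv 0 1 0 u (primitiveL2 z) := by
      have := isWeakDeriv_zero_self (integrableOn_L2 (primitiveL2 z)).locallyIntegrableOn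
      exact this.congr ((coeFn_primitiveL2 z).trans h.symm) (ae_eq_refl _)
    rw [weakDerivNorm_eq hw, eLpNorm_eq_ofReal_norm]
    exact ENNReal.ofReal_le_ofReal (norm_primitiveL2_le z)
  have h1 : weakDerivNorm 0 1 1 u = ENNReal.ofReal ‖z‖ := by
    rw [weakDerivNorm_eq (isWeakDeriv_primitive h), eLpNorm_eq_ofReal_norm]
  unfold sobolevNorm
  simp only [Finset.sum_range_succ, Finset.range_zero, Finset.sum_empty, zero_add, h1]
  set x := ENNReal.ofReal ‖z‖
  calc (weakDerivNorm 0 1 0 u ^ 2 + x ^ 2) ^ (1 / 2 : ℝ)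
      ≤ ((2 * x) ^ 2) ^ (1 / 2 : ℝ) := by
        refine ENNReal.rpow_le_rpow ?_ (by norm_num)
        calc weakDerivNorm 0 1 0 u ^ 2 + x ^ 2 ≤ x ^ 2 + x ^ 2 := by gcongr
          _ = 2 * x ^ 2 := by ring
          _ ≤ 4 * x ^ 2 := by gcongr; norm_num
          _ = (2 * x) ^ 2 := by ring
    _ = 2 * x := by rw [← ENNReal.rpow_natCast, ← ENNReal.rpow_mul]; simp

/-- A test function is the primitive of its derivative, and this derivative has mean zero. Both
relations survive the limit in H¹, because integration and the pairing with 1 are continuous on L².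
-/
theorem MemH10.exists_primitive {u : ℝ → ℝ} (h : MemH10 0 1 u) :
    ∃ z : L2Ω, u =ᵐ[unitMeasure] primitive z ∧ primitive z 1 = 0 := by
  obtain ⟨hfin, φ, hφ, hlim⟩ := h
  obtain ⟨z, hz, -⟩ := exists_L2_isWeakDeriv
    ((weakDerivNorm_le_sobolevNorm le_rfl u).trans_lt hfin)
  obtain ⟨U, hU, -⟩ := exists_L2_isWeakDeriv
    ((weakDerivNorm_le_sobolevNorm (Nat.zero_le 1) u).trans_lt hfin)
  have key : ∀ (j : ℕ) (hj : j ≤ 1) (w : L2Ω), IsWeakDeriv 0 1 j u w →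
      ∀ (d : ℕ → L2Ω), (∀ m, IsWeakDeriv 0 1 j (φ m) (d m)) → Tendsto d atTop (𝓝 w) := by
    intro j hj w hw d hd
    rw [tendsto_iff_norm_sub_tendsto_zero]
    have h1 : ∀ m, ‖d m - w‖ = (weakDerivNorm 0 1 j (fun x => φ m x - u x)).toReal := fun m => by
      rw [weakDerivNorm_eq (((hd m).sub hw).congr (ae_eq_refl _) (Lp.coeFn_sub (d m) w).symm),
        eLpNorm_eq_ofReal_norm, ENNReal.toReal_ofReal (norm_nonneg _)]
    simp only [h1]
    have h2 : Tendsto (fun m => weakDerivNorm 0 1 j (fun x => φ m x - u x)) atTop (𝓝 0) :=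
      tendsto_of_tendsto_of_tendsto_of_le_of_le tendsto_const_nhds hlim (fun _ => zero_le)
        fun m => weakDerivNorm_le_sobolevNorm hj _
    exact (ENNReal.tendsto_toReal ENNReal.zero_ne_top).comp h2
  have hd1 := key 1 le_rfl z hz (fun m => (hφ m).deriv.toL2) fun m =>
    isWeakDeriv_primitive ((ae_restrict_iff' measurableSet_Ioo).2
      (Eventually.of_forall fun x hx => (hφ m).eq_primitive (Ioo_subset_Icc_self hx)))
  have hd0 := key 0 zero_le_one U hU (fun m => (hφ m).toL2) fun m =>
    (isWeakDeriv_zero_self (hφ m).integrable.integrableOn.locallyIntegrableOn).congr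
      (ae_eq_refl _) ((hφ m).memLp 2 unitMeasure).coeFn_toLp.symm
  simp only [(hφ _).toL2_eq_primitiveL2] at hd0
  have hUz : U = primitiveL2 z :=
    tendsto_nhds_unique hd0 ((primitiveL2.continuous.tendsto z).comp hd1)
  refine ⟨z, ?_, ?_⟩
  · exact hU.ae_eq_of_zero.symm.trans (hUz ▸ coeFn_primitiveL2 z)
  · have h1 : Tendsto (fun m => inner ℝ oneL2 ((hφ m).deriv.toL2)) atTop (𝓝 (inner ℝ oneL2 z)) :=
      (tendsto_const_nhds).inner hd1
    have h2 : ∀ m, inner ℝ oneL2 ((hφ m).deriv.toL2) = (0 : ℝ) := fun m => by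
      rw [inner_oneL2_eq_primitive, ← (hφ m).eq_primitive (by simp),
        (hφ m).eq_zero_of_notMem (by simp)]
    simp only [h2] at h1
    rw [← inner_oneL2_eq_primitive]
    exact (tendsto_nhds_unique tendsto_const_nhds h1).symm

/-- Approximate the derivative in L² by test functions, correct their means, and integrate;
integration is bounded from L² to H¹. -/
theorem memH10_of_ae_eq_primitive {u : ℝ → ℝ} {z : L2Ω} (hu : u =ᵐ[unitMeasure] primitive z)
    (hz : primitive z 1 = 0) : MemH10 0 1 u := by
  refine ⟨(sobolevNorm_one_le hu).trans_lt (by finiteness), ?_⟩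
  obtain ⟨ψ, hψ, hlim⟩ := exists_testFunction_tendsto z
  obtain ⟨η, hη, hη1⟩ := IsTestFunction.exists_integral_eq_one (zero_lt_one (α := ℝ))
  -- Subtracting `c m * η` gives mean zero, so the primitive has compact support. The correction
  -- disappears in the limit since `z` itself has mean zero.
  set c : ℕ → ℝ := fun m => ∫ x, ψ m x
  have hχ : ∀ m, IsTestFunction 0 1 (fun x => ψ m x - c m * η x) := fun m =>
    (hψ m).sub (hη.const_mul (c m))
  have hχ0 : ∀ m, ∫ x, (ψ m x - c m * η x) = 0 := fun m => by
    rw [integral_sub (hψ m).integrable (hη.integrable.const_mul _), integral_const_mul, hη1]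
    simp [c]
  have hφ := fun m => (hχ m).primitive_of_integral_eq_zero zero_lt_one (hχ0 m)
  refine ⟨_, hφ, ?_⟩
  have hc : ∀ m, c m = inner ℝ oneL2 (hψ m).toL2 := fun m => by
    rw [inner_oneL2]
    refine (hψ m).integral_Ioo_eq.symm.trans ?_
    exact (integral_congr_ae ((hψ m).memLp 2 unitMeasure).coeFn_toLp).symm
  have hclim : Tendsto c atTop (𝓝 0) := by
    have h1 : Tendsto (fun m => inner ℝ oneL2 (hψ m).toL2) atTop (𝓝 (inner ℝ oneL2 z)) :=
      tendsto_const_nhds.inner hlim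
    rw [inner_oneL2_eq_primitive, hz] at h1
    exact (funext hc : c = _) ▸ h1
  have hχlim : Tendsto (fun m => ‖(hχ m).toL2 - z‖) atTop (𝓝 0) := by
    rw [← tendsto_iff_norm_sub_tendsto_zero]
    have h1 : ∀ m, (hχ m).toL2 = (hψ m).toL2 - c m • hη.toL2 := fun m => rfl
    simp only [h1]
    simpa using hlim.sub (hclim.smul_const hη.toL2)
  have hle : ∀ m, sobolevNorm 0 1 1 (fun x => (∫ t in (0 : ℝ)..x, (ψ m t - c m * η t)) - u x)
      ≤ 2 * ENNReal.ofReal ‖(hχ m).toL2 - z‖ := fun m => by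
    refine sobolevNorm_one_le ?_
    have hu' := hu
    rw [Filter.EventuallyEq, ae_restrict_iff' measurableSet_Ioo] at hu' ⊢
    filter_upwards [hu'] with x hx hx'
    rw [hx hx', primitive_sub _ _ (Ioo_subset_Icc_self hx')]
    congr 1
    exact (intervalIntegral_congr_ae_Ioo ((hχ m).memLp 2 unitMeasure).coeFn_toLp (by simp)
      (Ioo_subset_Icc_self hx')).symm
  refine tendsto_of_tendsto_of_tendsto_of_le_of_le tendsto_const_nhds ?_ (fun _ => zero_le) hle
  have h3 := ENNReal.Tendsto.const_mul (a := 2) (ENNReal.tendsto_ofReal hχlim)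
    (Or.inr (by norm_num))
  simpa using h3

/-! ### Chains of derivatives -/

/-- The functions `f 0, …, f m` are in `L²(a, b)` and each of them, except for the last, is a
primitive of the next one on `[a, b]`. -/
def IsDerivChain (a b : ℝ) (m : ℕ) (f : ℕ → ℝ → ℝ) : Prop :=
  (∀ i ≤ m, MemLp (f i) 2 (volume.restrict (Ioo a b))) ∧
    ∀ i < m, ∀ x ∈ Icc a b, ∀ y ∈ Icc a b, f i y - f i x = ∫ t in x..y, f (i + 1) t

/-- Turns a.e. classes of weak derivatives into representatives for which the fundamental theorem of
calculus holds at every point, as the arguments with zeros and point values need. -/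
theorem exists_derivChain {m : ℕ} {u : ℝ → ℝ} (h : sobolevNorm 0 1 m u < ⊤) :
    ∃ f, IsDerivChain 0 1 m f ∧ ∀ j ≤ m, IsWeakDeriv 0 1 j u (f j) := by
  have hex : ∀ j, ∃ w : ℝ → ℝ, j ≤ m → IsWeakDeriv 0 1 j u w ∧ MemLp w 2 unitMeasure := by
    intro j
    by_cases hj : j ≤ m
    · obtain ⟨w, h1, h2, -⟩ := exists_isWeakDeriv_of_weakDerivNorm_lt_top
        ((weakDerivNorm_le_sobolevNorm hj u).trans_lt h)
      exact ⟨w, fun _ => ⟨h1, h2⟩⟩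
    · exact ⟨0, fun h => absurd h hj⟩
  choose w hw using hex
  have hex2 : ∀ j, ∃ c : ℝ, j < m →
      w j =ᵐ[unitMeasure] fun x => c + ∫ t in (0 : ℝ)..x, w (j + 1) t := by
    intro j
    by_cases hj : j < m
    · obtain ⟨c, hc⟩ := ((hw j hj.le).1.succ (hw (j + 1) hj).1).ae_eq_primitive zero_lt_one
        (integrableOn_of_memLp (hw (j + 1) hj).2)
      exact ⟨c, fun _ => hc⟩
    · exact ⟨0, fun h => absurd h hj⟩
  choose c hc using hex2
  -- All derivatives but the highest have a continuous representative; the highest is only in L².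
  let f : ℕ → ℝ → ℝ := fun j => if j < m then fun x => c j + ∫ t in (0 : ℝ)..x, w (j + 1) t else w j
  have hf : ∀ j, w j =ᵐ[unitMeasure] f j := fun j => by
    by_cases hj : j < m
    · simpa only [f, if_pos hj] using hc j hj
    · simp only [f, if_neg hj]; exact ae_eq_refl _
  refine ⟨f, ⟨fun i hi => (memLp_congr_ae (hf i)).1 (hw i hi).2, fun i hi x hx y hy => ?_⟩,
    fun j hj => (hw j hj).1.congr (ae_eq_refl _) (hf j)⟩
  rw [← intervalIntegral_congr_ae_Ioo (hf (i + 1)) hx hy]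
  simp only [f, if_pos hi]
  have hI : ∀ z ∈ Icc (0 : ℝ) 1, IntervalIntegrable (w (i + 1)) volume 0 z := fun z hz =>
    intervalIntegrable_of_integrableOn_Ioo (integrableOn_of_memLp (hw (i + 1) hi).2) (by simp) hz
  rw [add_sub_add_left_eq_sub, intervalIntegral.integral_interval_sub_left (hI y hy) (hI x hx)]


/-! ### Polynomial approximation on one interval -/

theorem exists_derivative_eq_mem_degreeLT (m : ℕ) {p : ℝ[X]} (hp : p ∈ Polynomial.degreeLT ℝ m)
    (a c : ℝ) :
    ∃ q ∈ Polynomial.degreeLT ℝ (m + 1), q.derivative = p ∧ q.eval a = c := by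
  obtain ⟨q, hq, hqp⟩ : ∃ q ∈ Polynomial.degreeLT ℝ (m + 1), q.derivative = p := by
    refine ⟨∑ i : Fin m, Polynomial.monomial (i + 1) (p.coeff i / (i + 1)), ?_, ?_⟩
    · refine Submodule.sum_mem _ fun i _ => ?_
      exact Polynomial.monomial_coe_mem_degreeLT (n := m + 1) i.succ _
    · rw [Polynomial.derivative_sum]
      have h1 : ∀ i : Fin m, Polynomial.derivative
          (Polynomial.monomial ((i : ℕ) + 1) (p.coeff i / ((i : ℕ) + 1)))
          = Polynomial.monomial (i : ℕ) (p.coeff i) := fun i => by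
        rw [Polynomial.derivative_monomial]
        have : ((i : ℕ) : ℝ) + 1 ≠ 0 := by positivity
        simp [div_mul_cancel₀ _ this]
      simp only [h1]
      rw [Fin.sum_univ_eq_sum_range (fun i => Polynomial.monomial i (p.coeff i))]
      rcases Nat.eq_zero_or_pos m with rfl | hm
      · have : p = 0 := by
          rw [Polynomial.mem_degreeLT] at hp
          simpa using hp
        simp [this]
      · refine (Polynomial.as_sum_range' p m ?_).symm
        rw [Polynomial.mem_degreeLT] at hp
        rcases eq_or_ne p 0 with rfl | h0
        · simpa using hm
        · exact (Polynomial.natDegree_lt_iff_degree_lt h0).2 hp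
  refine ⟨q + Polynomial.C (c - q.eval a), Submodule.add_mem _ hq ?_, by simp [hqp], by simp⟩
  rw [Polynomial.mem_degreeLT]
  exact Polynomial.degree_C_le.trans_lt (by exact_mod_cast Nat.succ_pos m)

theorem intervalIntegral_eval_derivative (p : ℝ[X]) (x y : ℝ) :
    ∫ t in x..y, (Polynomial.derivative p).eval t = p.eval y - p.eval x :=
  intervalIntegral.integral_eq_sub_of_hasDerivAt (fun t _ => p.hasDerivAt t)
    (p.derivative.continuous.intervalIntegrable _ _)

namespace IsDerivChain

variable {a b : ℝ} {m : ℕ} {f : ℕ → ℝ → ℝ}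

theorem intervalIntegrable (h : IsDerivChain a b m f) {i : ℕ} (hi : i ≤ m) {x y : ℝ}
    (hx : x ∈ Icc a b) (hy : y ∈ Icc a b) : IntervalIntegrable (f i) volume x y :=
  intervalIntegrable_of_integrableOn_Ioo (integrableOn_of_memLp (h.1 i hi)) hx hy

theorem shift (h : IsDerivChain a b (m + 1) f) : IsDerivChain a b m fun i => f (i + 1) :=
  ⟨fun i hi => h.1 (i + 1) (by omega), fun i hi => h.2 (i + 1) (by omega)⟩

theorem mono {c d : ℝ} (h : IsDerivChain a b m f) (hcd : Icc c d ⊆ Icc a b)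
    (hcd' : Ioo c d ⊆ Ioo a b) : IsDerivChain c d m f :=
  ⟨fun i hi => (h.1 i hi).mono_measure (Measure.restrict_mono hcd' le_rfl),
    fun i hi x hx y hy => h.2 i hi x (hcd hx) y (hcd hy)⟩

theorem sub_polynomial (h : IsDerivChain a b m f) (p : ℝ[X]) :
    IsDerivChain a b m fun i x => f i x - (Polynomial.derivative^[i] p).eval x := by
  refine ⟨fun i hi => (h.1 i hi).sub
    (memLp_of_continuousOn_Icc (Polynomial.continuous _).continuousOn 2),
    fun i hi x hx y hy => ?_⟩
  rw [intervalIntegral.integral_sub (h.intervalIntegrable hi hx hy)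
    ((Polynomial.continuous _).intervalIntegrable _ _), ← h.2 i hi x hx y hy,
    Function.iterate_succ_apply', intervalIntegral_eval_derivative]
  ring

theorem continuousOn (h : IsDerivChain a b m f) (hab : a ≤ b) {i : ℕ} (hi : i < m) :
    ContinuousOn (f i) (Icc a b) := by
  have h1 := continuousOn_primitive hab (integrableOn_of_memLp (h.1 (i + 1) hi))
  refine ((h1.const_add (f i a))).congr fun y hy => ?_
  have := h.2 i hi a (left_mem_Icc.2 hab) y hy
  simp only
  linarith

/-- A function with a chain of `m` derivatives is approximated to order `m` by a polynomial of
degree less than `m`. -/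
theorem exists_polynomial_approx (hab : a < b) (h : IsDerivChain a b m f) :
    ∃ p ∈ Polynomial.degreeLT ℝ m, ∫ x in Ioo a b, (f 0 x - p.eval x) ^ 2
      ≤ ((b - a) ^ m) ^ 2 * ∫ x in Ioo a b, f m x ^ 2 := by
  induction m generalizing f with
  | zero => exact ⟨0, Submodule.zero_mem _, by simp⟩
  | succ m ih =>
    obtain ⟨p, hp, hle⟩ := ih h.shift
    -- The polynomial found for the derivative is integrated so as to match `f 0` at `a`. The error
    -- is then a primitive that starts from zero, and Poincaré's inequality contributes one factor
    -- `b - a`.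
    obtain ⟨q, hq, hqp, hqa⟩ := exists_derivative_eq_mem_degreeLT m hp a (f 0 a)
    refine ⟨q, hq, ?_⟩
    have ha : a ∈ Icc a b := left_mem_Icc.2 hab.le
    have h1 := integral_sq_le_of_eq_primitive hab (r := fun x => f 1 x - p.eval x)
      ((h.1 1 (by omega)).sub (memLp_of_continuousOn_Icc p.continuous.continuousOn 2)) ha
      (e := fun x => f 0 x - q.eval x) (fun y hy => by
        rw [intervalIntegral.integral_sub (h.intervalIntegrable (by omega) ha hy)
          (p.continuous.intervalIntegrable _ _), ← h.2 0 (by omega) a ha y hy, ← hqp,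
          intervalIntegral_eval_derivative, hqa]
        ring)
    refine h1.trans ?_
    calc (b - a) ^ 2 * ∫ x in Ioo a b, (f 1 x - p.eval x) ^ 2
        ≤ (b - a) ^ 2 * (((b - a) ^ m) ^ 2 * ∫ x in Ioo a b, f (m + 1) x ^ 2) :=
          mul_le_mul_of_nonneg_left hle (sq_nonneg _)
      _ = _ := by ring

/-- Rolle's theorem between consecutive zeros. With `2 ≤ m` the function `f 1` is continuous, so `f
0` is classically differentiable in the interior. -/
theorem exists_zeros_succ (h : IsDerivChain a b m f) (hab : a ≤ b) (hm : 2 ≤ m)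
    {n : ℕ} {p : Fin (n + 1) → ℝ} (hp : StrictMono p) (hpm : ∀ i, p i ∈ Icc a b)
    (hz : ∀ i, f 0 (p i) = 0) :
    ∃ q : Fin n → ℝ, StrictMono q ∧ (∀ i, q i ∈ Icc a b) ∧ ∀ i, f 1 (q i) = 0 := by
  have hex : ∀ i : Fin n, ∃ c ∈ Ioo (p i.castSucc) (p i.succ), f 1 c = 0 := by
    intro i
    have hlt : p i.castSucc < p i.succ := hp (Fin.castSucc_lt_succ)
    have hsub : Icc (p i.castSucc) (p i.succ) ⊆ Icc a b :=
      Icc_subset_Icc (hpm _).1 (hpm _).2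
    refine exists_hasDerivAt_eq_zero (f := f 0) hlt
      ((h.continuousOn hab (by omega)).mono hsub) ((hz _).trans (hz _).symm) fun x hx => ?_
    have hx' : x ∈ Ioo a b := ⟨(hpm i.castSucc).1.trans_lt hx.1, hx.2.trans_le (hpm i.succ).2⟩
    have hc : ContinuousOn (f 1) (Icc a b) := h.continuousOn hab (by omega)
    have ha : a ∈ Icc a b := left_mem_Icc.2 hab
    have h1 : HasDerivAt (fun y => ∫ t in a..y, f 1 t) (f 1 x) x := by
      refine intervalIntegral.integral_hasDerivAt_right
        (h.intervalIntegrable (by omega) ha (Ioo_subset_Icc_self hx')) ?_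
        (hc.continuousAt (Icc_mem_nhds hx'.1 hx'.2))
      exact (hc.mono Ioo_subset_Icc_self).stronglyMeasurableAtFilter isOpen_Ioo x hx'
    refine (h1.const_add (f 0 a)).congr_of_eventuallyEq ?_
    filter_upwards [Ioo_mem_nhds hx'.1 hx'.2] with y hy
    have := h.2 0 (by omega) a ha y (Ioo_subset_Icc_self hy)
    linarith
  choose q hq hq0 using hex
  refine ⟨q, fun i j hij => ?_, fun i => ?_, hq0⟩
  · refine (hq i).2.trans (lt_of_le_of_lt (hp.monotone ?_) (hq j).1)
    exact Fin.succ_le_castSucc_iff.2 hij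
  · exact ⟨(hpm _).1.trans (hq i).1.le, (hq i).2.le.trans (hpm _).2⟩

/-- A function with a chain of `m` derivatives and `m` zeros is small of order `m`. -/
theorem integral_sq_le_of_zeros (hab : a < b) (h : IsDerivChain a b m f)
    {p : Fin m → ℝ} (hp : StrictMono p) (hpm : ∀ i, p i ∈ Icc a b) (hz : ∀ i, f 0 (p i) = 0) :
    ∫ x in Ioo a b, f 0 x ^ 2 ≤ ((b - a) ^ m) ^ 2 * ∫ x in Ioo a b, f m x ^ 2 := by
  induction m generalizing f with
  | zero => simp
  | succ m ih =>
    have h1 := integral_sq_le_of_eq_primitive hab (h.1 1 (by omega)) (hpm 0) (e := f 0)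
      (fun y hy => by rw [← h.2 0 (by omega) _ (hpm 0) y hy, hz, sub_zero])
    refine h1.trans ?_
    have h2 : ∫ x in Ioo a b, f 1 x ^ 2 ≤ ((b - a) ^ m) ^ 2 * ∫ x in Ioo a b, f (m + 1) x ^ 2 := by
      -- For a chain of length one, `f 1` is already the last function, and neither zeros nor
      -- continuity of it are needed.
      rcases Nat.eq_zero_or_pos m with rfl | hm
      · simp
      · obtain ⟨q, hq, hqm, hqz⟩ := h.exists_zeros_succ hab.le (by omega) hp hpm hz
        exact ih h.shift hq hqm hqz
    calc (b - a) ^ 2 * ∫ x in Ioo a b, f 1 x ^ 2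
        ≤ (b - a) ^ 2 * (((b - a) ^ m) ^ 2 * ∫ x in Ioo a b, f (m + 1) x ^ 2) :=
          mul_le_mul_of_nonneg_left h2 (sq_nonneg _)
      _ = _ := by ring

end IsDerivChain

/-! ### Meshes -/

namespace Mesh

variable {k : ℕ} (M : Mesh k)

theorem x_lt (j : Fin M.N) : M.x j.castSucc < M.x j.succ := M.x_strictMono Fin.castSucc_lt_succ

theorem x_mem (j : Fin (M.N + 1)) : M.x j ∈ Icc (0 : ℝ) 1 :=
  ⟨M.x_zero ▸ M.x_strictMono.monotone (Fin.zero_le j),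
    M.x_last ▸ M.x_strictMono.monotone (Fin.le_last j)⟩

theorem Icc_subset (j : Fin M.N) : Icc (M.x j.castSucc) (M.x j.succ) ⊆ Icc 0 1 :=
  Icc_subset_Icc (M.x_mem _).1 (M.x_mem _).2

theorem Ioo_subset (j : Fin M.N) : Ioo (M.x j.castSucc) (M.x j.succ) ⊆ Ioo 0 1 :=
  Ioo_subset_Ioo (M.x_mem _).1 (M.x_mem _).2

theorem sub_le_h (j : Fin M.N) : M.x j.succ - M.x j.castSucc ≤ M.h :=
  le_ciSup (f := fun j : Fin M.N => M.x j.succ - M.x j.castSucc) (Set.finite_range _).bddAbove j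

theorem N_pos : 0 < M.N := by
  rcases Nat.eq_zero_or_pos M.N with h | h
  · have h0 := M.x_zero
    have h1 := M.x_last
    have : Fin.last M.N = 0 := by
      ext
      simpa using h
    rw [this, h0] at h1
    exact absurd h1 zero_ne_one
  · exact h

theorem h_nonneg : 0 ≤ M.h :=
  le_trans (sub_nonneg.2 (M.x_lt ⟨0, M.N_pos⟩).le) (M.sub_le_h ⟨0, M.N_pos⟩)

theorem exists_mem_Ico {y : ℝ} (hy : y ∈ Ico (0 : ℝ) 1) :
    ∃ j : Fin M.N, y ∈ Ico (M.x j.castSucc) (M.x j.succ) := by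
  by_contra! hcon
  have h : ∀ j, M.x j ≤ y := by
    intro j
    induction j using Fin.induction with
    | zero => rw [M.x_zero]; exact hy.1
    | succ j ih =>
      by_contra! hlt
      exact hcon j ⟨ih, hlt⟩
  have := h (Fin.last _)
  rw [M.x_last] at this
  exact absurd hy.2 (not_lt.2 this)

theorem exists_mem_Icc {y : ℝ} (hy : y ∈ Icc (0 : ℝ) 1) :
    ∃ j : Fin M.N, y ∈ Icc (M.x j.castSucc) (M.x j.succ) := by
  rcases hy.2.eq_or_lt with h1 | h1
  · refine ⟨⟨M.N - 1, by have := M.N_pos; omega⟩, ?_⟩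
    have hl : (⟨M.N - 1, by have := M.N_pos; omega⟩ : Fin M.N).succ = Fin.last M.N := by
      ext; simp; have := M.N_pos; omega
    rw [hl, M.x_last, h1]
    exact ⟨(M.x_mem _).2, le_rfl⟩
  · obtain ⟨j, hj⟩ := M.exists_mem_Ico ⟨hy.1, h1⟩
    exact ⟨j, Ico_subset_Icc_self hj⟩

theorem ae_exists_mem_Ioo :
    ∀ᵐ y ∂unitMeasure, ∃ j : Fin M.N, y ∈ Ioo (M.x j.castSucc) (M.x j.succ) := by
  have h1 : ∀ᵐ y : ℝ, y ∉ Set.range M.x := (Set.finite_range M.x).countable.ae_notMem volume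
  rw [ae_restrict_iff' measurableSet_Ioo]
  filter_upwards [h1] with y hy hy'
  obtain ⟨j, hj⟩ := M.exists_mem_Ico (Ioo_subset_Ico_self hy')
  exact ⟨j, lt_of_le_of_ne hj.1 fun h => hy ⟨_, h⟩, hj.2⟩

theorem eq_of_mem_Ioo {y : ℝ} {i j : Fin M.N} (hi : y ∈ Ioo (M.x i.castSucc) (M.x i.succ))
    (hj : y ∈ Ioo (M.x j.castSucc) (M.x j.succ)) : i = j := by
  rcases lt_trichotomy i j with h | h | h
  · have := M.x_strictMono.monotone (Fin.succ_le_castSucc_iff.2 h)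
    linarith [hi.2, hj.1]
  · exact h
  · have := M.x_strictMono.monotone (Fin.succ_le_castSucc_iff.2 h)
    linarith [hj.2, hi.1]

theorem integral_eq_sum {f : ℝ → ℝ} (hf : IntegrableOn f (Ioo 0 1)) :
    ∫ y in Ioo (0 : ℝ) 1, f y = ∑ j : Fin M.N, ∫ y in Ioo (M.x j.castSucc) (M.x j.succ), f y := by
  rw [← integral_iUnion_fintype (fun j => measurableSet_Ioo)
    (fun i j hij => Set.disjoint_left.2 fun y hi hj => hij (M.eq_of_mem_Ioo hi hj))
    fun j => hf.mono_set (M.Ioo_subset j)]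
  refine setIntegral_congr_set ?_
  have h1 := M.ae_exists_mem_Ioo
  rw [ae_restrict_iff' measurableSet_Ioo] at h1
  filter_upwards [h1] with y hy
  refine propext ⟨fun h => ?_, fun h => ?_⟩
  · exact mem_iUnion.2 (hy h)
  · obtain ⟨j, hj⟩ := mem_iUnion.1 h
    exact M.Ioo_subset j hj

/-- Squared L² norms add over the cells, so the passage from local to global estimates costs no
constant and needs no regularity of the mesh. -/
theorem integral_sq_le_of_local {e r : ℝ → ℝ} (m : ℕ) (he : MemLp e 2 unitMeasure)
    (hr : MemLp r 2 unitMeasure)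
    (h : ∀ j : Fin M.N, ∫ y in Ioo (M.x j.castSucc) (M.x j.succ), e y ^ 2
      ≤ ((M.x j.succ - M.x j.castSucc) ^ m) ^ 2
        * ∫ y in Ioo (M.x j.castSucc) (M.x j.succ), r y ^ 2) :
    ∫ y in Ioo (0 : ℝ) 1, e y ^ 2 ≤ (M.h ^ m) ^ 2 * ∫ y in Ioo (0 : ℝ) 1, r y ^ 2 := by
  rw [M.integral_eq_sum he.integrable_sq, M.integral_eq_sum hr.integrable_sq, Finset.mul_sum]
  refine Finset.sum_le_sum fun j _ => (h j).trans ?_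
  refine mul_le_mul_of_nonneg_right ?_ (integral_nonneg fun y => sq_nonneg _)
  have h0 : 0 ≤ M.x j.succ - M.x j.castSucc := sub_nonneg.2 (M.x_lt j).le
  exact pow_le_pow_left₀ (pow_nonneg h0 _) (pow_le_pow_left₀ h0 (M.sub_le_h j) _) 2

/-! ### Piecewise polynomials -/

/-- The function that is equal to the polynomial `p j` in the interior of the `j`-th interval. -/
noncomputable def piecewise (p : Fin M.N → ℝ[X]) (y : ℝ) : ℝ :=
  ∑ j, (Ioo (M.x j.castSucc) (M.x j.succ)).indicator (fun y => (p j).eval y) y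

theorem piecewise_eq (p : Fin M.N → ℝ[X]) {j : Fin M.N} {y : ℝ}
    (hy : y ∈ Ioo (M.x j.castSucc) (M.x j.succ)) : M.piecewise p y = (p j).eval y := by
  unfold piecewise
  rw [Finset.sum_eq_single j]
  · exact indicator_of_mem hy _
  · intro i _ hij
    exact indicator_of_notMem (fun hi => hij (M.eq_of_mem_Ioo hi hy)) _
  · simp

theorem memLp_piecewise (p : Fin M.N → ℝ[X]) : MemLp (M.piecewise p) 2 unitMeasure := by
  unfold piecewise
  refine memLp_finsetSum _ fun j _ => ?_
  exact (memLp_of_continuousOn_Icc (p j).continuous.continuousOn 2).indicator measurableSet_Ioo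

/-- The class of a piecewise polynomial in `L²(0, 1)`. -/
noncomputable def piecewiseL2 : (Fin M.N → ℝ[X]) →ₗ[ℝ] L2Ω where
  toFun p := (M.memLp_piecewise p).toLp _
  map_add' p q := by
    rw [← MemLp.toLp_add]
    refine (MemLp.toLp_eq_toLp_iff _ _).2 ?_
    filter_upwards [M.ae_exists_mem_Ioo] with y ⟨j, hj⟩
    simp [M.piecewise_eq _ hj]
  map_smul' c p := by
    rw [RingHom.id_apply, ← MemLp.toLp_const_smul]
    refine (MemLp.toLp_eq_toLp_iff _ _).2 ?_
    filter_upwards [M.ae_exists_mem_Ioo] with y ⟨j, hj⟩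
    simp [M.piecewise_eq _ hj]

theorem coeFn_piecewiseL2 (p : Fin M.N → ℝ[X]) :
    M.piecewiseL2 p =ᵐ[unitMeasure] M.piecewise p :=
  (M.memLp_piecewise p).coeFn_toLp

theorem ae_restrict_cell {p : ℝ → Prop} (h : ∀ᵐ y ∂unitMeasure, p y) (j : Fin M.N) :
    ∀ᵐ y ∂(volume.restrict (Ioo (M.x j.castSucc) (M.x j.succ))), p y :=
  ae_restrict_of_ae_restrict_of_subset (M.Ioo_subset j) h

theorem piecewiseL2_ae_eq (p : Fin M.N → ℝ[X]) (j : Fin M.N) :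
    M.piecewiseL2 p =ᵐ[volume.restrict (Ioo (M.x j.castSucc) (M.x j.succ))]
      fun y => (p j).eval y := by
  have h := M.ae_restrict_cell (M.coeFn_piecewiseL2 p) j
  rw [Filter.EventuallyEq, ae_restrict_iff' measurableSet_Ioo]
  rw [ae_restrict_iff' measurableSet_Ioo] at h
  filter_upwards [h] with y hy hy'
  rw [hy hy', M.piecewise_eq p hy']

/-- The space of piecewise polynomials of degree less than `k`. -/
noncomputable def gradSpace : Submodule ℝ L2Ω :=
  LinearMap.range (M.piecewiseL2 ∘ₗ (Polynomial.degreeLT ℝ k).subtype.compLeft (Fin M.N))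

theorem piecewiseL2_mem_gradSpace {p : Fin M.N → ℝ[X]} (hp : ∀ j, p j ∈ Polynomial.degreeLT ℝ k) :
    M.piecewiseL2 p ∈ M.gradSpace :=
  ⟨fun j => ⟨p j, hp j⟩, rfl⟩

theorem exists_of_mem_gradSpace {q : L2Ω} (hq : q ∈ M.gradSpace) :
    ∃ p : Fin M.N → ℝ[X], (∀ j, p j ∈ Polynomial.degreeLT ℝ k) ∧ M.piecewiseL2 p = q := by
  obtain ⟨p, hp⟩ := hq
  exact ⟨fun j => p j, fun j => (p j).2, hp⟩

instance finiteDimensional_gradSpace : FiniteDimensional ℝ M.gradSpace := by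
  have : Module.Finite ℝ (Polynomial.degreeLT ℝ k) :=
    Module.Finite.equiv (Polynomial.degreeLTEquiv ℝ k).symm
  unfold gradSpace
  infer_instance

/-- The orthogonal projection of `L²(0, 1)` onto the piecewise polynomials of degree less than
`k`. Applied to derivatives, it is the elliptic projection. -/
noncomputable def gradProj : L2Ω →L[ℝ] L2Ω := M.gradSpace.starProjection

theorem gradProj_mem (z : L2Ω) : M.gradProj z ∈ M.gradSpace :=
  Submodule.starProjection_apply_mem _ z

theorem inner_sub_gradProj (z : L2Ω) {q : L2Ω} (hq : q ∈ M.gradSpace) :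
    inner ℝ (z - M.gradProj z) q = 0 :=
  Submodule.starProjection_inner_eq_zero z q hq

theorem norm_sub_gradProj_le (z : L2Ω) {q : L2Ω} (hq : q ∈ M.gradSpace) :
    ‖z - M.gradProj z‖ ≤ ‖z - q‖ := by
  unfold gradProj
  rw [M.gradSpace.starProjection_minimal]
  exact ciInf_le ⟨0, by rintro _ ⟨w, rfl⟩; exact norm_nonneg _⟩ (⟨q, hq⟩ : M.gradSpace)

/-- The piecewise polynomials need not be continuous, so a best approximation may be chosen on each
cell separately; the projection does at least as well. -/
theorem norm_sub_gradProj_sq_le {z : L2Ω} {f : ℕ → ℝ → ℝ} (hf : IsDerivChain 0 1 k f)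
    (hz : z =ᵐ[unitMeasure] f 0) :
    ‖z - M.gradProj z‖ ^ 2 ≤ (M.h ^ k) ^ 2 * ∫ x in Ioo (0 : ℝ) 1, f k x ^ 2 := by
  have hloc := fun j => (hf.mono (M.Icc_subset j) (M.Ioo_subset j)).exists_polynomial_approx
    (M.x_lt j)
  choose p hp hle using hloc
  have h1 := M.norm_sub_gradProj_le z (M.piecewiseL2_mem_gradSpace hp)
  refine (pow_le_pow_left₀ (norm_nonneg _) h1 2).trans ?_
  rw [norm_sq_eq_integral]
  refine M.integral_sq_le_of_local k (Lp.memLp _) (hf.1 k le_rfl) fun j => ?_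
  refine le_trans (le_of_eq ?_) (hle j)
  refine integral_congr_ae ?_
  filter_upwards [M.ae_restrict_cell hz j, M.piecewiseL2_ae_eq p j,
    M.ae_restrict_cell (Lp.coeFn_sub z (M.piecewiseL2 p)) j] with y h1 h2 h3
  rw [h3, Pi.sub_apply, h1, h2]

theorem primitive_sub_primitive (z : L2Ω) {x y : ℝ} (hx : x ∈ Icc (0 : ℝ) 1)
    (hy : y ∈ Icc (0 : ℝ) 1) : primitive z y - primitive z x = ∫ t in x..y, z t :=
  intervalIntegral.integral_interval_sub_left (intervalIntegrable_L2 z (by simp) hy)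
    (intervalIntegrable_L2 z (by simp) hx)

/-- For `1 ≤ k` the indicator of a cell belongs to `gradSpace`, so the error of the projection has
mean zero on each cell and its primitive returns to zero at each node. -/
theorem primitive_sub_gradProj_node (hk : 1 ≤ k) (z : L2Ω) (j : Fin (M.N + 1)) :
    primitive (z - M.gradProj z) (M.x j) = 0 := by
  induction j using Fin.induction with
  | zero => rw [M.x_zero, primitive_zero_left]
  | succ j ih =>
    have h1 := primitive_sub_primitive (z - M.gradProj z) (M.x_mem j.castSucc) (M.x_mem j.succ)
    rw [ih, sub_zero] at h1
    rw [h1, ← integral_Ioo_eq_intervalIntegral (M.x_lt j).le]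
    have hq : M.piecewiseL2 (Pi.single j 1) ∈ M.gradSpace := by
      refine M.piecewiseL2_mem_gradSpace fun i => ?_
      rw [Polynomial.mem_degreeLT]
      rcases eq_or_ne i j with rfl | hij
      · rw [Pi.single_eq_same]
        exact Polynomial.degree_one_le.trans_lt (by exact_mod_cast hk)
      · rw [Pi.single_eq_of_ne hij]
        simp
    have h2 := M.inner_sub_gradProj z hq
    rw [real_inner_comm, inner_eq_integral, M.integral_eq_sum
      (integrable_mul_of_memLp (Lp.memLp _) (Lp.memLp _)), Finset.sum_eq_single j] at h2
    · refine Eq.trans ?_ h2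
      refine integral_congr_ae ?_
      filter_upwards [M.piecewiseL2_ae_eq (Pi.single j 1) j] with y hy
      rw [hy]
      simp
    · intro i _ hij
      rw [integral_congr_ae (g := fun _ => (0 : ℝ))]
      · simp
      · filter_upwards [M.piecewiseL2_ae_eq (Pi.single j 1) i] with y hy
        rw [hy, Pi.single_eq_of_ne hij]
        simp
    · simp

/-- The elliptic projection gains one order in `L²`. -/
theorem norm_primitiveL2_sub_gradProj_le (hk : 1 ≤ k) (z : L2Ω) :
    ‖primitiveL2 (z - M.gradProj z)‖ ≤ M.h * ‖z - M.gradProj z‖ := by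
  refine (pow_le_pow_iff_left₀ (norm_nonneg _) (mul_nonneg M.h_nonneg (norm_nonneg _))
    two_ne_zero).1 ?_
  set r := z - M.gradProj z
  rw [mul_pow, norm_sq_eq_integral, norm_sq_eq_integral]
  have h1 := M.integral_sq_le_of_local (e := primitiveL2 r) (r := r) 1 (Lp.memLp _) (Lp.memLp _) ?_
  · simpa using h1
  intro j
  have h2 := integral_sq_le_of_eq_primitive (M.x_lt j)
    ((Lp.memLp r).mono_measure (Measure.restrict_mono (M.Ioo_subset j) le_rfl))
    (left_mem_Icc.2 (M.x_lt j).le) (e := primitive r) (fun y hy => by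
      rw [← primitive_sub_primitive r (M.x_mem _) (M.Icc_subset j hy),
        M.primitive_sub_gradProj_node hk, sub_zero])
  rw [pow_one]
  refine le_trans (le_of_eq (integral_congr_ae ?_)) h2
  filter_upwards [M.ae_restrict_cell (coeFn_primitiveL2 r) j] with y hy
  rw [hy]

theorem norm_primitiveL2_sub_gradProj_sq_le (hk : 1 ≤ k) {z : L2Ω} {f : ℕ → ℝ → ℝ}
    (hf : IsDerivChain 0 1 k f) (hz : z =ᵐ[unitMeasure] f 0) :
    ‖primitiveL2 (z - M.gradProj z)‖ ^ 2
      ≤ (M.h ^ (k + 1)) ^ 2 * ∫ x in Ioo (0 : ℝ) 1, f k x ^ 2 := by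
  calc ‖primitiveL2 (z - M.gradProj z)‖ ^ 2 ≤ (M.h * ‖z - M.gradProj z‖) ^ 2 :=
        pow_le_pow_left₀ (norm_nonneg _) (M.norm_primitiveL2_sub_gradProj_le hk z) 2
    _ = M.h ^ 2 * ‖z - M.gradProj z‖ ^ 2 := by ring
    _ ≤ M.h ^ 2 * ((M.h ^ k) ^ 2 * ∫ x in Ioo (0 : ℝ) 1, f k x ^ 2) :=
        mul_le_mul_of_nonneg_left (M.norm_sub_gradProj_sq_le hf hz) (sq_nonneg _)
    _ = _ := by ring

/-- The error of Lagrange interpolation, with a constant that does not depend on the nodes. -/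
theorem IsInterpolant.integral_sq_sub_le {W u : ℝ → ℝ} (hW : M.IsInterpolant u W)
    {f : ℕ → ℝ → ℝ} (hf : IsDerivChain 0 1 (k + 1) f) (hu : ∀ y ∈ Icc (0 : ℝ) 1, f 0 y = u y) :
    ∫ y in Ioo (0 : ℝ) 1, (u y - W y) ^ 2
      ≤ (M.h ^ (k + 1)) ^ 2 * ∫ x in Ioo (0 : ℝ) 1, f (k + 1) x ^ 2 := by
  have hc : ContinuousOn u (Icc 0 1) :=
    (hf.continuousOn zero_le_one (Nat.succ_pos k)).congr fun y hy => (hu y hy).symm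
  refine M.integral_sq_le_of_local (k + 1)
    (memLp_of_continuousOn_Icc (hc.sub hW.1.1) 2) (hf.1 _ le_rfl) fun j => ?_
  obtain ⟨p, hp, hpW⟩ := hW.1.2.2.2 j
  have hPm : ∀ l, M.P j l ∈ Icc (M.x j.castSucc) (M.x j.succ) := fun l =>
    ⟨M.P_zero j ▸ (M.P_strictMono j).monotone (Fin.zero_le l),
      M.P_last j ▸ (M.P_strictMono j).monotone (Fin.le_last l)⟩
  have h1 := ((hf.mono (M.Icc_subset j) (M.Ioo_subset j)).sub_polynomial p).integral_sq_le_of_zeros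
    (M.x_lt j) (M.P_strictMono j) hPm (fun l => by
      simp only [Function.iterate_zero, id]
      rw [hu _ (M.Icc_subset j (hPm l)), ← hpW _ (hPm l), hW.2 j l, sub_self])
  -- The error vanishes at k + 1 points, and its derivative of order k + 1 is that of `u` alone: the
  -- finite element function drops out.
  have h2 : Polynomial.derivative^[k + 1] p = 0 :=
    Polynomial.iterate_derivative_eq_zero (by omega)
  simp only [h2, Polynomial.eval_zero, sub_zero, Function.iterate_zero, id] at h1
  refine le_trans (le_of_eq (setIntegral_congr_fun measurableSet_Ioo fun y hy => ?_)) h1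
  rw [hpW y (Ioo_subset_Icc_self hy), hu y (M.Icc_subset j (Ioo_subset_Icc_self hy))]

end Mesh


/-! ### Finite element functions as primitives of piecewise polynomials -/

theorem ae_hasDerivAt_primitive_L2 (q : L2Ω) :
    ∀ᵐ y ∂unitMeasure, HasDerivAt (primitive q) (q y) y :=
  ae_hasDerivAt_primitive zero_le_one (integrableOn_L2 q)

theorem deriv_primitive_ae_eq (q : L2Ω) : deriv (primitive q) =ᵐ[unitMeasure] q := by
  filter_upwards [ae_hasDerivAt_primitive_L2 q] with y hy using hy.deriv

namespace Mesh

variable {k : ℕ} (M : Mesh k)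

theorem intervalIntegral_piecewiseL2 (p : Fin M.N → ℝ[X]) (j : Fin M.N) {x y : ℝ}
    (hx : x ∈ Icc (M.x j.castSucc) (M.x j.succ)) (hy : y ∈ Icc (M.x j.castSucc) (M.x j.succ)) :
    ∫ t in x..y, M.piecewiseL2 p t = ∫ t in x..y, (p j).eval t :=
  intervalIntegral_congr_ae_Ioo (M.piecewiseL2_ae_eq p j) hx hy

/-- The derivative of the piecewise polynomial with given values at the Lagrange points. -/
noncomputable def nodalGrad : (Fin M.N → Fin (k + 1) → ℝ) →ₗ[ℝ] L2Ω :=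
  M.piecewiseL2 ∘ₗ LinearMap.pi fun j =>
    Polynomial.derivative ∘ₗ Lagrange.interpolate Finset.univ (M.P j) ∘ₗ LinearMap.proj j

theorem nodalGrad_apply (d : Fin M.N → Fin (k + 1) → ℝ) :
    M.nodalGrad d = M.piecewiseL2 fun j =>
      Polynomial.derivative (Lagrange.interpolate Finset.univ (M.P j) (d j)) := rfl

theorem degree_interpolate_lt (d : Fin M.N → Fin (k + 1) → ℝ) (j : Fin M.N) :
    (Lagrange.interpolate Finset.univ (M.P j) (d j)).degree < ((k + 1 : ℕ) : WithBot ℕ) := by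
  have := Lagrange.degree_interpolate_lt (s := Finset.univ) (d j) (M.P_strictMono j).injective.injOn
  simpa using this

theorem derivative_mem_degreeLT {p : ℝ[X]} (hp : p.degree < ((k + 1 : ℕ) : WithBot ℕ)) :
    Polynomial.derivative p ∈ Polynomial.degreeLT ℝ k := by
  rw [Polynomial.mem_degreeLT]
  rcases eq_or_ne p 0 with rfl | h0
  · simp
  · have h1 := Polynomial.degree_derivative_lt h0
    have h2 : p.degree ≤ (k : WithBot ℕ) := by
      rw [Polynomial.degree_eq_natDegree h0] at hp ⊢
      have : p.natDegree < k + 1 := by exact_mod_cast hp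
      exact_mod_cast Nat.lt_succ_iff.1 this
    exact h1.trans_le h2

theorem nodalGrad_mem (d : Fin M.N → Fin (k + 1) → ℝ) : M.nodalGrad d ∈ M.gradSpace := by
  rw [nodalGrad_apply]
  exact M.piecewiseL2_mem_gradSpace fun j => derivative_mem_degreeLT (M.degree_interpolate_lt d j)

/-- The values of a function at the Lagrange points. -/
def nodalValues (W : ℝ → ℝ) (j : Fin M.N) (l : Fin (k + 1)) : ℝ := W (M.P j l)

theorem P_mem (j : Fin M.N) (l : Fin (k + 1)) : M.P j l ∈ Icc (M.x j.castSucc) (M.x j.succ) :=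
  ⟨M.P_zero j ▸ (M.P_strictMono j).monotone (Fin.zero_le l),
    M.P_last j ▸ (M.P_strictMono j).monotone (Fin.le_last l)⟩

variable {M} {W : ℝ → ℝ}

theorem eq_eval_interpolate_of_mem_S (hW : W ∈ M.S) (j : Fin M.N) {y : ℝ}
    (hy : y ∈ Icc (M.x j.castSucc) (M.x j.succ)) :
    W y = (Lagrange.interpolate Finset.univ (M.P j) (M.nodalValues W j)).eval y := by
  obtain ⟨p, hp, hpW⟩ := hW.2.2.2 j
  rw [hpW y hy]
  congr 1
  refine Lagrange.eq_interpolate_of_eval_eq _ (M.P_strictMono j).injective.injOn ?_ ?_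
  · rw [Finset.card_univ, Fintype.card_fin]
    exact (Polynomial.degree_le_of_natDegree_le hp).trans_lt (by exact_mod_cast Nat.lt_succ_self k)
  · intro l _
    exact (hpW _ (M.P_mem j l)).symm

/-- Expresses `W` linearly in finitely many point values, so that continuity and absolute continuity
in time pass from the values at single points to the whole function. The two sides have equal
increments inside each cell and both vanish at 0. -/
theorem eq_primitive_of_mem_S (hW : W ∈ M.S) {y : ℝ} (hy : y ∈ Icc (0 : ℝ) 1) :
    W y = primitive (M.nodalGrad (M.nodalValues W)) y := by
  set q := M.nodalGrad (M.nodalValues W) with hq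
  have hstep : ∀ (j : Fin M.N) (x), x ∈ Icc (M.x j.castSucc) (M.x j.succ) →
      W x - W (M.x j.castSucc) = primitive q x - primitive q (M.x j.castSucc) := by
    intro j x hx
    have hl : M.x j.castSucc ∈ Icc (M.x j.castSucc) (M.x j.succ) := left_mem_Icc.2 (M.x_lt j).le
    rw [primitive_sub_primitive q (M.Icc_subset j hl) (M.Icc_subset j hx), hq, nodalGrad_apply,
      M.intervalIntegral_piecewiseL2 _ j hl hx, intervalIntegral_eval_derivative,
      ← eq_eval_interpolate_of_mem_S hW j hl, ← eq_eval_interpolate_of_mem_S hW j hx]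
  have hnode : ∀ j, W (M.x j) = primitive q (M.x j) := by
    intro j
    induction j using Fin.induction with
    | zero => rw [M.x_zero, hW.2.1, primitive_zero_left]
    | succ j ih =>
      have := hstep j _ (right_mem_Icc.2 (M.x_lt j).le)
      linarith
  obtain ⟨j, hj⟩ := M.exists_mem_Icc hy
  have := hstep j y hj
  linarith [hnode j.castSucc]

theorem deriv_ae_eq_of_mem_S (hW : W ∈ M.S) :
    deriv W =ᵐ[unitMeasure] M.nodalGrad (M.nodalValues W) := by
  have h1 := deriv_primitive_ae_eq (M.nodalGrad (M.nodalValues W))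
  rw [Filter.EventuallyEq, ae_restrict_iff' measurableSet_Ioo] at h1 ⊢
  filter_upwards [h1] with y hy hy'
  rw [← hy hy']
  refine Filter.EventuallyEq.deriv_eq ?_
  filter_upwards [Ioo_mem_nhds hy'.1 hy'.2] with x hx
  exact eq_primitive_of_mem_S hW (Ioo_subset_Icc_self hx)

/-- Makes θ an admissible test function of the discrete problem. -/
theorem primitive_mem_S {q : L2Ω} (hq : q ∈ M.gradSpace) (h1 : primitive q 1 = 0) :
    primitive q ∈ M.S := by
  obtain ⟨p, hp, rfl⟩ := M.exists_of_mem_gradSpace hq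
  refine ⟨continuousOn_primitive_L2 _, primitive_zero_left _, h1, fun j => ?_⟩
  obtain ⟨r, hr, hrp, hr0⟩ := exists_derivative_eq_mem_degreeLT k (hp j) (M.x j.castSucc)
    (primitive (M.piecewiseL2 p) (M.x j.castSucc))
  refine ⟨r, ?_, fun y hy => ?_⟩
  · rw [Polynomial.mem_degreeLT] at hr
    rcases eq_or_ne r 0 with rfl | h0
    · simp
    · exact Nat.lt_succ_iff.1 ((Polynomial.natDegree_lt_iff_degree_lt h0).2 hr)
  · have hl : M.x j.castSucc ∈ Icc (M.x j.castSucc) (M.x j.succ) := left_mem_Icc.2 (M.x_lt j).le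
    have h2 := primitive_sub_primitive (M.piecewiseL2 p) (M.Icc_subset j hl) (M.Icc_subset j hy)
    rw [M.intervalIntegral_piecewiseL2 p j hl hy, ← hrp, intervalIntegral_eval_derivative, hr0]
      at h2
    linarith

theorem primitive_gradProj_one (hk : 1 ≤ k) (z : L2Ω) :
    primitive (M.gradProj z) 1 = primitive z 1 := by
  have h := M.primitive_sub_gradProj_node hk z (Fin.last _)
  rw [M.x_last, primitive_sub _ _ (by simp)] at h
  linarith

end Mesh

/-! ### Absolutely continuous functions of time -/

theorem AbsolutelyContinuousOnInterval.finset_sum {ι : Type*} (s : Finset ι) {f : ι → ℝ → ℝ}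
    {a b : ℝ} (h : ∀ i ∈ s, AbsolutelyContinuousOnInterval (f i) a b) :
    AbsolutelyContinuousOnInterval (fun t => ∑ i ∈ s, f i t) a b := by
  classical
  induction s using Finset.induction_on with
  | empty =>
    simpa using (contDiff_const (c := (0 : ℝ)) (n := 1)).contDiffOn.absolutelyContinuousOnInterval
  | insert i s hi ih =>
    simp only [Finset.sum_insert hi]
    exact (h i (Finset.mem_insert_self i s)).fun_add
      (ih fun j hj => h j (Finset.mem_insert_of_mem hj))

/-- A linear functional on `ι → ℝ` is a finite combination of coordinates. -/
theorem AbsolutelyContinuousOnInterval.linearMap_comp {ι : Type*} [Fintype ι]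
    (F : (ι → ℝ) →ₗ[ℝ] ℝ) {d : ℝ → ι → ℝ} {a b : ℝ}
    (h : ∀ i, AbsolutelyContinuousOnInterval (fun t => d t i) a b) :
    AbsolutelyContinuousOnInterval (fun t => F (d t)) a b := by
  classical
  have h1 : (fun t => F (d t)) = fun t => ∑ i, F (fun j => if i = j then 1 else 0) * d t i := by
    funext t
    rw [F.pi_apply_eq_sum_univ]
    simp [mul_comm]
  rw [h1]
  exact AbsolutelyContinuousOnInterval.finset_sum _ fun i _ => (h i).const_mul _

/-- Gronwall's inequality for absolutely continuous functions. -/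
theorem AbsolutelyContinuousOnInterval.gronwall {F b : ℝ → ℝ} {T K : ℝ} (hT : 0 ≤ T) (hK : 0 ≤ K)
    (hF : AbsolutelyContinuousOnInterval F 0 T) (hF0 : 0 ≤ F 0)
    (hb : IntegrableOn b (Ioo 0 T)) (hb0 : ∀ t, 0 ≤ b t)
    (h : ∀ᵐ t ∂(volume.restrict (Ioo 0 T)), deriv F t ≤ K * F t + b t) :
    ∀ t ∈ Icc 0 T, F t ≤ Real.exp (K * T) * (F 0 + ∫ s in Ioo 0 T, b s) := by
  intro t ht
  have hsub : uIcc 0 t ⊆ uIcc 0 T := by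
    rw [uIcc_of_le ht.1, uIcc_of_le hT]
    exact Icc_subset_Icc_right ht.2
  -- Integrating factor: the derivative of the product with `F` is at most `b`, since the factor is
  -- at most 1 and `b` is nonnegative. Absolute continuity allows integrating this a.e. bound.
  have hE : AbsolutelyContinuousOnInterval (fun s => Real.exp (-(K * s))) 0 t := by
    refine ContDiffOn.absolutelyContinuousOnInterval (ContDiff.contDiffOn ?_)
    fun_prop
  have hG := hE.fun_mul (hF.mono hsub)
  have h1 := hG.integral_deriv_eq_sub
  have h2 : ∫ s in (0 : ℝ)..t, deriv (fun s => Real.exp (-(K * s)) * F s) s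
      ≤ ∫ s in (0 : ℝ)..t, b s := by
    refine intervalIntegral.integral_mono_ae_restrict ht.1 hG.intervalIntegrable_deriv
      (intervalIntegrable_of_integrableOn_Ioo hb (left_mem_Icc.2 hT) ht) ?_
    have hd := hF.ae_differentiableAt
    have h' : ∀ᵐ s ∂(volume.restrict (Ioo 0 t)), deriv F s ≤ K * F s + b s :=
      ae_restrict_of_ae_restrict_of_subset (Ioo_subset_Ioo_right ht.2) h
    rw [← restrict_Ioo_eq_restrict_Icc, Filter.EventuallyLE,
      ae_restrict_iff' measurableSet_Ioo]
    rw [ae_restrict_iff' measurableSet_Ioo] at h'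
    filter_upwards [hd, h'] with s hs hs' hst
    have hds := hs (hsub (by rw [uIcc_of_le ht.1]; exact Ioo_subset_Icc_self hst))
    have he : HasDerivAt (fun s => Real.exp (-(K * s))) (Real.exp (-(K * s)) * (-K)) s := by
      have : HasDerivAt (fun s : ℝ => -(K * s)) (-K) s := by
        exact ((hasDerivAt_id' s).const_mul K).fun_neg.congr_deriv (by simp)
      exact this.exp
    rw [(he.fun_mul hds.hasDerivAt).deriv]
    have hexp : Real.exp (-(K * s)) ≤ 1 := Real.exp_le_one_iff.2 (by
      have := mul_nonneg hK hst.1.le; linarith)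
    calc Real.exp (-(K * s)) * -K * F s + Real.exp (-(K * s)) * deriv F s
        ≤ Real.exp (-(K * s)) * -K * F s + Real.exp (-(K * s)) * (K * F s + b s) := by
          gcongr
          exact hs' hst
      _ = Real.exp (-(K * s)) * b s := by ring
      _ ≤ b s := mul_le_of_le_one_left (hb0 s) hexp
  have h3 : ∫ s in (0 : ℝ)..t, b s ≤ ∫ s in Ioo 0 T, b s := by
    rw [← integral_Ioo_eq_intervalIntegral ht.1]
    exact setIntegral_mono_set hb (Eventually.of_forall hb0)
      (Ioo_subset_Ioo_right ht.2).eventuallyLE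
  rw [h1] at h2
  simp only [mul_zero, neg_zero, Real.exp_zero, one_mul] at h2
  have h4 : Real.exp (-(K * t)) * F t ≤ F 0 + ∫ s in Ioo 0 T, b s := by linarith
  have h5 : 0 ≤ F 0 + ∫ s in Ioo 0 T, b s := add_nonneg hF0 (integral_nonneg hb0)
  calc F t = Real.exp (K * t) * (Real.exp (-(K * t)) * F t) := by
        rw [← mul_assoc, ← Real.exp_add]; simp
    _ ≤ Real.exp (K * t) * (F 0 + ∫ s in Ioo 0 T, b s) :=
        mul_le_mul_of_nonneg_left h4 (Real.exp_pos _).le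
    _ ≤ _ := by
        refine mul_le_mul_of_nonneg_right (Real.exp_le_exp.2 ?_) h5
        exact mul_le_mul_of_nonneg_left ht.2 hK


/-! ### The gradient as an element of `L²(0, 1)` -/

open Classical in
/-- The class of the weak derivative of `u` in `L²(0, 1)`, with value `0` outside of `H¹(0, 1)`. -/
noncomputable def gradL2 (u : L2Ω) : L2Ω :=
  if h : weakDerivNorm 0 1 1 u < ⊤ then (exists_L2_isWeakDeriv h).choose else 0

theorem isWeakDeriv_gradL2 {u : L2Ω} (h : weakDerivNorm 0 1 1 u < ⊤) :
    IsWeakDeriv 0 1 1 u (gradL2 u) := by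
  unfold gradL2
  rw [dif_pos h]
  exact (exists_L2_isWeakDeriv h).choose_spec.1

theorem ofReal_norm_gradL2_le (u : L2Ω) :
    ENNReal.ofReal ‖gradL2 u‖ ≤ weakDerivNorm 0 1 1 u := by
  by_cases h : weakDerivNorm 0 1 1 u < ⊤
  · unfold gradL2
    rw [dif_pos h]
    exact (exists_L2_isWeakDeriv h).choose_spec.2.le
  · unfold gradL2
    rw [dif_neg h]
    simp

theorem inner_toL2_gradL2 {u : L2Ω} (h : weakDerivNorm 0 1 1 u < ⊤) {ψ : ℝ → ℝ}
    (hψ : IsTestFunction 0 1 ψ) :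
    inner ℝ hψ.toL2 (gradL2 u) = - inner ℝ (hψ.iteratedDeriv 1).toL2 u := by
  have := (isWeakDeriv_iff_inner u (gradL2 u)).1 (isWeakDeriv_gradL2 h) ψ hψ
  rw [this]
  ring

theorem exists_ae_eq_const_add_primitive {u : L2Ω} (h : weakDerivNorm 0 1 1 u < ⊤) :
    ∃ c : ℝ, u = c • oneL2 + primitiveL2 (gradL2 u) := by
  obtain ⟨c, hc⟩ := (isWeakDeriv_gradL2 h).ae_eq_primitive zero_lt_one (integrableOn_L2 _)
  refine ⟨c, Lp.ext ?_⟩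
  filter_upwards [hc, coeFn_primitiveL2 (gradL2 u), Lp.coeFn_add (c • oneL2) (primitiveL2 (gradL2 u)),
    Lp.coeFn_smul c oneL2, memLp_const_one.coeFn_toLp] with x h1 h2 h3 h4 h5
  have h5' : oneL2 x = 1 := h5
  rw [h1, h3, Pi.add_apply, h2, h4, Pi.smul_apply, h5', smul_eq_mul, mul_one]
  rfl

/-! ### Weak derivatives with respect to time -/

theorem eqOn_Icc_of_ae_eq_Ioo {a b : ℝ} (hab : a < b) {f g : ℝ → ℝ}
    (h : f =ᵐ[volume.restrict (Ioo a b)] g) (hf : ContinuousOn f (Icc a b))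
    (hg : ContinuousOn g (Icc a b)) : EqOn f g (Icc a b) := by
  rw [restrict_Ioo_eq_restrict_Icc] at h
  exact Measure.eqOn_Icc_of_ae_eq volume hab.ne h hf hg

/-- Continuity up to the end points upgrades the a.e. identity to every time and fixes the constant
of integration as the value at 0. -/
theorem IsWeakDeriv.eq_add_integral {T : ℝ} (hT : 0 < T) {g w : ℝ → ℝ} (h : IsWeakDeriv 0 T 1 g w)
    (hg : ContinuousOn g (Icc 0 T)) (hw : IntegrableOn w (Ioo 0 T)) {t : ℝ} (ht : t ∈ Icc 0 T) :
    g t = g 0 + ∫ s in (0 : ℝ)..t, w s := by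
  obtain ⟨c, hc⟩ := h.ae_eq_primitive hT hw
  have h1 := eqOn_Icc_of_ae_eq_Ioo hT hc hg
    ((continuousOn_primitive hT.le hw).const_add c)
  rw [h1 ht, h1 (left_mem_Icc.2 hT.le)]
  simp

theorem locallyIntegrableOn_inner {E : Type*} [NormedAddCommGroup E] [InnerProductSpace ℝ E]
    {s : Set ℝ} {v : ℝ → E} (hv : LocallyIntegrableOn v s) (q : E) :
    LocallyIntegrableOn (fun t => inner ℝ q (v t)) s := by
  intro x hx
  obtain ⟨u, hu, hi⟩ := hv x hx
  exact ⟨u, hu, hi.const_inner q⟩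

theorem IsWeakDeriv.inner_left {E : Type*} [NormedAddCommGroup E] [InnerProductSpace ℝ E]
    [CompleteSpace E] {a b : ℝ} {v w : ℝ → E} (h : IsWeakDeriv a b 1 v w) (q : E) :
    IsWeakDeriv a b 1 (fun t => inner ℝ q (v t)) (fun t => inner ℝ q (w t)) := by
  refine ⟨locallyIntegrableOn_inner h.1 q, locallyIntegrableOn_inner h.2.1 q, fun φ hφ => ?_⟩
  simp only [smul_eq_mul, ← real_inner_smul_right]
  rw [integral_inner ((hφ.iteratedDeriv 1).integrable_smul h.1) q,
    integral_inner (hφ.integrable_smul h.2.1) q, h.2.2 φ hφ, real_inner_smul_right]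

section TimeRegularity

variable {T : ℝ} {v w : ℝ → L2Ω} {B : ℝ → ℝ}

/-- `gradL2` is built by a pointwise choice, so only weak measurability is established: against a
test function the derivative moves to the other side, and test functions are dense. -/
theorem aestronglyMeasurable_inner_gradL2 {μ : Measure ℝ} (hw : AEStronglyMeasurable w μ)
    (hfin : ∀ᵐ t ∂μ, weakDerivNorm 0 1 1 (w t) < ⊤) (q : L2Ω) :
    AEStronglyMeasurable (fun t => inner ℝ q (gradL2 (w t))) μ := by
  obtain ⟨ψ, hψ, hlim⟩ := exists_testFunction_tendsto q
  refine aestronglyMeasurable_of_tendsto_ae atTop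
    (f := fun m t => - inner ℝ ((hψ m).iteratedDeriv 1).toL2 (w t)) (fun m => ?_) ?_
  · exact (aestronglyMeasurable_const.inner hw).neg
  · filter_upwards [hfin] with t ht
    refine Tendsto.congr (fun m => inner_toL2_gradL2 ht (hψ m)) ?_
    exact hlim.inner tendsto_const_nhds

theorem integrableOn_inner_gradL2 (hw : AEStronglyMeasurable w (volume.restrict (Ioo 0 T)))
    (hfin : ∀ᵐ t ∂(volume.restrict (Ioo 0 T)), weakDerivNorm 0 1 1 (w t) < ⊤)
    (hB : IntegrableOn B (Ioo 0 T))
    (hwB : ∀ᵐ t ∂(volume.restrict (Ioo 0 T)), ‖gradL2 (w t)‖ ≤ B t) (q : L2Ω) :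
    IntegrableOn (fun t => inner ℝ q (gradL2 (w t))) (Ioo 0 T) := by
  refine Integrable.mono' (hB.const_mul ‖q‖) (aestronglyMeasurable_inner_gradL2 hw hfin q) ?_
  filter_upwards [hwB] with t ht
  exact (abs_real_inner_le_norm _ _).trans (mul_le_mul_of_nonneg_left ht (norm_nonneg _))

/-- Time differentiation commutes with the gradient. -/
theorem inner_gradL2_eq_add_integral (hT : 0 < T) (hv : ContinuousOn v (Icc 0 T))
    (hvw : IsWeakDeriv 0 T 1 v w) (hw : IntegrableOn w (Ioo 0 T))
    (hfin : ∀ᵐ t ∂(volume.restrict (Ioo 0 T)), weakDerivNorm 0 1 1 (w t) < ⊤)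
    (hB : IntegrableOn B (Ioo 0 T))
    (hwB : ∀ᵐ t ∂(volume.restrict (Ioo 0 T)), ‖gradL2 (w t)‖ ≤ B t)
    (h0 : weakDerivNorm 0 1 1 (v 0) < ⊤) {t : ℝ} (ht : t ∈ Icc 0 T)
    (htv : weakDerivNorm 0 1 1 (v t) < ⊤) (q : L2Ω) :
    inner ℝ q (gradL2 (v t))
      = inner ℝ q (gradL2 (v 0)) + ∫ s in (0 : ℝ)..t, inner ℝ q (gradL2 (w s)) := by
  -- For test functions the identity is the fundamental theorem in time for -(ψ', v(t)). General `q`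
  -- follows by approximation, with multiples of `B` dominating the time integrals.
  have htest : ∀ ψ (hψ : IsTestFunction 0 1 ψ), inner ℝ hψ.toL2 (gradL2 (v t))
      = inner ℝ hψ.toL2 (gradL2 (v 0)) + ∫ s in (0 : ℝ)..t, inner ℝ hψ.toL2 (gradL2 (w s)) := by
    intro ψ hψ
    have h1 := (hvw.inner_left (hψ.iteratedDeriv 1).toL2).eq_add_integral hT
      (continuousOn_const.inner hv) (hw.const_inner _) ht
    have h2 : ∫ s in (0 : ℝ)..t, inner ℝ hψ.toL2 (gradL2 (w s))
        = ∫ s in (0 : ℝ)..t, - inner ℝ (hψ.iteratedDeriv 1).toL2 (w s) := by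
      refine intervalIntegral_congr_ae_Ioo (a := 0) (b := T) ?_ (left_mem_Icc.2 hT.le) ht
      filter_upwards [hfin] with s hs
      exact inner_toL2_gradL2 hs hψ
    rw [h2, intervalIntegral.integral_neg, inner_toL2_gradL2 htv, inner_toL2_gradL2 h0, h1]
    ring
  obtain ⟨ψ, hψ, hlim⟩ := exists_testFunction_tendsto q
  have l1 : Tendsto (fun m => inner ℝ (hψ m).toL2 (gradL2 (v t))) atTop
      (𝓝 (inner ℝ q (gradL2 (v t)))) := hlim.inner tendsto_const_nhds
  have l2 : Tendsto (fun m => inner ℝ (hψ m).toL2 (gradL2 (v 0))) atTop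
      (𝓝 (inner ℝ q (gradL2 (v 0)))) := hlim.inner tendsto_const_nhds
  have l3 : Tendsto (fun m => ∫ s in (0 : ℝ)..t, inner ℝ (hψ m).toL2 (gradL2 (w s))) atTop
      (𝓝 (∫ s in (0 : ℝ)..t, inner ℝ q (gradL2 (w s)))) := by
    have hbd : ∃ C : ℝ, ∀ m, ‖(hψ m).toL2‖ ≤ C := by
      obtain ⟨C, hC⟩ := (hlim.norm).bddAbove_range
      exact ⟨C, fun m => hC ⟨m, rfl⟩⟩
    obtain ⟨C, hC⟩ := hbd
    have hae : ∀ {p : ℝ → Prop}, (∀ᵐ s ∂(volume.restrict (Ioo 0 T)), p s) →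
        ∀ᵐ s, s ∈ uIoc 0 t → p s := by
      intro p hp
      rw [restrict_Ioo_eq_restrict_Ioc, ae_restrict_iff' measurableSet_Ioc] at hp
      filter_upwards [hp] with s hs hst
      rw [uIoc_of_le ht.1] at hst
      exact hs ⟨hst.1, hst.2.trans ht.2⟩
    refine intervalIntegral.tendsto_integral_filter_of_dominated_convergence (fun s => C * B s)
      (Eventually.of_forall fun m => ?_) (Eventually.of_forall fun m => hae ?_) ?_ ?_
    · have := integrableOn_inner_gradL2 hw.aestronglyMeasurable hfin hB hwB (hψ m).toL2
      exact (intervalIntegrable_iff.1 (intervalIntegrable_of_integrableOn_Ioo this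
        (left_mem_Icc.2 hT.le) ht)).aestronglyMeasurable
    · filter_upwards [hwB] with s hs
      refine (abs_real_inner_le_norm _ _).trans ?_
      exact mul_le_mul (hC m) hs (norm_nonneg _) ((norm_nonneg _).trans (hC m))
    · exact intervalIntegrable_of_integrableOn_Ioo (hB.const_mul C) (left_mem_Icc.2 hT.le) ht
    · exact Eventually.of_forall fun s _ => hlim.inner tendsto_const_nhds
  refine tendsto_nhds_unique l1 ?_
  simp only [htest]
  exact l2.add l3

/-- The time derivative of a function with values in `H₀¹` vanishes at the boundary. -/
theorem ae_eq_primitiveL2_gradL2 (hT : 0 < T) (hv : ContinuousOn v (Icc 0 T))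
    (hvw : IsWeakDeriv 0 T 1 v w) (hw : IntegrableOn w (Ioo 0 T))
    (hfin : ∀ᵐ t ∂(volume.restrict (Ioo 0 T)), weakDerivNorm 0 1 1 (w t) < ⊤)
    (hB : IntegrableOn B (Ioo 0 T))
    (hwB : ∀ᵐ t ∂(volume.restrict (Ioo 0 T)), ‖gradL2 (w t)‖ ≤ B t)
    (h0 : weakDerivNorm 0 1 1 (v 0) < ⊤)
    (hvf : ∀ᵐ t ∂(volume.restrict (Ioo 0 T)), weakDerivNorm 0 1 1 (v t) < ⊤)
    (hvp : ∀ᵐ t ∂(volume.restrict (Ioo 0 T)), v t = primitiveL2 (gradL2 (v t))) :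
    ∀ᵐ t ∂(volume.restrict (Ioo 0 T)), w t = primitiveL2 (gradL2 (w t)) := by
  -- With this `q`, `d t` below is the mean of `w t` minus the primitive of its gradient, that is,
  -- the constant of integration of `w t`. It has to be shown to vanish.
  set q := ContinuousLinearMap.adjoint primitiveL2 oneL2 with hq
  have hadj : ∀ z, inner ℝ q z = inner ℝ oneL2 (primitiveL2 z) := fun z =>
    ContinuousLinearMap.adjoint_inner_left _ _ _
  set d : ℝ → ℝ := fun t => inner ℝ oneL2 (w t) - inner ℝ q (gradL2 (w t)) with hd
  have i1 : IntegrableOn (fun t => inner ℝ oneL2 (w t)) (Ioo 0 T) := hw.const_inner _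
  have i2 := integrableOn_inner_gradL2 hw.aestronglyMeasurable hfin hB hwB q
  have hdi : IntegrableOn d (Ioo 0 T) := i1.sub i2
  have h1 : ∀ᵐ t ∂(volume.restrict (Ioo 0 T)), ∫ s in (0 : ℝ)..t, d s
      = inner ℝ q (gradL2 (v 0)) - inner ℝ oneL2 (v 0) := by
    filter_upwards [hvf, hvp, ae_restrict_mem measurableSet_Ioo] with t h2 h3 ht
    have ht' := Ioo_subset_Icc_self ht
    have e1 := inner_gradL2_eq_add_integral hT hv hvw hw hfin hB hwB h0 ht' h2 q
    have e2 := (hvw.inner_left oneL2).eq_add_integral hT (continuousOn_const.inner hv) i1 ht'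
    have hl := left_mem_Icc.2 hT.le
    rw [hd, intervalIntegral.integral_sub (intervalIntegrable_of_integrableOn_Ioo i1 hl ht')
      (intervalIntegrable_of_integrableOn_Ioo i2 hl ht')]
    have e3 : inner ℝ oneL2 (v t) = inner ℝ q (gradL2 (v t)) := by
      rw [hadj, ← h3]
    linarith
  -- The time integral of `d` is a.e. constant because `v t` has no constant of integration for a.e.
  -- t. Being continuous, it is constant throughout, hence its derivative `d` is zero a.e.
  have h2 : EqOn (fun t => ∫ s in (0 : ℝ)..t, d s)
      (fun _ => inner ℝ q (gradL2 (v 0)) - inner ℝ oneL2 (v 0)) (Icc 0 T) := by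
    exact eqOn_Icc_of_ae_eq_Ioo hT h1 (continuousOn_primitive hT.le hdi) continuousOn_const
  filter_upwards [ae_hasDerivAt_primitive hT.le hdi, ae_restrict_mem measurableSet_Ioo, hfin]
    with t h3 ht h4
  have h5 : d t = 0 := by
    rw [← h3.deriv]
    have : (fun t => ∫ s in (0 : ℝ)..t, d s) =ᶠ[𝓝 t]
        fun _ => inner ℝ q (gradL2 (v 0)) - inner ℝ oneL2 (v 0) := by
      filter_upwards [Ioo_mem_nhds ht.1 ht.2] with s hs
      exact h2 (Ioo_subset_Icc_self hs)
    rw [this.deriv_eq, deriv_const]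
  obtain ⟨c, hc⟩ := exists_ae_eq_const_add_primitive h4
  have h6 : inner ℝ oneL2 (w t) = c + inner ℝ q (gradL2 (w t)) := by
    rw [hadj]
    nth_rewrite 1 [hc]
    rw [inner_add_right, real_inner_smul_right]
    have : inner ℝ oneL2 oneL2 = (1 : ℝ) := by
      rw [oneL2, inner_toLp_toLp]
      simp
    rw [this, mul_one]
  have h7 : c = 0 := by
    simp only [hd] at h5
    linarith
  nth_rewrite 1 [hc]
  rw [h7, zero_smul, zero_add]

end TimeRegularity


/-! ### Multiplication by affine functions -/

theorem memLp_affine_mul (A B : ℝ) (r : L2Ω) :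
    MemLp (fun y => (A + B * y) * r y) 2 unitMeasure := by
  refine (Lp.memLp r).of_le_mul (c := |A| + |B|) ?_ ?_
  · exact AEStronglyMeasurable.mul (Continuous.aestronglyMeasurable (by fun_prop))
      (Lp.aestronglyMeasurable r)
  · rw [ae_restrict_iff' measurableSet_Ioo]
    refine Eventually.of_forall fun y hy => ?_
    rw [norm_mul]
    refine mul_le_mul_of_nonneg_right ?_ (norm_nonneg _)
    refine (norm_add_le _ _).trans ?_
    rw [norm_mul, Real.norm_eq_abs, Real.norm_eq_abs, Real.norm_eq_abs, abs_of_pos hy.1]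
    have := mul_le_mul_of_nonneg_left hy.2.le (abs_nonneg B)
    linarith

/-- Multiplication by `y ↦ A + B y` on `L²(0, 1)`. -/
noncomputable def affineMul (A B : ℝ) : L2Ω →ₗ[ℝ] L2Ω where
  toFun r := (memLp_affine_mul A B r).toLp _
  map_add' r r' := by
    rw [← MemLp.toLp_add]
    refine (MemLp.toLp_eq_toLp_iff _ _).2 ?_
    filter_upwards [Lp.coeFn_add r r'] with y hy
    rw [hy, Pi.add_apply, Pi.add_apply]
    ring
  map_smul' c r := by
    rw [RingHom.id_apply, ← MemLp.toLp_const_smul]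
    refine (MemLp.toLp_eq_toLp_iff _ _).2 ?_
    filter_upwards [Lp.coeFn_smul c r] with y hy
    rw [hy, Pi.smul_apply, Pi.smul_apply, smul_eq_mul, smul_eq_mul]
    ring

theorem coeFn_affineMul (A B : ℝ) (r : L2Ω) :
    affineMul A B r =ᵐ[unitMeasure] fun y => (A + B * y) * r y :=
  (memLp_affine_mul A B r).coeFn_toLp

theorem norm_affineMul_le {A B β : ℝ} (h : ∀ y ∈ Ioo (0 : ℝ) 1, |A + B * y| ≤ β) (r : L2Ω) :
    ‖affineMul A B r‖ ≤ β * ‖r‖ := by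
  refine Lp.norm_le_mul_norm_of_ae_le_mul ?_
  filter_upwards [coeFn_affineMul A B r, ae_restrict_mem measurableSet_Ioo] with y hy hy'
  rw [hy, norm_mul]
  exact mul_le_mul_of_nonneg_right (h y hy') (norm_nonneg _)

theorem inner_affineMul (A B : ℝ) (r w : L2Ω) :
    inner ℝ (affineMul A B r) w = ∫ y in Ioo (0 : ℝ) 1, (A + B * y) * r y * w y := by
  rw [inner_eq_integral]
  refine integral_congr_ae ?_
  filter_upwards [coeFn_affineMul A B r] with y hy
  rw [hy]

/-- Integration by parts moves the derivative from ρ, the primitive of `r`, to θ, the primitive of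
`e`. The boundary terms vanish because θ is zero at both ends. -/
theorem inner_affineMul_primitiveL2 (A B : ℝ) (r : L2Ω) {e : L2Ω} (he : primitive e 1 = 0) :
    inner ℝ (affineMul A B r) (primitiveL2 e)
      = -(B * inner ℝ (primitiveL2 r) (primitiveL2 e)
        + inner ℝ (affineMul A B e) (primitiveL2 r)) := by
  have hr : AbsolutelyContinuousOnInterval (primitive r) 0 1 :=
    absolutelyContinuous_primitive zero_le_one (integrableOn_L2 r)
  have hb : AbsolutelyContinuousOnInterval (fun y : ℝ => A + B * y) 0 1 :=
    ContDiffOn.absolutelyContinuousOnInterval (ContDiff.contDiffOn (by fun_prop))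
  have he' : AbsolutelyContinuousOnInterval (primitive e) 0 1 :=
    absolutelyContinuous_primitive zero_le_one (integrableOn_L2 e)
  have h1 := hr.integral_deriv_mul_eq_sub (hb.fun_mul he')
  rw [he, primitive_zero_left, primitive_zero_left, mul_zero, mul_zero, zero_mul, sub_zero,
    ← integral_Ioo_eq_intervalIntegral zero_le_one] at h1
  have h2 : ∫ y in Ioo (0 : ℝ) 1, (affineMul A B r y * primitiveL2 e y
      + (B * (primitiveL2 r y * primitiveL2 e y) + affineMul A B e y * primitiveL2 r y)) = 0 := by
    refine Eq.trans ?_ h1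
    refine integral_congr_ae ?_
    filter_upwards [coeFn_affineMul A B r, coeFn_affineMul A B e, coeFn_primitiveL2 r,
      coeFn_primitiveL2 e, ae_hasDerivAt_primitive_L2 r, ae_hasDerivAt_primitive_L2 e]
      with y a1 a2 a3 a4 a5 a6
    have a7 : HasDerivAt (fun y : ℝ => A + B * y) B y := by
      exact (((hasDerivAt_id' y).const_mul B).const_add A).congr_deriv (by simp)
    rw [a1, a2, a3, a4, a5.deriv, (a7.fun_mul a6).deriv]
    ring
  have i1 := integrable_mul_of_memLp (Lp.memLp (affineMul A B r)) (Lp.memLp (primitiveL2 e))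
  have i2 := integrable_mul_of_memLp (Lp.memLp (primitiveL2 r)) (Lp.memLp (primitiveL2 e))
  have i3 := integrable_mul_of_memLp (Lp.memLp (affineMul A B e)) (Lp.memLp (primitiveL2 r))
  have i4 : Integrable (fun y => B * (primitiveL2 r y * primitiveL2 e y)
      + affineMul A B e y * primitiveL2 r y) unitMeasure := (i2.const_mul B).add i3
  rw [integral_add i1 i4, integral_add (i2.const_mul B) i3, integral_const_mul] at h2
  rw [inner_eq_integral, inner_eq_integral, inner_eq_integral]
  linarith

/-! ### The energy inequality at a fixed time -/

/-- Here `G` and `z` are the gradients of V and v, `g` is that of ∂_t v, the primitive of `G -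
M.gradProj z` is θ, and `c` is the common right-hand side, which cancels. The affine function A + B
y is the convection coefficient. -/
theorem energy_inequality {k : ℕ} (M : Mesh k) {A B β aV av b₂ m₀ c : ℝ} {z g Vt G : L2Ω}
    (hβ : ∀ y ∈ Ioo (0 : ℝ) 1, |A + B * y| ≤ β) (hB : |B| ≤ β)
    (hm₀ : m₀ ≤ aV * b₂) (hb₂ : 0 ≤ b₂) (hG : G ∈ M.gradSpace)
    (he : primitive (G - M.gradProj z) 1 = 0)
    (hV : inner ℝ Vt (primitiveL2 (G - M.gradProj z)) + aV * b₂ * inner ℝ G (G - M.gradProj z)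
      - inner ℝ (affineMul A B G) (primitiveL2 (G - M.gradProj z)) = c)
    (hv : inner ℝ (primitiveL2 g) (primitiveL2 (G - M.gradProj z))
      + av * b₂ * inner ℝ z (G - M.gradProj z)
      - inner ℝ (affineMul A B z) (primitiveL2 (G - M.gradProj z)) = c) :
    inner ℝ (Vt - primitiveL2 (M.gradProj g)) (primitiveL2 (G - M.gradProj z))
      ≤ ‖primitiveL2 (g - M.gradProj g)‖ * ‖primitiveL2 (G - M.gradProj z)‖
        - m₀ * ‖G - M.gradProj z‖ ^ 2 + |av - aV| * b₂ * ‖z‖ * ‖G - M.gradProj z‖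
        + β * (‖G - M.gradProj z‖ * ‖primitiveL2 (G - M.gradProj z)‖
          + ‖primitiveL2 (z - M.gradProj z)‖ * ‖primitiveL2 (G - M.gradProj z)‖
          + ‖primitiveL2 (z - M.gradProj z)‖ * ‖G - M.gradProj z‖) := by
  set e := G - M.gradProj z with he_def
  set r := z - M.gradProj z with hr_def
  have heS : e ∈ M.gradSpace := M.gradSpace.sub_mem hG (M.gradProj_mem z)
  -- The defining orthogonality of the elliptic projection: the diffusion term contains no
  -- contribution of ρ.
  have hre : inner ℝ r e = 0 := M.inner_sub_gradProj z heS
  have hGe : G = e + z - r := by rw [he_def, hr_def]; abel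
  have hβ0 : 0 ≤ β := (abs_nonneg B).trans hB
  have e1 : inner ℝ G e = ‖e‖ ^ 2 + inner ℝ z e := by
    nth_rewrite 1 [hGe]
    rw [inner_sub_left, inner_add_left, hre, real_inner_self_eq_norm_sq, sub_zero]
  have e2 : inner ℝ (affineMul A B G) (primitiveL2 e)
      = inner ℝ (affineMul A B e) (primitiveL2 e) + inner ℝ (affineMul A B z) (primitiveL2 e)
        - inner ℝ (affineMul A B r) (primitiveL2 e) := by
    rw [hGe, map_sub, map_add, inner_sub_left, inner_add_left]
  have e3 := inner_affineMul_primitiveL2 A B r he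
  have e4 : inner ℝ (Vt - primitiveL2 (M.gradProj g)) (primitiveL2 e)
      = inner ℝ Vt (primitiveL2 e) - inner ℝ (primitiveL2 g) (primitiveL2 e)
        + inner ℝ (primitiveL2 (g - M.gradProj g)) (primitiveL2 e) := by
    rw [inner_sub_left, map_sub primitiveL2 g, inner_sub_left]
    ring
  have b1 := (le_abs_self _).trans (abs_real_inner_le_norm (primitiveL2 (g - M.gradProj g))
    (primitiveL2 e))
  have b2 : (av - aV) * b₂ * inner ℝ z e ≤ |av - aV| * b₂ * ‖z‖ * ‖e‖ := by
    calc (av - aV) * b₂ * inner ℝ z e ≤ |(av - aV) * b₂ * inner ℝ z e| := le_abs_self _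
      _ = |av - aV| * b₂ * |inner ℝ z e| := by rw [abs_mul, abs_mul, abs_of_nonneg hb₂]
      _ ≤ |av - aV| * b₂ * (‖z‖ * ‖e‖) :=
          mul_le_mul_of_nonneg_left (abs_real_inner_le_norm _ _) (mul_nonneg (abs_nonneg _) hb₂)
      _ = _ := by ring
  have hform : ∀ p q : L2Ω, inner ℝ (affineMul A B p) q ≤ β * (‖p‖ * ‖q‖) := fun p q => by
    calc inner ℝ (affineMul A B p) q ≤ ‖affineMul A B p‖ * ‖q‖ := real_inner_le_norm _ _
      _ ≤ β * ‖p‖ * ‖q‖ := mul_le_mul_of_nonneg_right (norm_affineMul_le hβ p) (norm_nonneg _)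
      _ = _ := by ring
  have b3 := hform e (primitiveL2 e)
  have b4 := hform e (primitiveL2 r)
  have b5 : B * inner ℝ (primitiveL2 r) (primitiveL2 e)
      ≤ β * (‖primitiveL2 r‖ * ‖primitiveL2 e‖) := by
    calc B * inner ℝ (primitiveL2 r) (primitiveL2 e)
        ≤ |B * inner ℝ (primitiveL2 r) (primitiveL2 e)| := le_abs_self _
      _ = |B| * |inner ℝ (primitiveL2 r) (primitiveL2 e)| := abs_mul _ _
      _ ≤ β * (‖primitiveL2 r‖ * ‖primitiveL2 e‖) :=
          mul_le_mul hB (abs_real_inner_le_norm _ _) (abs_nonneg _) hβ0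
  have b6 : m₀ * ‖e‖ ^ 2 ≤ aV * b₂ * ‖e‖ ^ 2 := mul_le_mul_of_nonneg_right hm₀ (sq_nonneg _)
  rw [e1, e2, e3] at hV
  rw [e4]
  have e5 : aV * b₂ * (‖e‖ ^ 2 + inner ℝ z e) = aV * b₂ * ‖e‖ ^ 2 + aV * b₂ * inner ℝ z e := by
    ring
  have e6 : (av - aV) * b₂ * inner ℝ z e = av * b₂ * inner ℝ z e - aV * b₂ * inner ℝ z e := by
    ring
  have e7 : ‖primitiveL2 r‖ * ‖e‖ = ‖e‖ * ‖primitiveL2 r‖ := mul_comm _ _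
  rw [e7]
  linarith

/-- Absorption of the gradient terms by Young's inequality. -/
theorem absorb_gradient_terms {s th x ρ d κ β m₀ : ℝ} (hm₀ : 0 < m₀) (hth : 0 ≤ th)
    (hx : 0 ≤ x) (hβ : 0 ≤ β) (hthd : th ≤ d) (hρd : ρ ≤ d) :
    2 * (s * th - m₀ * x ^ 2 + κ * d * x + β * (x * th + ρ * th + ρ * x))
      ≤ s ^ 2 + (1 + (κ + 2 * β) ^ 2 / (2 * m₀) + 2 * β) * d ^ 2 := by
  have hd : 0 ≤ d := hth.trans hthd
  have h1 : 2 * (s * th) ≤ s ^ 2 + d ^ 2 := by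
    nlinarith [sq_nonneg (s - th), mul_le_mul hthd hthd hth hd]
  have h2 : β * (x * th) ≤ β * (x * d) := by gcongr
  have h3 : β * (ρ * th) ≤ β * (d * d) := by gcongr
  have h4 : β * (ρ * x) ≤ β * (d * x) := by gcongr
  -- Three terms are linear in the gradient norm `x`: the nonlocal one with factor `κ`, and two
  -- convection terms with factor `β` each. Completing the square spends exactly the diffusion 2 m₀
  -- x².
  have h5 : 2 * ((κ + 2 * β) * d * x) ≤ 2 * m₀ * x ^ 2 + (κ + 2 * β) ^ 2 / (2 * m₀) * d ^ 2 := by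
    have h6 : 0 ≤ 2 * m₀ * (x - (κ + 2 * β) * d / (2 * m₀)) ^ 2 := by positivity
    have h7 : 2 * m₀ * (x - (κ + 2 * β) * d / (2 * m₀)) ^ 2
        = 2 * m₀ * x ^ 2 - 2 * ((κ + 2 * β) * d * x) + (κ + 2 * β) ^ 2 / (2 * m₀) * d ^ 2 := by
      field_simp
      ring
    linarith
  nlinarith

/-! ### Curves in finite dimensional subspaces -/

section Curve

variable {E : Type*} [NormedAddCommGroup E] [InnerProductSpace ℝ E] {ι : Type*} [Fintype ι]
  {T : ℝ} {c : ι → ℝ → ℝ} (x : ι → E)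

theorem norm_sq_sum_smul (d : ι → ℝ) :
    ‖∑ m, d m • x m‖ ^ 2 = ∑ m, ∑ l, d m * d l * inner ℝ (x m) (x l) := by
  rw [← real_inner_self_eq_norm_sq, sum_inner]
  refine Finset.sum_congr rfl fun m _ => ?_
  rw [inner_sum]
  refine Finset.sum_congr rfl fun l _ => ?_
  rw [real_inner_smul_left, real_inner_smul_right]
  ring

/-- With fixed vectors the squared norm is a quadratic form in the coefficients, so only real-valued
absolute continuity is involved. -/
theorem absolutelyContinuous_norm_sq_sum (h : ∀ m, AbsolutelyContinuousOnInterval (c m) 0 T) :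
    AbsolutelyContinuousOnInterval (fun t => ‖∑ m, c m t • x m‖ ^ 2) 0 T := by
  simp only [norm_sq_sum_smul]
  refine AbsolutelyContinuousOnInterval.finset_sum _ fun m _ =>
    AbsolutelyContinuousOnInterval.finset_sum _ fun l _ => ?_
  have h1 := ((h m).fun_mul (h l)).const_mul (inner ℝ (x m) (x l))
  simpa only [mul_comm] using h1

theorem deriv_norm_sq_sum {t : ℝ} (h : ∀ m, DifferentiableAt ℝ (c m) t) :
    deriv (fun t => ‖∑ m, c m t • x m‖ ^ 2) t
      = 2 * inner ℝ (∑ m, deriv (c m) t • x m) (∑ m, c m t • x m) := by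
  have h1 : HasDerivAt (fun t => ∑ m, c m t • x m) (∑ m, deriv (c m) t • x m) t := by
    have := HasDerivAt.fun_sum (u := Finset.univ) fun m _ => (h m).hasDerivAt.smul_const (x m)
    exact this
  rw [h1.norm_sq.deriv, real_inner_comm]

end Curve

namespace Mesh

variable {k : ℕ} (M : Mesh k)

/-- An orthonormal basis of the piecewise polynomials of degree less than `k`. -/
noncomputable def gradBasis :
    OrthonormalBasis (Fin (Module.finrank ℝ M.gradSpace)) ℝ M.gradSpace :=
  stdOrthonormalBasis ℝ M.gradSpace

theorem sum_inner_gradBasis (z : L2Ω) :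
    ∑ m, inner ℝ (M.gradBasis m : L2Ω) z • (M.gradBasis m : L2Ω) = M.gradProj z := by
  have h := M.gradBasis.sum_repr' (M.gradSpace.orthogonalProjectionOnto z)
  have h2 := congrArg (fun w : M.gradSpace => (w : L2Ω)) h
  simp only [Submodule.coe_sum, Submodule.coe_smul] at h2
  unfold gradProj
  rw [Submodule.starProjection_apply, ← h2]
  refine Finset.sum_congr rfl fun m _ => ?_
  congr 1
  rw [Submodule.coe_inner, ← Submodule.starProjection_apply]
  have h3 := Submodule.starProjection_inner_eq_zero (K := M.gradSpace) z _ (M.gradBasis m).2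
  rw [inner_sub_left, real_inner_comm, real_inner_comm _ (M.gradSpace.starProjection z)] at h3
  linarith

theorem gradProj_eq_self {q : L2Ω} (hq : q ∈ M.gradSpace) : M.gradProj q = q :=
  Submodule.starProjection_eq_self_iff.2 hq

end Mesh


/-! ### Errors of the elliptic projection and of the initial value -/

theorem gradL2_ae_eq {u : L2Ω} {w : ℝ → ℝ} (h : IsWeakDeriv 0 1 1 u w)
    (hw : MemLp w 2 unitMeasure) :
    weakDerivNorm 0 1 1 u < ⊤ ∧ gradL2 u =ᵐ[unitMeasure] w := by
  have h1 : weakDerivNorm 0 1 1 u < ⊤ := by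
    rw [weakDerivNorm_eq h]
    exact hw.2
  exact ⟨h1, (isWeakDeriv_gradL2 h1).ae_unique h⟩

theorem gradL2_eq_of_ae_eq_primitive {u z : L2Ω} (h : u =ᵐ[unitMeasure] primitive z) :
    weakDerivNorm 0 1 1 u < ⊤ ∧ gradL2 u = z ∧ u = primitiveL2 (gradL2 u) := by
  obtain ⟨h1, h2⟩ := gradL2_ae_eq (isWeakDeriv_primitive h) (Lp.memLp z)
  have h3 : gradL2 u = z := Lp.ext h2
  exact ⟨h1, h3, by rw [h3]; exact Lp.ext (h.trans (coeFn_primitiveL2 z).symm)⟩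

theorem integral_sq_eq_of_eLpNorm {f : ℝ → ℝ} (hf : MemLp f 2 unitMeasure) :
    ∫ x in Ioo (0 : ℝ) 1, f x ^ 2 = (eLpNorm f 2 unitMeasure).toReal ^ 2 := by
  rw [← norm_toLp_sq hf, Lp.norm_toLp]

theorem IsDerivChain.integral_sq_le_sobolevNorm {m : ℕ} {u : ℝ → ℝ} {f : ℕ → ℝ → ℝ}
    (hf : IsDerivChain 0 1 m f) (hfu : ∀ j ≤ m, IsWeakDeriv 0 1 j u (f j))
    (h : sobolevNorm 0 1 m u < ⊤) :
    ∫ x in Ioo (0 : ℝ) 1, f m x ^ 2 ≤ (sobolevNorm 0 1 m u).toReal ^ 2 := by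
  rw [integral_sq_eq_of_eLpNorm (hf.1 m le_rfl), ← weakDerivNorm_eq (hfu m le_rfl)]
  exact pow_le_pow_left₀ ENNReal.toReal_nonneg
    (ENNReal.toReal_mono h.ne (weakDerivNorm_le_sobolevNorm le_rfl u)) 2

/-- The `L²` error of the elliptic projection. -/
theorem Mesh.norm_primitiveL2_gradL2_sub_le {k : ℕ} (M : Mesh k) (hk : 1 ≤ k) {u : L2Ω}
    (h : sobolevNorm 0 1 (k + 1) u < ⊤) :
    ‖primitiveL2 (gradL2 u - M.gradProj (gradL2 u))‖
      ≤ M.h ^ (k + 1) * (sobolevNorm 0 1 (k + 1) u).toReal := by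
  obtain ⟨f, hf, hfu⟩ := exists_derivChain h
  have h1 : gradL2 u =ᵐ[unitMeasure] f 1 :=
    (gradL2_ae_eq (hfu 1 (by omega)) (hf.1 1 (by omega))).2
  have h2 := M.norm_primitiveL2_sub_gradProj_sq_le hk hf.shift h1
  refine (pow_le_pow_iff_left₀ (norm_nonneg _)
    (mul_nonneg (pow_nonneg M.h_nonneg _) ENNReal.toReal_nonneg) two_ne_zero).1 ?_
  rw [mul_pow]
  exact h2.trans (mul_le_mul_of_nonneg_left (hf.integral_sq_le_sobolevNorm hfu h) (sq_nonneg _))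

/-- The error between the initial value of the semidiscrete solution and the elliptic projection. -/
theorem Mesh.initial_error {k : ℕ} (M : Mesh k) (hk : 1 ≤ k) {u V₀ : ℝ → ℝ} {U : L2Ω}
    (hV : M.IsInterpolant u V₀) (hu : ContinuousOn u (Icc 0 1)) (hU : U =ᵐ[unitMeasure] u)
    (h : sobolevNorm 0 1 (k + 1) u < ⊤) :
    weakDerivNorm 0 1 1 U < ⊤ ∧ U = primitiveL2 (gradL2 U) ∧
      ‖primitiveL2 (M.nodalGrad (M.nodalValues V₀) - M.gradProj (gradL2 U))‖
        ≤ 2 * (M.h ^ (k + 1) * (sobolevNorm 0 1 (k + 1) u).toReal) := by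
  obtain ⟨f, hf, hfu⟩ := exists_derivChain h
  have hfc : ContinuousOn (f 0) (Icc 0 1) := hf.continuousOn zero_le_one (Nat.succ_pos k)
  have hf0 : ∀ y ∈ Icc (0 : ℝ) 1, f 0 y = u y :=
    eqOn_Icc_of_ae_eq_Ioo zero_lt_one ((hfu 0 (Nat.zero_le _)).ae_eq_of_zero) hfc hu
  -- The boundary value is read off from the interpolant, which vanishes at 0 and agrees with `u` at
  -- that Lagrange point.
  have hu0 : u 0 = 0 := by
    have h1 := hV.2 ⟨0, M.N_pos⟩ 0
    have h2 : M.P ⟨0, M.N_pos⟩ 0 = 0 := by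
      rw [M.P_zero]
      exact M.x_zero
    rw [h2, hV.1.2.1] at h1
    exact h1.symm
  have hm1 := hf.1 1 (by omega)
  have hprim : U =ᵐ[unitMeasure] primitive (hm1.toLp (f 1)) := by
    have hU' := hU
    rw [Filter.EventuallyEq, ae_restrict_iff' measurableSet_Ioo] at hU' ⊢
    filter_upwards [hU'] with y hy hy'
    have hyI := Ioo_subset_Icc_self hy'
    have h1 := hf.2 0 (Nat.succ_pos k) 0 (by simp) y hyI
    rw [hf0 y hyI, hf0 0 (by simp), hu0, sub_zero] at h1
    rw [hy hy', h1]
    exact (intervalIntegral_congr_ae_Ioo hm1.coeFn_toLp (by simp) hyI).symm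
  obtain ⟨a1, a2, a3⟩ := gradL2_eq_of_ae_eq_primitive hprim
  have hUs : sobolevNorm 0 1 (k + 1) U = sobolevNorm 0 1 (k + 1) u := by
    unfold sobolevNorm
    simp only [weakDerivNorm_congr_ae hU]
  refine ⟨a1, a3, ?_⟩
  set H := M.h ^ (k + 1) * (sobolevNorm 0 1 (k + 1) u).toReal
  have hH : 0 ≤ H := mul_nonneg (pow_nonneg M.h_nonneg _) ENNReal.toReal_nonneg
  have e1 : ‖primitiveL2 (gradL2 U - M.gradProj (gradL2 U))‖ ≤ H := by
    have := M.norm_primitiveL2_gradL2_sub_le hk (u := U) (by rwa [hUs])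
    rwa [hUs] at this
  have e2 : ‖U - primitiveL2 (M.nodalGrad (M.nodalValues V₀))‖ ≤ H := by
    refine (pow_le_pow_iff_left₀ (norm_nonneg _) hH two_ne_zero).1 ?_
    have h1 := (hV.integral_sq_sub_le M hf hf0).trans
      (mul_le_mul_of_nonneg_left (hf.integral_sq_le_sobolevNorm hfu h) (sq_nonneg _))
    rw [norm_sq_eq_integral, mul_pow]
    refine le_trans (le_of_eq (integral_congr_ae ?_)) h1
    filter_upwards [Lp.coeFn_sub U (primitiveL2 (M.nodalGrad (M.nodalValues V₀))), hU,
      coeFn_primitiveL2 (M.nodalGrad (M.nodalValues V₀)), ae_restrict_mem measurableSet_Ioo]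
      with y b1 b2 b3 b4
    rw [b1, Pi.sub_apply, b2, b3, ← Mesh.eq_primitive_of_mem_S hV.1 (Ioo_subset_Icc_self b4)]
  have e3 : primitiveL2 (M.nodalGrad (M.nodalValues V₀) - M.gradProj (gradL2 U))
      = primitiveL2 (gradL2 U - M.gradProj (gradL2 U))
        - (U - primitiveL2 (M.nodalGrad (M.nodalValues V₀))) := by
    nth_rewrite 4 [a3]
    rw [map_sub, map_sub]
    abel
  rw [e3]
  refine (norm_sub_le _ _).trans ?_
  linarith

/-- A curve `v` in `L²(0, 1)`, with values in `H₀¹(0, 1)` almost everywhere, whose time derivative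
`w` has an integrable `H¹` norm. -/
structure IsRegularCurve (T : ℝ) (v w : ℝ → L2Ω) (B : ℝ → ℝ) : Prop where
  continuousOn : ContinuousOn v (Icc 0 T)
  isWeakDeriv : IsWeakDeriv 0 T 1 v w
  integrableOn : IntegrableOn w (Ioo 0 T)
  finite_deriv : ∀ᵐ t ∂(volume.restrict (Ioo 0 T)), weakDerivNorm 0 1 1 (w t) < ⊤
  integrableOn_bound : IntegrableOn B (Ioo 0 T)
  norm_grad_le : ∀ᵐ t ∂(volume.restrict (Ioo 0 T)), ‖gradL2 (w t)‖ ≤ B t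
  finite_zero : weakDerivNorm 0 1 1 (v 0) < ⊤
  memH10 : ∀ᵐ t ∂(volume.restrict (Ioo 0 T)), MemH10 0 1 (v t)

theorem MemH10.gradL2_spec {u : L2Ω} (h : MemH10 0 1 u) :
    weakDerivNorm 0 1 1 u < ⊤ ∧ u = primitiveL2 (gradL2 u) ∧ primitive (gradL2 u) 1 = 0 := by
  obtain ⟨z, h1, h2⟩ := h.exists_primitive
  obtain ⟨a, b, c⟩ := gradL2_eq_of_ae_eq_primitive h1
  exact ⟨a, c, by rw [b]; exact h2⟩

theorem ae_Ioo_of_ae_Icc {T : ℝ} (hT : 0 ≤ T) {f : ℝ → ℝ}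
    (h : AbsolutelyContinuousOnInterval f 0 T) :
    ∀ᵐ t ∂(volume.restrict (Ioo 0 T)), DifferentiableAt ℝ f t :=
  ae_Ioo_of_ae_uIcc hT h.ae_differentiableAt

/-! ### The elliptic projection along a curve in time -/

namespace IsRegularCurve

variable {T : ℝ} {v w : ℝ → L2Ω} {B : ℝ → ℝ}

theorem ae_eq_primitiveL2 (h : IsRegularCurve T v w B) (hT : 0 < T) :
    ∀ᵐ t ∂(volume.restrict (Ioo 0 T)), w t = primitiveL2 (gradL2 (w t)) := by
  refine ae_eq_primitiveL2_gradL2 hT h.continuousOn h.isWeakDeriv h.integrableOn h.finite_deriv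
    h.integrableOn_bound h.norm_grad_le h.finite_zero ?_ ?_
  · filter_upwards [h.memH10] with t ht using ht.gradL2_spec.1
  · filter_upwards [h.memH10] with t ht using ht.gradL2_spec.2.1

/-- The square of the `L²` norm of the difference between a curve of finite element functions and
the elliptic projection of a regular curve is absolutely continuous in time. -/
theorem exists_error_curve (h : IsRegularCurve T v w B) (hT : 0 < T) {k : ℕ} (M : Mesh k)
    {V : ℝ → ℝ → ℝ} (hS : ∀ t ∈ Icc 0 T, V t ∈ M.S)
    (hAC : ∀ y ∈ Icc (0 : ℝ) 1, AbsolutelyContinuousOnInterval (fun t => V t y) 0 T) :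
    ∃ F : ℝ → ℝ, AbsolutelyContinuousOnInterval F 0 T ∧
      F 0 = ‖primitiveL2 (M.nodalGrad (M.nodalValues (V 0)) - M.gradProj (gradL2 (v 0)))‖ ^ 2 ∧
      ∀ᵐ t ∂(volume.restrict (Ioo 0 T)),
        F t = ‖primitiveL2 (M.nodalGrad (M.nodalValues (V t)) - M.gradProj (gradL2 (v t)))‖ ^ 2 ∧
        ∃ Vt : L2Ω, (fun y => deriv (fun s => V s y) t) =ᵐ[unitMeasure] Vt ∧
          deriv F t = 2 * inner ℝ (Vt - primitiveL2 (M.gradProj (gradL2 (w t))))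
            (primitiveL2 (M.nodalGrad (M.nodalValues (V t)) - M.gradProj (gradL2 (v t)))) := by
  set u : Fin (Module.finrank ℝ M.gradSpace) → L2Ω := fun m => (M.gradBasis m : L2Ω) with hu
  have hsum : ∀ z, ∑ m, inner ℝ (u m) z • u m = M.gradProj z := M.sum_inner_gradBasis
  set c : Fin (Module.finrank ℝ M.gradSpace) → ℝ → ℝ := fun m t =>
    inner ℝ (u m) (M.nodalGrad (M.nodalValues (V t))) with hc
  -- The coefficients of the projected gradient in an orthonormal basis, written as time integrals.
  -- They are absolutely continuous on all of [0, T], and agree with the true coefficients at 0 and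
  -- whenever `v t` lies in H₀¹, hence a.e.
  set ζ : Fin (Module.finrank ℝ M.gradSpace) → ℝ → ℝ := fun m t =>
    inner ℝ (u m) (gradL2 (v 0)) + ∫ s in (0 : ℝ)..t, inner ℝ (u m) (gradL2 (w s)) with hζ
  have hgi : ∀ q, IntegrableOn (fun t => inner ℝ q (gradL2 (w t))) (Ioo 0 T) := fun q =>
    integrableOn_inner_gradL2 h.integrableOn.aestronglyMeasurable h.finite_deriv
      h.integrableOn_bound h.norm_grad_le q
  have hcAC : ∀ m, AbsolutelyContinuousOnInterval (c m) 0 T := by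
    intro m
    let L : (Fin M.N × Fin (k + 1) → ℝ) →ₗ[ℝ] ℝ :=
      (innerSL ℝ (u m)).toLinearMap ∘ₗ M.nodalGrad ∘ₗ
        { toFun := fun d j l => d (j, l), map_add' := fun _ _ => rfl, map_smul' := fun _ _ => rfl }
    exact AbsolutelyContinuousOnInterval.linearMap_comp L
      (d := fun t p => V t (M.P p.1 p.2)) fun p => hAC _ (M.Icc_subset _ (M.P_mem _ _))
  have hζAC : ∀ m, AbsolutelyContinuousOnInterval (ζ m) 0 T := by
    intro m
    have h1 : AbsolutelyContinuousOnInterval (fun _ : ℝ => inner ℝ (u m) (gradL2 (v 0))) 0 T :=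
      contDiff_const.contDiffOn.absolutelyContinuousOnInterval
    exact h1.fun_add (absolutelyContinuous_primitive hT.le (hgi (u m)))
  set Θ : Fin (Module.finrank ℝ M.gradSpace) → ℝ → ℝ := fun m t => c m t - ζ m t with hΘ
  have hΘAC : ∀ m, AbsolutelyContinuousOnInterval (Θ m) 0 T := fun m =>
    (hcAC m).fun_sub (hζAC m)
  have hcsum : ∀ t, ∑ m, c m t • u m = M.nodalGrad (M.nodalValues (V t)) := fun t => by
    rw [hsum, M.gradProj_eq_self (M.nodalGrad_mem _)]
  have hval : ∀ t, (∀ m, ζ m t = inner ℝ (u m) (gradL2 (v t))) →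
      ∑ m, Θ m t • primitiveL2 (u m)
        = primitiveL2 (M.nodalGrad (M.nodalValues (V t)) - M.gradProj (gradL2 (v t))) := by
    intro t ht
    have h1 : ∑ m, Θ m t • u m
        = M.nodalGrad (M.nodalValues (V t)) - M.gradProj (gradL2 (v t)) := by
      simp only [hΘ, ht, sub_smul, Finset.sum_sub_distrib]
      rw [hcsum, hsum]
    rw [← h1, map_sum]
    simp only [map_smul]
  refine ⟨fun t => ‖∑ m, Θ m t • primitiveL2 (u m)‖ ^ 2,
    absolutelyContinuous_norm_sq_sum _ hΘAC, ?_, ?_⟩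
  · simp only
    rw [hval 0 fun m => by simp [hζ]]
  have hdc : ∀ᵐ t ∂(volume.restrict (Ioo 0 T)), ∀ m, DifferentiableAt ℝ (c m) t :=
    ae_all_iff.2 fun m => ae_Ioo_of_ae_Icc hT.le (hcAC m)
  have hdζ : ∀ᵐ t ∂(volume.restrict (Ioo 0 T)), ∀ m,
      HasDerivAt (ζ m) (inner ℝ (u m) (gradL2 (w t))) t := by
    refine ae_all_iff.2 fun m => ?_
    filter_upwards [ae_hasDerivAt_primitive hT.le (hgi (u m))] with t ht
    exact ht.const_add _
  filter_upwards [hdc, hdζ, h.memH10, ae_restrict_mem measurableSet_Ioo] with t h1 h2 h3 ht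
  have hv := hval t fun m => by
    exact (inner_gradL2_eq_add_integral hT h.continuousOn h.isWeakDeriv h.integrableOn
      h.finite_deriv h.integrableOn_bound h.norm_grad_le h.finite_zero (Ioo_subset_Icc_self ht)
      h3.gradL2_spec.1 (u m)).symm
  -- The exceptional set of times depends only on the finitely many coefficients and not on y; so at
  -- such a time `t` the pointwise derivatives at all y in (0, 1) exist together.
  refine ⟨by rw [hv], primitiveL2 (∑ m, deriv (c m) t • u m), ?_, ?_⟩
  · rw [Filter.EventuallyEq]
    filter_upwards [coeFn_primitiveL2 (∑ m, deriv (c m) t • u m), ae_restrict_mem measurableSet_Ioo]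
      with y hy hy'
    have hyI := Ioo_subset_Icc_self hy'
    rw [hy, primitive_sum _ _ _ hyI]
    have h4 : HasDerivAt (fun s => ∑ m, c m s * primitive (u m) y)
        (∑ m, deriv (c m) t * primitive (u m) y) t :=
      HasDerivAt.fun_sum fun m _ => (h1 m).hasDerivAt.mul_const _
    rw [← h4.deriv]
    refine Filter.EventuallyEq.deriv_eq ?_
    filter_upwards [Ioo_mem_nhds ht.1 ht.2] with s hs
    rw [Mesh.eq_primitive_of_mem_S (hS s (Ioo_subset_Icc_self hs)) hyI, ← hcsum,
      primitive_sum _ _ _ hyI]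
  · rw [deriv_norm_sq_sum _ fun m => (h1 m).fun_sub (h2 m).differentiableAt, hv]
    congr 2
    change ∑ m, deriv (Θ m) t • primitiveL2 (u m) = _
    have h5 : ∀ m, deriv (Θ m) t = deriv (c m) t - inner ℝ (u m) (gradL2 (w t)) := fun m =>
      ((h1 m).hasDerivAt.fun_sub (h2 m)).deriv
    simp only [h5, sub_smul, Finset.sum_sub_distrib]
    rw [← hsum, map_sum, map_sum]
    simp only [map_smul]

end IsRegularCurve


/-! ### Consequences of bounds of Bochner norms -/

theorem ae_sobolevNorm_le {T : ℝ} {m : ℕ} {u : ℝ → L2Ω} {R : ℝ≥0∞}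
    (h : bochnerSobolevNorm ⊤ T m u ≤ R) :
    ∀ᵐ t ∂(volume.restrict (Ioo 0 T)), sobolevNorm 0 1 m (u t) ≤ R := by
  unfold bochnerSobolevNorm at h
  rw [eLpNorm_exponent_top] at h
  filter_upwards [enorm_ae_le_eLpNormEssSup (fun t => sobolevNorm 0 1 m (u t))
    (volume.restrict (Ioo 0 T))] with t ht
  exact ht.trans h

/-- The bound on `eLpNorm` is a bound on a Lebesgue integral; measurability of the Sobolev norm in
time is what turns it into a.e. finiteness and integrability of a real function. -/
theorem memLp_sobolevNorm {T : ℝ} {m : ℕ} {w : ℝ → L2Ω}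
    (hw : AEStronglyMeasurable w (volume.restrict (Ioo 0 T))) {R : ℝ≥0}
    (h : bochnerSobolevNorm 2 T m w ≤ R) :
    (∀ᵐ t ∂(volume.restrict (Ioo 0 T)), sobolevNorm 0 1 m (w t) < ⊤) ∧
      MemLp (fun t => (sobolevNorm 0 1 m (w t)).toReal) 2 (volume.restrict (Ioo 0 T)) ∧
      ∫ t in Ioo 0 T, (sobolevNorm 0 1 m (w t)).toReal ^ 2 ≤ (R : ℝ) ^ 2 := by
  have hm := aemeasurable_sobolevNorm hw m
  have h1 : ∫⁻ t in Ioo 0 T, sobolevNorm 0 1 m (w t) ^ 2 ≤ (R : ℝ≥0∞) ^ 2 := by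
    unfold bochnerSobolevNorm at h
    rw [eLpNorm_eq_lintegral_rpow_enorm_toReal (by norm_num) (by norm_num)] at h
    have h2 := ENNReal.rpow_le_rpow h (z := 2) (by norm_num)
    rw [← ENNReal.rpow_mul] at h2
    simpa using h2
  have hfin : ∀ᵐ t ∂(volume.restrict (Ioo 0 T)), sobolevNorm 0 1 m (w t) < ⊤ := by
    have h2 : ∫⁻ t in Ioo 0 T, sobolevNorm 0 1 m (w t) ^ 2 ≠ ⊤ :=
      (h1.trans_lt (by finiteness)).ne
    filter_upwards [ae_lt_top' (hm.pow_const 2) h2] with t ht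
    by_contra hcon
    rw [not_lt, top_le_iff] at hcon
    simp [hcon] at ht
  have h3 : ∫⁻ t in Ioo 0 T, ENNReal.ofReal ((sobolevNorm 0 1 m (w t)).toReal ^ 2)
      = ∫⁻ t in Ioo 0 T, sobolevNorm 0 1 m (w t) ^ 2 := by
    refine lintegral_congr_ae ?_
    filter_upwards [hfin] with t ht
    rw [ENNReal.ofReal_pow ENNReal.toReal_nonneg, ENNReal.ofReal_toReal ht.ne]
  have hBm : AEStronglyMeasurable (fun t => (sobolevNorm 0 1 m (w t)).toReal)
      (volume.restrict (Ioo 0 T)) := hm.ennreal_toReal.aestronglyMeasurable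
  have h4 : ∫ t in Ioo 0 T, (sobolevNorm 0 1 m (w t)).toReal ^ 2 ≤ (R : ℝ) ^ 2 := by
    rw [integral_eq_lintegral_of_nonneg_ae (Eventually.of_forall fun t => sq_nonneg _)
      (hBm.pow 2), h3]
    have := ENNReal.toReal_mono (by finiteness) h1
    simpa using this
  refine ⟨hfin, ?_, h4⟩
  rw [memLp_two_iff_integrable_sq hBm]
  refine ⟨hBm.pow 2, ?_⟩
  rw [hasFiniteIntegral_iff_ofReal (Eventually.of_forall fun t => sq_nonneg _), h3]
  exact h1.trans_lt (by finiteness)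

theorem le_of_sum_le {ι : Type*} [Fintype ι] {f : ι → ℝ≥0∞} {R : ℝ≥0∞} (h : ∑ i, f i ≤ R) (i : ι) :
    f i ≤ R :=
  (Finset.single_le_sum (f := f) (fun _ _ => zero_le) (Finset.mem_univ i)).trans h

/-- The continuous functions min(f, K) and f agree a.e., hence everywhere. -/
theorem le_on_Icc_of_ae_le {T K : ℝ} (hT : 0 < T) {f : ℝ → ℝ} (hf : ContinuousOn f (Icc 0 T))
    (h : ∀ᵐ t ∂(volume.restrict (Ioo 0 T)), f t ≤ K) : ∀ t ∈ Icc 0 T, f t ≤ K := by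
  intro t ht
  have h1 : EqOn (fun t => min (f t) K) f (Icc 0 T) := by
    refine eqOn_Icc_of_ae_eq_Ioo hT ?_
      (fun x hx => Filter.Tendsto.min (hf x hx) tendsto_const_nhds) hf
    filter_upwards [h] with t ht
    exact min_eq_left ht
  have h2 := h1 ht
  simp only at h2
  exact min_eq_left_iff.1 h2

/-! ### Bounds for the coefficients -/

namespace ProblemData

variable {n : ℕ} {D : ProblemData n} {T γ₀ γ₁ γ'max α'max ma Ma : ℝ} {La : ℝ≥0}

theorem b1_eq (y t : ℝ) :
    D.b1 y t = deriv D.α t / D.γ t + deriv D.γ t / D.γ t * y := by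
  unfold b1
  ring

theorem Admissible.abs_b1_le (h : D.Admissible T γ₀ γ₁ γ'max α'max ma Ma La) (hγ₀ : 0 < γ₀) {t : ℝ}
    (ht : t ∈ Ioo 0 T) :
    (∀ y ∈ Ioo (0 : ℝ) 1, |deriv D.α t / D.γ t + deriv D.γ t / D.γ t * y|
      ≤ (α'max + γ'max) / γ₀) ∧ |deriv D.γ t / D.γ t| ≤ (α'max + γ'max) / γ₀ := by
  have hγ := (h.γ_bounds t (Ioo_subset_Icc_self ht)).1
  have h1 := h.γ'_bound t ht
  have h2 := h.α'_bound t ht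
  have hγ' : 0 < D.γ t := hγ₀.trans hγ
  have e1 : |deriv D.α t / D.γ t| ≤ α'max / γ₀ := by
    rw [abs_div, abs_of_pos hγ']
    exact div_le_div₀ ((abs_nonneg _).trans h2) h2 hγ₀ hγ.le
  have e2 : |deriv D.γ t / D.γ t| ≤ γ'max / γ₀ := by
    rw [abs_div, abs_of_pos hγ']
    exact div_le_div₀ ((abs_nonneg _).trans h1) h1 hγ₀ hγ.le
  rw [add_div]
  refine ⟨fun y hy => ?_, ?_⟩
  · refine (abs_add_le _ _).trans (add_le_add e1 ?_)
    rw [abs_mul, abs_of_pos hy.1]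
    exact (mul_le_of_le_one_right (abs_nonneg _) hy.2.le).trans e2
  · have := (abs_nonneg _).trans e1
    linarith

theorem Admissible.b2_bounds (h : D.Admissible T γ₀ γ₁ γ'max α'max ma Ma La) (hγ₀ : 0 < γ₀) {t : ℝ}
    (ht : t ∈ Icc 0 T) : 1 / γ₁ ^ 2 ≤ D.b2 t ∧ D.b2 t ≤ 1 / γ₀ ^ 2 := by
  obtain ⟨h1, h2⟩ := h.γ_bounds t ht
  have hγ' : 0 < D.γ t := hγ₀.trans h1
  unfold b2
  refine ⟨one_div_le_one_div_of_le (by positivity) ?_, one_div_le_one_div_of_le (by positivity) ?_⟩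
  · exact pow_le_pow_left₀ hγ'.le h2.le 2
  · exact pow_le_pow_left₀ hγ₀.le h1.le 2

theorem norm_oneL2 : ‖oneL2‖ = 1 := by
  have h : ‖oneL2‖ ^ 2 = 1 := by
    rw [oneL2, norm_toLp_sq]
    simp
  exact (pow_eq_one_iff_of_nonneg (norm_nonneg _) two_ne_zero).1 h

/-- The functional l is γ(t) times the L² pairing with 1, a vector of norm 1. The metric on `Fin n →
ℝ` is the maximum metric, so a bound for each component is enough and no factor depending on n
appears. -/
theorem Admissible.abs_a_sub_le (h : D.Admissible T γ₀ γ₁ γ'max α'max ma Ma La) (hγ₀ : 0 < γ₀)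
    {t : ℝ} (ht : t ∈ Icc 0 T) (i : Fin n) {p q : Fin n → ℝ → ℝ} {P Q : Fin n → L2Ω}
    (hp : ∀ j, p j =ᵐ[unitMeasure] P j) (hq : ∀ j, q j =ᵐ[unitMeasure] Q j) {d : ℝ}
    (hd : ∀ j, ‖P j - Q j‖ ≤ d) (hd0 : 0 ≤ d) :
    |D.a i (fun j => D.l t (p j)) - D.a i (fun j => D.l t (q j))| ≤ La * (γ₁ * d) := by
  obtain ⟨h1, h2⟩ := h.γ_bounds t ht
  have hγ' : 0 < D.γ t := hγ₀.trans h1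
  have h3 := (h.a_lipschitz i).dist_le_mul (fun j => D.l t (p j)) (fun j => D.l t (q j))
  rw [Real.dist_eq] at h3
  refine h3.trans (mul_le_mul_of_nonneg_left ?_ La.2)
  refine (dist_pi_le_iff (mul_nonneg (hγ'.le.trans h2.le) hd0)).2 fun j => ?_
  rw [Real.dist_eq]
  unfold l
  rw [integral_congr_ae (hp j), integral_congr_ae (hq j), ← inner_oneL2, ← inner_oneL2, ← mul_sub,
    ← inner_sub_right, abs_mul, abs_of_pos hγ']
  refine mul_le_mul h2.le ?_ (abs_nonneg _) (hγ'.le.trans h2.le)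
  refine (abs_real_inner_le_norm _ _).trans ?_
  rw [norm_oneL2, one_mul]
  exact hd j

end ProblemData

/-- The weak formulation tested with a primitive, in terms of `L²` inner products. -/
theorem integral_form_eq {A B c b : ℝ} {p r : ℝ → ℝ} {P R e : L2Ω} (hp : p =ᵐ[unitMeasure] P)
    (hr : r =ᵐ[unitMeasure] R) {W dW : ℝ → ℝ} (hW : W =ᵐ[unitMeasure] primitive e)
    (hdW : dW =ᵐ[unitMeasure] e) {β : ℝ → ℝ} (hβ : ∀ y, β y = A + B * y) :
    (∫ y in Ioo (0 : ℝ) 1, p y * W y) + c * b * (∫ y in Ioo (0 : ℝ) 1, r y * dW y)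
      - (∫ y in Ioo (0 : ℝ) 1, β y * r y * W y)
      = inner ℝ P (primitiveL2 e) + c * b * inner ℝ R e
        - inner ℝ (affineMul A B R) (primitiveL2 e) := by
  rw [inner_eq_integral P, inner_eq_integral R, inner_affineMul]
  congr 1
  · congr 1
    · refine integral_congr_ae ?_
      filter_upwards [hp, hW, coeFn_primitiveL2 e] with y h1 h2 h3
      rw [h1, h2, h3]
    · congr 1
      refine integral_congr_ae ?_
      filter_upwards [hr, hdW] with y h1 h2
      rw [h1, h2]
  · refine integral_congr_ae ?_
    filter_upwards [hr, hW, coeFn_primitiveL2 e] with y h1 h2 h3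
    rw [h1, h2, h3, hβ]


/-! ### The energy estimate for the two solutions -/

theorem ProblemData.IsWeakSolution.isRegularCurve {n : ℕ} {D : ProblemData n} {T : ℝ}
    {v : Fin n → ℝ → L2Ω} (h : D.IsWeakSolution T v) {m : ℕ} (hm : 1 ≤ m) (i : Fin n) {R : ℝ≥0}
    (hR : bochnerSobolevNorm 2 T m (weakDeriv 0 T (v i)) ≤ R)
    (h0 : weakDerivNorm 0 1 1 (v i 0) < ⊤) :
    IsRegularCurve T (v i) (weakDeriv 0 T (v i))
      (fun t => (sobolevNorm 0 1 m (weakDeriv 0 T (v i) t : L2Ω)).toReal) := by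
  have hm2 := h.timeDeriv_memLp i
  obtain ⟨h1, h2, -⟩ := memLp_sobolevNorm hm2.aestronglyMeasurable hR
  refine ⟨h.continuousOn i, isWeakDeriv_weakDeriv (h.hasTimeDeriv i), hm2.integrable (by norm_num),
    ?_, integrableOn_of_memLp h2, ?_, h0, h.memH10 i⟩
  · filter_upwards [h1] with t ht
    exact (weakDerivNorm_le_sobolevNorm hm _).trans_lt ht
  · filter_upwards [h1] with t ht
    have h3 := (ofReal_norm_gradL2_le (weakDeriv 0 T (v i) t)).trans
      (weakDerivNorm_le_sobolevNorm hm _)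
    exact (ENNReal.ofReal_le_iff_le_toReal ht.ne).1 h3

section EnergyEstimate

variable {n k : ℕ} {D : ProblemData n} {T γ₀ γ₁ γ'max α'max ma Ma : ℝ} {La R₂ : ℝ≥0}

/-- The energy estimate for the difference between the semidiscrete solution and the elliptic
projection of the weak solution, at a time where both satisfy their equations. -/
theorem energy_estimate_at (hγ₀ : 0 < γ₀) (hma : 0 < ma)
    (hD : D.Admissible T γ₀ γ₁ γ'max α'max ma Ma La) (hk : 1 ≤ k) (M : Mesh k) {t : ℝ}
    (ht : t ∈ Ioo 0 T) {v w : Fin n → L2Ω} {V : Fin n → ℝ → ℝ} (hV : ∀ j, V j ∈ M.S)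
    (hv : ∀ j, MemH10 0 1 (v j)) (i : Fin n) {Vt : L2Ω} {dV : ℝ → ℝ}
    (hVt : dV =ᵐ[unitMeasure] Vt)
    (hw : w i = primitiveL2 (gradL2 (w i))) (hR : ‖gradL2 (v i)‖ ≤ R₂)
    (heqv : ∀ W : ℝ → ℝ, MemH10 0 1 W →
      (∫ y in Ioo (0 : ℝ) 1, w i y * W y)
        + D.a i (fun j => D.l t (v j)) * D.b2 t *
          (∫ y in Ioo (0 : ℝ) 1, weakDeriv 0 1 (v i) y * weakDeriv 0 1 W y)
        - (∫ y in Ioo (0 : ℝ) 1, D.b1 y t * weakDeriv 0 1 (v i) y * W y)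
        = ∫ y in Ioo (0 : ℝ) 1, D.g i y t * W y)
    (heqV : ∀ W ∈ M.S,
      (∫ y in Ioo (0 : ℝ) 1, dV y * W y)
        + D.a i (fun j => D.l t (V j)) * D.b2 t *
          (∫ y in Ioo (0 : ℝ) 1, deriv (V i) y * deriv W y)
        - (∫ y in Ioo (0 : ℝ) 1, D.b1 y t * deriv (V i) y * W y)
        = ∫ y in Ioo (0 : ℝ) 1, D.g i y t * W y) :
    2 * inner ℝ (Vt - primitiveL2 (M.gradProj (gradL2 (w i))))
        (primitiveL2 (M.nodalGrad (M.nodalValues (V i)) - M.gradProj (gradL2 (v i))))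
      ≤ ‖primitiveL2 (gradL2 (w i) - M.gradProj (gradL2 (w i)))‖ ^ 2
        + (1 + (La * γ₁ * R₂ / γ₀ ^ 2 + 2 * ((α'max + γ'max) / γ₀)) ^ 2 / (2 * (ma / γ₁ ^ 2))
            + 2 * ((α'max + γ'max) / γ₀))
          * (∑ j, (‖primitiveL2 (M.nodalGrad (M.nodalValues (V j)) - M.gradProj (gradL2 (v j)))‖
            + ‖primitiveL2 (gradL2 (v j) - M.gradProj (gradL2 (v j)))‖)) ^ 2 := by
  have htI := Ioo_subset_Icc_self ht
  obtain ⟨hγ1, hγ2⟩ := hD.γ_bounds t htI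
  have hγ₁ : 0 < γ₁ := hγ₀.trans (hγ1.trans hγ2)
  obtain ⟨hβ, hB⟩ := hD.abs_b1_le hγ₀ ht
  obtain ⟨hb1, hb2⟩ := hD.b2_bounds hγ₀ htI
  set β := (α'max + γ'max) / γ₀
  set G : Fin n → L2Ω := fun j => M.nodalGrad (M.nodalValues (V j)) with hG
  set z : Fin n → L2Ω := fun j => gradL2 (v j) with hz
  -- The sum of all ‖θ_j‖ + ‖ρ_j‖; it dominates each ‖v_j - V_j‖, through which the equations are
  -- coupled.
  set d := ∑ j, (‖primitiveL2 (G j - M.gradProj (z j))‖ + ‖primitiveL2 (z j - M.gradProj (z j))‖)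
    with hd
  have hdj : ∀ j, ‖primitiveL2 (G j - M.gradProj (z j))‖
      + ‖primitiveL2 (z j - M.gradProj (z j))‖ ≤ d := fun j =>
    Finset.single_le_sum (f := fun j => ‖primitiveL2 (G j - M.gradProj (z j))‖
      + ‖primitiveL2 (z j - M.gradProj (z j))‖) (fun j _ => by positivity) (Finset.mem_univ j)
  have hd0 : 0 ≤ d := Finset.sum_nonneg fun j _ => by positivity
  have hVG : ∀ j, V j =ᵐ[unitMeasure] primitiveL2 (G j) := fun j => by
    filter_upwards [coeFn_primitiveL2 (G j), ae_restrict_mem measurableSet_Ioo] with y hy hy'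
    rw [hy]
    exact Mesh.eq_primitive_of_mem_S (hV j) (Ioo_subset_Icc_self hy')
  have hvz : ∀ j, v j = primitiveL2 (z j) := fun j => (hv j).gradL2_spec.2.1
  have ha := hD.abs_a_sub_le hγ₀ htI i (p := fun j => v j) (q := V) (P := v)
    (fun j => ae_eq_refl _) hVG (fun j => (by
      have e1 : v j - primitiveL2 (G j) = primitiveL2 (z j - M.gradProj (z j))
          - primitiveL2 (G j - M.gradProj (z j)) := by
        rw [hvz j, map_sub, map_sub]
        abel
      rw [e1]
      refine (norm_sub_le _ _).trans ?_
      rw [add_comm]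
      exact hdj j : ‖v j - primitiveL2 (G j)‖ ≤ d)) hd0
  set e := G i - M.gradProj (z i) with he
  have heS : e ∈ M.gradSpace := M.gradSpace.sub_mem (M.nodalGrad_mem _) (M.gradProj_mem _)
  have he1 : primitive e 1 = 0 := by
    rw [he, primitive_sub _ _ (by simp), Mesh.primitive_gradProj_one hk,
      (hv i).gradL2_spec.2.2, ← Mesh.eq_primitive_of_mem_S (hV i) (by simp), (hV i).2.2.1, sub_zero]
  -- Both equations are tested with the same function θ, which lies in S_h^k and in H₀¹.
  have f1 := heqV _ (Mesh.primitive_mem_S heS he1)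
  have f2 := heqv _ (memH10_of_ae_eq_primitive (ae_eq_refl _) he1)
  rw [integral_form_eq hVt (Mesh.deriv_ae_eq_of_mem_S (hV i)) (ae_eq_refl _)
    (deriv_primitive_ae_eq e) fun y => ProblemData.b1_eq y t] at f1
  rw [integral_form_eq (ae_eq_refl _)
    (weakDeriv_ae_eq (isWeakDeriv_gradL2 (hv i).gradL2_spec.1)) (ae_eq_refl _)
    (weakDeriv_ae_eq (isWeakDeriv_primitive (ae_eq_refl _))) fun y => ProblemData.b1_eq y t, hw]
    at f2
  have hb0 : 0 ≤ D.b2 t := le_trans (by positivity) hb1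
  have hm₀ : ma / γ₁ ^ 2 ≤ D.a i (fun j => D.l t (V j)) * D.b2 t := by
    rw [div_eq_mul_one_div]
    exact mul_le_mul (hD.a_bounds i _).1 hb1 (by positivity)
      (hma.le.trans (hD.a_bounds i _).1)
  have key := energy_inequality M hβ hB hm₀ hb0 (M.nodalGrad_mem _) he1 f1 f2
  have hκ : |D.a i (fun j => D.l t (v j)) - D.a i (fun j => D.l t (V j))| * D.b2 t * ‖z i‖ * ‖e‖
      ≤ La * γ₁ * R₂ / γ₀ ^ 2 * d * ‖e‖ := by
    refine mul_le_mul_of_nonneg_right ?_ (norm_nonneg _)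
    calc |D.a i (fun j => D.l t (v j)) - D.a i (fun j => D.l t (V j))| * D.b2 t * ‖z i‖
        ≤ (La * (γ₁ * d)) * (1 / γ₀ ^ 2) * R₂ := by
          refine mul_le_mul (mul_le_mul ha hb2 hb0 ?_) hR (norm_nonneg _) ?_ <;> positivity
      _ = _ := by ring
  have hβ0 : 0 ≤ β := (abs_nonneg _).trans hB
  have habs := absorb_gradient_terms (s := ‖primitiveL2 (gradL2 (w i) - M.gradProj (gradL2 (w i)))‖)
    (κ := La * γ₁ * R₂ / γ₀ ^ 2) (m₀ := ma / γ₁ ^ 2) (β := β) (by positivity)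
    (norm_nonneg (primitiveL2 e)) (norm_nonneg e) hβ0
    ((le_add_of_nonneg_right (norm_nonneg _)).trans (hdj i))
    ((le_add_of_nonneg_left (norm_nonneg _)).trans (hdj i))
  refine le_trans ?_ habs
  refine mul_le_mul_of_nonneg_left (key.trans ?_) two_pos.le
  linarith

end EnergyEstimate

theorem sq_sum_add_le {n : ℕ} (x y : Fin n → ℝ) :
    (∑ j, (x j + y j)) ^ 2 ≤ 2 * n * (∑ j, x j ^ 2 + ∑ j, y j ^ 2) := by
  have h1 := sq_sum_le_card_mul_sum_sq (s := Finset.univ) (f := fun j => x j + y j)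
  rw [Finset.card_univ, Fintype.card_fin] at h1
  refine h1.trans ?_
  have h2 : ∑ j, (x j + y j) ^ 2 ≤ 2 * (∑ j, x j ^ 2 + ∑ j, y j ^ 2) := by
    rw [← Finset.sum_add_distrib, Finset.mul_sum]
    exact Finset.sum_le_sum fun j _ => by nlinarith [sq_nonneg (x j - y j)]
  calc (n : ℝ) * ∑ j, (x j + y j) ^ 2 ≤ n * (2 * (∑ j, x j ^ 2 + ∑ j, y j ^ 2)) := by gcongr
    _ = _ := by ring

end NonlocalFEM

/-! ### The error estimate -/

theorem theorem5 (n : ℕ) (T γ₀ γ₁ γ'max α'max ma Ma : ℝ) (La : ℝ≥0)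
    (hT : 0 < T) (hγ₀ : 0 < γ₀) (hma : 0 < ma) (R₀ R₁ R₂ R₃ R₄ : ℝ≥0) :
    ∃ C : ℝ, ∀ (D : ProblemData n), D.Admissible T γ₀ γ₁ γ'max α'max ma Ma La →
      ∀ (v : Fin n → ℝ → L2Ω), D.IsWeakSolution T v →
      ∀ k : ℕ, 1 ≤ k →
      ∑ i, sobolevNorm 0 1 (k + 1) (D.v0 i) ≤ R₀ →
      ∑ i, bochnerSobolevNorm ⊤ T (k + 1) (v i) ≤ R₁ →
      ∑ i, eLpNorm (fun t => eLpNorm (weakDeriv 0 1 (v i t)) 2 (volume.restrict (Ioo 0 1))) ⊤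
        (volume.restrict (Ioo 0 T)) ≤ R₂ →
      ∑ i, bochnerSobolevNorm 2 T (k + 1) (v i) ≤ R₃ →
      ∑ i, bochnerSobolevNorm 2 T (k + 1) (weakDeriv 0 T (v i)) ≤ R₄ →
      ∀ (M : Mesh k) (V : Fin n → ℝ → ℝ → ℝ), IsSemidiscreteSolution D T M V →
      ∀ i, ∀ t ∈ Ioc 0 T,
        eLpNorm (fun y => V i t y - v i t y) 2 (volume.restrict (Ioo 0 1))
          ≤ ENNReal.ofReal (C * M.h ^ (k + 1)) := by
  -- `K₀` is the factor of d² in the energy estimate of one equation. In `K`, one factor n counts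
  -- the equations and 2n comes from d² ≤ 2n ∑ (‖θ_j‖² + ‖ρ_j‖²). `C₁` collects the initial error
  -- (R₀), the time derivative of ρ (R₄) and ρ itself (R₁).
  set K₀ : ℝ := 1 + (La * γ₁ * R₂ / γ₀ ^ 2 + 2 * ((α'max + γ'max) / γ₀)) ^ 2 / (2 * (ma / γ₁ ^ 2))
    + 2 * ((α'max + γ'max) / γ₀) with hK₀
  set K : ℝ := n * (K₀ * (2 * n)) with hK
  set C₁ : ℝ := Real.exp (K * T) * (n * (2 * R₀) ^ 2 + (n * (R₄ : ℝ) ^ 2 + K * (n * (R₁ : ℝ) ^ 2) * T))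
    with hC₁
  refine ⟨√C₁ + R₁, ?_⟩
  intro D hD v hv k hk hR₀ hR₁ hR₂ _ hR₄ M V hV
  set H := M.h ^ (k + 1) with hH
  have hH0 : 0 ≤ H := pow_nonneg M.h_nonneg _
  -- No sign is assumed for the bounds on α' and γ'; the bounds at any interior time force their sum
  -- to be nonnegative.
  have hmid : T / 2 ∈ Ioo 0 T := ⟨by linarith, by linarith⟩
  have hβ0 : 0 ≤ (α'max + γ'max) / γ₀ := (abs_nonneg _).trans (hD.abs_b1_le hγ₀ hmid).2
  have hK₀0 : 0 ≤ K₀ := by positivity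
  have hK0 : 0 ≤ K := by positivity
  have hR₀' : ∀ i, sobolevNorm 0 1 (k + 1) (D.v0 i) ≤ R₀ := fun i => le_of_sum_le hR₀ i
  have hR₁' : ∀ i, ∀ᵐ t ∂(volume.restrict (Ioo 0 T)), sobolevNorm 0 1 (k + 1) (v i t) ≤ R₁ :=
    fun i => ae_sobolevNorm_le (le_of_sum_le hR₁ i)
  have hR₄' := fun i => le_of_sum_le hR₄ i
  have hR₂' : ∀ i, ∀ᵐ t ∂(volume.restrict (Ioo 0 T)),
      eLpNorm (weakDeriv 0 1 (v i t)) 2 unitMeasure ≤ R₂ := fun i => by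
    have h1 := le_of_sum_le hR₂ i
    rw [eLpNorm_exponent_top] at h1
    filter_upwards [enorm_ae_le_eLpNormEssSup
      (fun t => eLpNorm (weakDeriv 0 1 (v i t)) 2 unitMeasure) (volume.restrict (Ioo 0 T))]
      with t ht
    exact ht.trans h1
  have hv0c : ∀ i, ContinuousOn (D.v0 i) (Icc 0 1) := fun i => by
    have h0 : (0 : ℝ) ∈ Icc 0 T := left_mem_Icc.2 hT.le
    have hγ : 0 < D.γ 0 := hγ₀.trans (hD.γ_bounds 0 h0).1
    refine (hD.u0_cont i).comp (Continuous.continuousOn (by fun_prop)) fun y hy => ?_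
    have hβα : D.β 0 = D.α 0 + D.γ 0 * 1 := by simp [ProblemData.γ]
    refine ⟨by have := mul_nonneg hγ.le hy.1; linarith, ?_⟩
    rw [hβα]
    have := mul_le_mul_of_nonneg_left hy.2 hγ.le
    linarith
  have hinit := fun i => M.initial_error hk (hV.initial i) (hv0c i) (hv.initial i)
    ((hR₀' i).trans_lt ENNReal.coe_lt_top)
  have hreg := fun i => hv.isRegularCurve (m := k + 1) (by omega) i (hR₄' i) (hinit i).1
  have hcurve := fun i => (hreg i).exists_error_curve hT M (hV.mem i) (hV.absolutelyContinuous i)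
  choose F hFAC hF0 hF using hcurve
  have hB := fun i => memLp_sobolevNorm (hv.timeDeriv_memLp i).aestronglyMeasurable (hR₄' i)
  set B : Fin n → ℝ → ℝ := fun i t => (sobolevNorm 0 1 (k + 1) (weakDeriv 0 T (v i) t : L2Ω)).toReal
  set b : ℝ → ℝ := fun t => H ^ 2 * (∑ i, B i t ^ 2 + K * (n * (R₁ : ℝ) ^ 2)) with hb
  have hBint : ∀ i, IntegrableOn (fun t => B i t ^ 2) (Ioo 0 T) := fun i => (hB i).2.1.integrable_sq
  have hBsum : IntegrableOn (fun t => ∑ i, B i t ^ 2) (Ioo 0 T) :=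
    integrable_finsetSum _ fun i _ => hBint i
  have hconst : IntegrableOn (fun _ : ℝ => K * (n * (R₁ : ℝ) ^ 2)) (Ioo 0 T) :=
    integrableOn_const (by simp)
  have hbint : IntegrableOn b (Ioo 0 T) := (hBsum.add hconst).const_mul _
  have hb_le : ∫ t in Ioo 0 T, b t
      ≤ H ^ 2 * (n * (R₄ : ℝ) ^ 2 + K * (n * (R₁ : ℝ) ^ 2) * T) := by
    simp only [hb]
    rw [integral_const_mul, integral_add hBsum hconst, integral_finsetSum _ fun i _ => hBint i]
    refine mul_le_mul_of_nonneg_left (add_le_add ?_ ?_) (sq_nonneg _)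
    · refine (Finset.sum_le_sum fun i _ => (hB i).2.2).trans ?_
      simp
    · simp [hT.le, mul_comm]
  have hρ : ∀ i, ∀ᵐ t ∂(volume.restrict (Ioo 0 T)),
      ‖primitiveL2 (gradL2 (v i t) - M.gradProj (gradL2 (v i t)))‖ ≤ H * R₁ := fun i => by
    filter_upwards [hR₁' i] with t ht
    refine (M.norm_primitiveL2_gradL2_sub_le hk (ht.trans_lt ENNReal.coe_lt_top)).trans ?_
    exact mul_le_mul_of_nonneg_left (ENNReal.toReal_mono ENNReal.coe_ne_top ht) hH0
  have hFsum : AbsolutelyContinuousOnInterval (fun t => ∑ i, F i t) 0 T :=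
    AbsolutelyContinuousOnInterval.finset_sum _ fun i _ => hFAC i
  have hderiv : ∀ᵐ t ∂(volume.restrict (Ioo 0 T)),
      deriv (fun t => ∑ i, F i t) t ≤ K * (∑ i, F i t) + b t := by
    filter_upwards [ae_all_iff.2 hF, ae_all_iff.2 hρ, ae_all_iff.2 hR₂',
      ae_all_iff.2 fun i => ae_Ioo_of_ae_Icc hT.le (hFAC i), ae_all_iff.2 hv.memH10,
      ae_all_iff.2 hv.equation, ae_all_iff.2 hV.equation, ae_all_iff.2 fun i => (hB i).1,
      ae_all_iff.2 fun i => (hreg i).ae_eq_primitiveL2 hT, ae_restrict_mem measurableSet_Ioo]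
      with t h1 h2 h3 h4 h5 h6 h7 h8 h9 ht
    choose h1F Vt hVt hdF using h1
    rw [deriv_fun_sum fun i _ => h4 i]
    set d := ∑ j, (‖primitiveL2 (M.nodalGrad (M.nodalValues (V j t))
      - M.gradProj (gradL2 (v j t)))‖
        + ‖primitiveL2 (gradL2 (v j t) - M.gradProj (gradL2 (v j t)))‖) with hd
    have hone : ∀ i, deriv (F i) t ≤ H ^ 2 * B i t ^ 2 + K₀ * d ^ 2 := fun i => by
      have hz : ‖gradL2 (v i t)‖ ≤ R₂ := by
        have h10 := h3 i
        rw [eLpNorm_congr_ae (weakDeriv_ae_eq (isWeakDeriv_gradL2 (h5 i).gradL2_spec.1)),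
          eLpNorm_eq_ofReal_norm] at h10
        simpa using (ENNReal.ofReal_le_iff_le_toReal ENNReal.coe_ne_top).1 h10
      have h11 := energy_estimate_at hγ₀ hma hD hk M ht (v := fun j => v j t)
        (w := fun j => weakDeriv 0 T (v j) t) (V := fun j => V j t)
        (fun j => hV.mem j t (Ioo_subset_Icc_self ht)) h5 i (hVt i) (h9 i) hz (h6 i) (h7 i)
      rw [hdF i]
      refine h11.trans (add_le_add ?_ le_rfl)
      rw [← mul_pow]
      exact pow_le_pow_left₀ (norm_nonneg _) (M.norm_primitiveL2_gradL2_sub_le hk (h8 i)) 2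
    have hd2 : d ^ 2 ≤ 2 * n * (∑ i, F i t + n * (H * R₁) ^ 2) := by
      refine (sq_sum_add_le _ _).trans ?_
      refine mul_le_mul_of_nonneg_left (add_le_add (le_of_eq ?_) ?_) (by positivity)
      · exact Finset.sum_congr rfl fun i _ => (h1F i).symm
      · refine (Finset.sum_le_sum fun i _ =>
          pow_le_pow_left₀ (norm_nonneg _) (h2 i) 2).trans ?_
        simp
    calc ∑ i, deriv (F i) t ≤ ∑ i, (H ^ 2 * B i t ^ 2 + K₀ * d ^ 2) :=
          Finset.sum_le_sum fun i _ => hone i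
      _ = H ^ 2 * ∑ i, B i t ^ 2 + n * (K₀ * d ^ 2) := by
          rw [Finset.sum_add_distrib, ← Finset.mul_sum]
          simp
      _ ≤ H ^ 2 * ∑ i, B i t ^ 2
          + n * (K₀ * (2 * n * (∑ i, F i t + n * (H * R₁) ^ 2))) := by gcongr
      _ = K * (∑ i, F i t) + b t := by
          simp only [hb, hK]
          ring
  have hF0' : ∑ i, F i 0 ≤ n * (2 * (H * R₀)) ^ 2 := by
    have h1 : ∀ i, F i 0 ≤ (2 * (H * R₀)) ^ 2 := fun i => by
      rw [hF0 i]
      refine pow_le_pow_left₀ (norm_nonneg _) ((hinit i).2.2.trans ?_) 2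
      refine mul_le_mul_of_nonneg_left (mul_le_mul_of_nonneg_left ?_ hH0) two_pos.le
      exact ENNReal.toReal_mono ENNReal.coe_ne_top (hR₀' i)
    refine (Finset.sum_le_sum fun i _ => h1 i).trans ?_
    simp
  have hF0n : 0 ≤ ∑ i, F i 0 := Finset.sum_nonneg fun i _ => by
    rw [hF0 i]
    positivity
  have hgron := AbsolutelyContinuousOnInterval.gronwall hT.le hK0 hFsum hF0n hbint
    (fun t => by positivity) hderiv
  have hFle : ∀ t ∈ Icc 0 T, ∑ i, F i t ≤ H ^ 2 * C₁ := fun t ht => by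
    refine (hgron t ht).trans ?_
    calc Real.exp (K * T) * (∑ i, F i 0 + ∫ s in Ioo 0 T, b s)
        ≤ Real.exp (K * T) * (n * (2 * (H * R₀)) ^ 2
          + H ^ 2 * (n * (R₄ : ℝ) ^ 2 + K * (n * (R₁ : ℝ) ^ 2) * T)) := by gcongr
      _ = H ^ 2 * C₁ := by rw [hC₁]; ring
  intro i t ht
  set Vc : ℝ → L2Ω := fun t => primitiveL2 (M.nodalGrad (M.nodalValues (V i t))) with hVc
  have hVcont : ContinuousOn Vc (Icc 0 T) := by
    refine primitiveL2.continuous.comp_continuousOn ?_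
    refine (LinearMap.continuous_of_finiteDimensional M.nodalGrad).comp_continuousOn ?_
    refine continuousOn_pi.2 fun j => continuousOn_pi.2 fun l => ?_
    have := (hV.absolutelyContinuous i _ (M.Icc_subset j (M.P_mem j l))).continuousOn
    rwa [uIcc_of_le hT.le] at this
  -- V - v = θ - ρ: Gronwall's inequality gives √C₁ for θ, the elliptic projection gives R₁ for ρ.
  have hbound : ∀ᵐ t ∂(volume.restrict (Ioo 0 T)), ‖Vc t - v i t‖ ≤ (√C₁ + R₁) * H := by
    filter_upwards [ae_all_iff.2 hF, hρ i, hv.memH10 i, ae_restrict_mem measurableSet_Ioo]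
      with s h1 h2 h3 hs
    have e1 : Vc s - v i s
        = primitiveL2 (M.nodalGrad (M.nodalValues (V i s)) - M.gradProj (gradL2 (v i s)))
          - primitiveL2 (gradL2 (v i s) - M.gradProj (gradL2 (v i s))) := by
      nth_rewrite 1 [h3.gradL2_spec.2.1]
      rw [map_sub, map_sub]
      abel
    have e2 : ‖primitiveL2 (M.nodalGrad (M.nodalValues (V i s)) - M.gradProj (gradL2 (v i s)))‖
        ≤ H * √C₁ := by
      have h4 : F i s ≤ H ^ 2 * C₁ := by
        refine le_trans ?_ (hFle s (Ioo_subset_Icc_self hs))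
        refine Finset.single_le_sum (f := fun i => F i s) (fun j _ => ?_) (Finset.mem_univ i)
        rw [(h1 j).1]
        positivity
      rw [(h1 i).1] at h4
      have h5 := Real.le_sqrt_of_sq_le h4
      rwa [Real.sqrt_mul (sq_nonneg _), Real.sqrt_sq hH0] at h5
    rw [e1]
    refine (norm_sub_le _ _).trans ?_
    linarith
  -- The a.e. bound on θ and ρ separately says nothing at a given time, but their difference is
  -- continuous in L², so the bound holds at every time, `T` included.
  have hfin := le_on_Icc_of_ae_le hT ((hVcont.sub (hv.continuousOn i)).norm) hbound t
    (Ioc_subset_Icc_self ht)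
  have hcongr : (fun y => V i t y - v i t y) =ᵐ[unitMeasure] (Vc t - v i t : L2Ω) := by
    filter_upwards [Lp.coeFn_sub (Vc t) (v i t),
      coeFn_primitiveL2 (M.nodalGrad (M.nodalValues (V i t))), ae_restrict_mem measurableSet_Ioo]
      with y h1 h2 h3
    rw [h1, Pi.sub_apply, hVc, h2]
    rw [← Mesh.eq_primitive_of_mem_S (hV.mem i t (Ioc_subset_Icc_self ht)) (Ioo_subset_Icc_self h3)]
  rw [eLpNorm_congr_ae hcongr, eLpNorm_eq_ofReal_norm]
  exact ENNReal.ofReal_le_ofReal hfin
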